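/- A \emph{vertical plane} is a pair $(\mathcal P,\pi)$, where $\mathcal P$ is an (oriented) topological space homeomorphic to $\mathbb R^2$ and $\pi:\mathcal P\to\mathbb R$ is a locally trivial topological fibration. A \emph{domain of finite type} in $(\mathcal P,\pi)$ is a closed subset $\mathcal D\subset\mathcal P$ homeomorphic to a surface with non-empty boundary $\mathcal C$, such that $\pi|_{\mathcal D}$ is proper and such that the set $\Sigma$ of topological critical points of $\pi|_{\mathcal C}$ is finite; here $p\in\mathcal C$ is a topological critical point if no neighbourhood of $p$ in $\mathcal C$ is mapped by $\pi$ homeomorphically onto its image. Let $\rho:\mathcal P\to\tilde{\mathcal P}$ be the quotient map that collapses each connected component of each fibre of $\pi|_{\mathcal D}$ to a point, let $\tilde\pi:\tilde{\mathcal P}\to\mathbb R$ be induced by $\pi$, and let $\tilde{\mathcal D}=\rho(\mathcal D)$ be the \emph{Poincaré–Reeb set}. Its \emph{vertices} are the points of $\rho(\Sigma)$. A \emph{critical segment} is a connected component of a fibre of $\pi|_{\mathcal D}$ that meets $\Sigma$; a \emph{band} is the closure of a connected component of the complement in $\mathcal D$ of the union of the critical segments; an \emph{edge} of $\tilde{\mathcal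 D}$ is the image $\rho(R)$ of a band $R$, and an \emph{open edge} is an edge with the vertices removed. A \emph{closed segment} of $\mathbb R$ is a closed interval, possibly unbounded, with more than one point; an \emph{open segment} is a non-empty open interval, possibly unbounded. A \emph{transversal graph} in a vertical plane $(\mathcal Q,\pi')$ is a closed subset $G\subset\mathcal Q$ partitioned into finitely many points (vertices) and finitely many subsets homeomorphic to open segments (open edges), such that: for each open edge $E$, the closure $\overline E$ (an edge) is homeomorphic to a closed segment, $\overline E\setminus E$ consists of $0$, $1$ or $2$ vertices, and $\pi'|_{\overline E}$ is a homeomorphism onto its image; and $\pi'|_G$ is proper. The \emph{valency} of a vertex is the number of edges ending at it. \textbf{Proposition.} Let $\mathcal D$ be a domain of finite type in a vertical plane $(\mathcal P,\pi)$. Then each edge of the Poincaré–Reeb set $\tilde{\mathcal D}$ is homeomorphic to a closed segment of $\mathbb R$. Moreover $(\tilde{\mathcal P},\tilde\pi)$ is a vertical plane and, endowed with its vertices and open edges, $\tilde{\mathcal D}$ is a transversal graph in it, whose edges (the closures of the open edges) are exactly the edges of $\tilde{\mathcal D}$ defined above, and which has no vertex of valency $2$. -/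

import Mathlib

open Set Topology

namespace PoincareReeb

/-- `(P, π)` is a vertical plane: `P` is homeomorphic to `ℝ²` and `π : P → ℝ` is a locally trivial
topological fibration, that is, every `x : ℝ` has an open neighbourhood over which `π` is
isomorphic to a product with the fibre over `x`. (A choice of orientation of `P` is extra data
that none of the notions below uses.) -/
structure IsVerticalPlane {P : Type*} [TopologicalSpace P] (π : P → ℝ) : Prop where
  homeomorphic_plane : Nonempty (P ≃ₜ ℝ × ℝ)
  locally_trivial : ∀ x : ℝ, ∃ e : Bundle.Trivialization (π ⁻¹' {x}) π, x ∈ e.baseSet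

/-- A topological surface with (possibly empty) boundary. -/
structure IsSurface (X : Type*) [TopologicalSpace X] : Prop where
  t2 : T2Space X
  secondCountable : SecondCountableTopology X
  exists_chart : ∀ x : X, ∃ φ : OpenPartialHomeomorph X (EuclideanHalfSpace 2), x ∈ φ.source

/-- The boundary of a topological surface: the points that some chart sends to the boundary line
of the half-plane. -/
def surfaceBoundary (X : Type*) [TopologicalSpace X] : Set X :=
  {x | ∃ φ : OpenPartialHomeomorph X (EuclideanHalfSpace 2), x ∈ φ.source ∧ (φ x).1 0 = 0}

section

variable {P : Type*} [TopologicalSpace P]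

/-- The boundary `C` of a subset `D` of `P` which is a surface, as a subset of `P`. -/
def boundaryCurve (D : Set P) : Set P :=
  Subtype.val '' surfaceBoundary D

/-- The topological critical set of a curve `C`: the points of `C` no neighbourhood of which in
`C` is mapped by `π` homeomorphically onto its image. -/
def topCriticalSet (π : P → ℝ) (C : Set P) : Set P :=
  {p | p ∈ C ∧ ¬ ∃ U ∈ 𝓝 p, IsEmbedding ((C ∩ U).domRestrict π)}

/-- Domains of finite type in a vertical plane `(P, π)`. -/
structure IsDomainOfFiniteType (π : P → ℝ) (D : Set P) : Prop where
  isClosed : IsClosed D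
  isSurface : IsSurface D
  boundary_nonempty : (boundaryCurve D).Nonempty
  proper : IsProperMap (D.domRestrict π)
  finite_topCriticalSet : (topCriticalSet π (boundaryCurve D)).Finite

/-- The connected component of `p` in the fibre of `π|_D` through `p` (empty if `p ∉ D`). -/
def fiberComponent (π : P → ℝ) (D : Set P) (p : P) : Set P :=
  connectedComponentIn (π ⁻¹' {π p} ∩ D) p

/-- Vertical equivalence relative to `D`. -/
def VertEquiv (π : P → ℝ) (D : Set P) (p q : P) : Prop :=
  π p = π q ∧ (q ∈ fiberComponent π D p ∨ (p = q ∧ p ∉ D))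

theorem vertEquiv_equivalence (π : P → ℝ) (D : Set P) : Equivalence (VertEquiv π D) where
  refl p := by
    refine ⟨rfl, ?_⟩
    by_cases h : p ∈ D
    · exact Or.inl (mem_connectedComponentIn ⟨rfl, h⟩)
    · exact Or.inr ⟨rfl, h⟩
  symm := by
    rintro p q ⟨h, h' | ⟨rfl, h'⟩⟩
    · refine ⟨h.symm, Or.inl ?_⟩
      have hp : p ∈ π ⁻¹' {π p} ∩ D :=
        mem_of_mem_of_subset (mem_connectedComponentIn (connectedComponentIn_nonempty_iff.1 ⟨q, h'⟩))
          (connectedComponentIn_subset _ _)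
      unfold fiberComponent at h' ⊢
      rw [← h, ← connectedComponentIn_eq h']
      exact mem_connectedComponentIn hp
    · exact ⟨rfl, Or.inr ⟨rfl, h'⟩⟩
  trans := by
    rintro p q r ⟨h, h' | ⟨rfl, h'⟩⟩ ⟨k, k' | ⟨rfl, k'⟩⟩
    · refine ⟨h.trans k, Or.inl ?_⟩
      unfold fiberComponent at h' k' ⊢
      rw [← h, ← connectedComponentIn_eq h'] at k'
      exact k'
    · exact ⟨h, Or.inl h'⟩
    · exact ⟨k, Or.inl k'⟩
    · exact ⟨rfl, Or.inr ⟨rfl, h'⟩⟩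

/-- Vertical equivalence relative to `D`, as a setoid. -/
def collapseSetoid (π : P → ℝ) (D : Set P) : Setoid P :=
  ⟨VertEquiv π D, vertEquiv_equivalence π D⟩

/-- The `D`-collapse of `P`, with the quotient topology. -/
abbrev Collapse (π : P → ℝ) (D : Set P) : Type _ :=
  Quotient (collapseSetoid π D)

/-- The collapsing map relative to `D`. -/
def collapseMap (π : P → ℝ) (D : Set P) : P → Collapse π D :=
  Quotient.mk (collapseSetoid π D)

/-- The map from the `D`-collapse of `P` to `ℝ` induced by `π`. -/
def collapseProj (π : P → ℝ) (D : Set P) : Collapse π D → ℝ :=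
  Quotient.lift π fun _ _ h => h.1

/-- The Poincaré–Reeb set of `D`. -/
def reebSet (π : P → ℝ) (D : Set P) : Set (Collapse π D) :=
  collapseMap π D '' D

/-- The vertices of the Poincaré–Reeb set. -/
def reebVertices (π : P → ℝ) (D : Set P) : Set (Collapse π D) :=
  collapseMap π D '' topCriticalSet π (boundaryCurve D)

/-- The critical segments of `D`: the connected components of fibres of `π|_D` which contain a
topological critical point of the boundary. -/
def criticalSegments (π : P → ℝ) (D : Set P) : Set (Set P) :=
  {S | (∃ p ∈ D, S = fiberComponent π D p) ∧ (S ∩ topCriticalSet π (boundaryCurve D)).Nonempty}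

/-- The bands of `D`: the closures of the connected components of the complement in `D` of the
union of the critical segments. -/
def bands (π : P → ℝ) (D : Set P) : Set (Set P) :=
  {R | ∃ p ∈ D \ ⋃₀ criticalSegments π D,
    R = closure (connectedComponentIn (D \ ⋃₀ criticalSegments π D) p)}

/-- The edges of the Poincaré–Reeb set. -/
def reebEdges (π : P → ℝ) (D : Set P) : Set (Set (Collapse π D)) :=
  (fun R => collapseMap π D '' R) '' bands π D

/-- The open edges of the Poincaré–Reeb set: its edges with the vertices removed. -/
def reebOpenEdges (π : P → ℝ) (D : Set P) : Set (Set (Collapse π D)) :=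
  (fun e => e \ reebVertices π D) '' reebEdges π D

/-- `e` is homeomorphic to a closed segment of `ℝ`: a closed, possibly unbounded, interval which
is not empty and not a point. -/
def IsClosedSegment (e : Set P) : Prop :=
  ∃ I : Set ℝ, IsClosed I ∧ I.OrdConnected ∧ I.Nontrivial ∧ Nonempty (e ≃ₜ I)

/-- `e` is homeomorphic to an open segment of `ℝ`: a non-empty, possibly unbounded, open
interval. -/
def IsOpenSegment (e : Set P) : Prop :=
  ∃ I : Set ℝ, IsOpen I ∧ I.OrdConnected ∧ I.Nonempty ∧ Nonempty (e ≃ₜ I)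

/-- `G`, partitioned into the points of `V` (vertices) and the members of `E` (open edges), is a
transversal graph with respect to the projection `π`. The edges are the closures of the open
edges. -/
structure IsTransversalGraph (π : P → ℝ) (G V : Set P) (E : Set (Set P)) : Prop where
  isClosed : IsClosed G
  finite_vertices : V.Finite
  finite_openEdges : E.Finite
  union_eq : V ∪ ⋃₀ E = G
  openEdges_disjoint : E.PairwiseDisjoint id
  disjoint_vertices : ∀ e ∈ E, Disjoint e V
  openEdge_segment : ∀ e ∈ E, IsOpenSegment e
  edge_segment : ∀ e ∈ E, IsClosedSegment (closure e)
  ends_subset : ∀ e ∈ E, closure e \ e ⊆ V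
  ends_card : ∀ e ∈ E, (closure e \ e).encard ≤ 2
  transversal : ∀ e ∈ E, IsEmbedding ((closure e).domRestrict π)
  proper : IsProperMap (G.domRestrict π)

/-- The valency of `v` in a graph with set of open edges `E`: the number of edges ending at `v`.
(In a transversal graph no edge is a loop.) -/
noncomputable def valency (E : Set (Set P)) (v : P) : ℕ∞ :=
  {e | e ∈ E ∧ v ∈ closure e}.encard

end

end PoincareReeb

open PoincareReeb

/-! A fibration of the plane over the line is trivial with fibre the line, so `π` may be taken to be
the first projection of `ℝ × ℝ` (`IsVerticalPlane.exists_homeomorph`), and `D` becomes a closed set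
`A`. The topology of the plane enters through invariance of domain, proved with logarithms: an odd
nowhere vanishing function on the circle has none. It shows that the factor `F` of a plane `F × ℝ`
is a line, and that the boundary of the surface is its frontier.

The collapse is made explicit by replacing the height of a point with `outerHeight`, the signed
length of the part of the vertical segment from `(x, 0)` that lies outside `A`. This is constant
exactly along the vertical segments in `A`, continuous because the frontier meets each vertical line
in a countable set, and proper and onto because `A` is proper over the line. So the quotient is
again a plane fibred over the same line.

Near each of its points the frontier consists of two graphs issuing from that point: on opposite
sides of the vertical line at a noncritical point, on the same side at a critical one. Hence a fibre
component without critical points has a neighbourhood in `A` made of vertical segments, and the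
Poincaré–Reeb set is there the image of a section. A closed set with finite fibres, proper over the
line, that is locally a section away from finitely many points is a transversal graph
(`isTransversalGraph_of_hasLocalSections`). At a critical point `A` lies either between the two
graphs, and then at most one edge ends at the vertex, or outside them, and then at least three do.
Finally, the collapsing map is closed with connected fibres, so it matches components upstairs with
components downstairs, hence bands with edges. -/

namespace PoincareReeb

/-! ### Logarithms and invariance of domain in the plane -/

section Fibration

open scoped unitInterval

/-- Continuous logarithms extend along homotopies of nowhere vanishing functions. -/
theorem exists_log_of_homotopy {X : Type*} [TopologicalSpace X] (H : C(I × X, ℂ))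
    (hH : ∀ p, H p ≠ 0) (L₀ : C(X, ℂ)) (hL₀ : ∀ x, Complex.exp (L₀ x) = H (0, x)) :
    ∃ L : C(X, ℂ), ∀ x, Complex.exp (L x) = H (1, x) := by
  let H' : C(I × X, {z : ℂ // z ≠ 0}) := ⟨fun p => ⟨H p, hH p⟩, by fun_prop⟩
  have h0 : ∀ x, H' (0, x) = (fun z : ℂ ↦ (⟨_, z.exp_ne_zero⟩ : {z : ℂ // z ≠ 0})) (L₀ x) :=
    fun x => Subtype.ext (hL₀ x).symm
  let K := Complex.isCoveringMap_exp.liftHomotopy H' L₀ h0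
  refine ⟨⟨fun x => K (1, x), by fun_prop⟩, fun x => ?_⟩
  have := congrFun (Complex.isCoveringMap_exp.liftHomotopy_lifts H' L₀ h0) (1, x)
  exact congrArg Subtype.val this

/-- A nowhere vanishing function on a contractible space has a continuous logarithm. -/
theorem exists_log_of_contractible {X : Type*} [TopologicalSpace X] [ContractibleSpace X]
    (G : C(X, ℂ)) (hG : ∀ x, G x ≠ 0) : ∃ L : C(X, ℂ), ∀ x, Complex.exp (L x) = G x := by
  obtain ⟨y, ⟨h⟩⟩ := id_nullhomotopic X
  let h' := h.symm
  obtain ⟨L, hL⟩ := exists_log_of_homotopy (G.comp h'.toContinuousMap) (fun p => hG _)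
    (ContinuousMap.const X (Complex.log (G y))) (fun x => by
      have : h' (0, x) = y := by simp [h']
      change Complex.exp (Complex.log (G y)) = G (h' (0, x))
      rw [this, Complex.exp_log (hG y)])
  refine ⟨L, fun x => (hL x).trans ?_⟩
  change G (h' (1, x)) = G x
  simp [h']

/-- The difference `f z - f (-z)` of values at antipodal points of the circle, if it does not
vanish, has no continuous logarithm. -/
theorem not_exists_log_odd (u : Metric.sphere (0 : ℂ) 1 → ℂ) (hu : ∀ z, u (-z) = -u z) :
    ¬ ∃ L : C(Metric.sphere (0 : ℂ) 1, ℂ), ∀ z, Complex.exp (L z) = u z := by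
  rintro ⟨L, hL⟩
  have hconn : ConnectedSpace (Metric.sphere (0 : ℂ) 1) := by
    refine Subtype.connectedSpace (isConnected_sphere ?_ 0 zero_le_one)
    rw [Complex.rank_real_complex]; norm_num
  -- Oddness of `u` gives `exp (k z) = -1`. The imaginary part of `k` is odd, so it vanishes
  -- somewhere on the connected circle, and there `exp (k z)` would be a positive real.
  let k : Metric.sphere (0 : ℂ) 1 → ℂ := fun z => L z - L (-z)
  have hk : ∀ z, Complex.exp (k z) = -1 := fun z => by
    have h0 : u z ≠ 0 := hL z ▸ Complex.exp_ne_zero _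
    simp only [k, Complex.exp_sub, hL, hu]
    field_simp
  have hkc : Continuous fun z => (k z).im := by
    have : Continuous fun z : Metric.sphere (0 : ℂ) 1 => L (-z) := L.continuous.comp continuous_neg
    fun_prop
  have hodd : ∀ z, (k (-z)).im = -(k z).im := fun z => by simp [k]
  let z₀ : Metric.sphere (0 : ℂ) 1 := ⟨1, by simp⟩
  obtain ⟨z, hz⟩ : ∃ z, (k z).im = 0 := by
    rcases le_total (k z₀).im 0 with h | h
    · exact mem_range_of_exists_le_of_exists_ge hkc ⟨z₀, h⟩ ⟨-z₀, by rw [hodd]; linarith⟩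
    · exact mem_range_of_exists_le_of_exists_ge hkc ⟨-z₀, by rw [hodd]; linarith⟩ ⟨z₀, h⟩
  have h1 := congrArg Complex.re (hk z)
  rw [Complex.exp_re, hz, Real.cos_zero] at h1
  have := Real.exp_pos (k z).re
  simp at h1
  linarith

/-- If a value `y` near `f 0` were missed, `f - y` would have a logarithm on the disk, hence on the
circle. There it deforms without zeros to `f - f 0`, by moving `y`, and then to `f z - f (-z)`, by
moving the second argument from the centre to the antipode. This last function is odd and has no
logarithm. -/
theorem image_closedBall_mem_nhds {f : ℂ → ℂ} (hf : ContinuousOn f (Metric.closedBall 0 1))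
    (hi : InjOn f (Metric.closedBall 0 1)) : f '' Metric.closedBall 0 1 ∈ 𝓝 (f 0) := by
  have hSB : Metric.sphere (0 : ℂ) 1 ⊆ Metric.closedBall 0 1 := Metric.sphere_subset_closedBall
  have hK : IsCompact (f '' Metric.sphere (0 : ℂ) 1) :=
    (isCompact_sphere _ _).image_of_continuousOn (hf.mono hSB)
  have h0 : f 0 ∉ f '' Metric.sphere (0 : ℂ) 1 := by
    rintro ⟨z, hz, h⟩
    rw [hi (hSB hz) (by simp) h] at hz
    simp at hz
  obtain ⟨ε, hε, hdisj⟩ := Metric.mem_nhds_iff.1 (hK.isClosed.isOpen_compl.mem_nhds h0)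
  refine Filter.mem_of_superset (Metric.ball_mem_nhds _ hε) fun y hy => ?_
  by_contra hyf
  have : ContractibleSpace (Metric.closedBall (0 : ℂ) 1) :=
    (convex_closedBall _ _).contractibleSpace ⟨0, by simp⟩
  obtain ⟨L, hL⟩ := exists_log_of_contractible
    (⟨fun z : Metric.closedBall (0 : ℂ) 1 => f z - y,
      (continuousOn_iff_continuous_domRestrict.1 hf).sub continuous_const⟩ :
      C(Metric.closedBall (0 : ℂ) 1, ℂ))
    (fun z => sub_ne_zero.2 fun h => hyf ⟨z, z.2, h⟩)
  have hfS : Continuous fun z : Metric.sphere (0 : ℂ) 1 => f z :=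
    continuousOn_iff_continuous_domRestrict.1 (hf.mono hSB)
  obtain ⟨L₁, hL₁⟩ := exists_log_of_homotopy
    (⟨fun p : I × Metric.sphere (0 : ℂ) 1 => f p.2 - (y + ((p.1 : ℝ) : ℂ) * (f 0 - y)),
      (hfS.comp continuous_snd).sub (by fun_prop)⟩ : C(I × Metric.sphere (0 : ℂ) 1, ℂ))
    (fun p => sub_ne_zero.2 fun h => hdisj (a := f p.2) (by
      rw [h]
      have := (convex_ball (f 0) ε).add_smul_sub_mem hy (Metric.mem_ball_self hε) p.1.2
      simpa using this) ⟨_, p.2.2, rfl⟩)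
    ⟨fun z => L ⟨z, hSB z.2⟩, by fun_prop⟩ (fun z => (hL _).trans (by
      change f z - y = f z - (y + ((0 : ℝ) : ℂ) * (f 0 - y))
      simp))
  have hmem : ∀ p : I × Metric.sphere (0 : ℂ) 1,
      -(((p.1 : ℝ) : ℂ) * (p.2 : ℂ)) ∈ Metric.closedBall (0 : ℂ) 1 := fun p => by
    have h1 : ‖(p.2 : ℂ)‖ = 1 := by simp
    have := p.1.2.2
    have h2 := p.1.2.1
    rw [mem_closedBall_zero_iff, norm_neg, norm_mul, h1, Complex.norm_real, Real.norm_of_nonneg h2]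
    linarith
  obtain ⟨L₂, hL₂⟩ := exists_log_of_homotopy
    (⟨fun p : I × Metric.sphere (0 : ℂ) 1 => f p.2 - f (-(((p.1 : ℝ) : ℂ) * (p.2 : ℂ))),
      (hfS.comp continuous_snd).sub (hf.comp_continuous (by fun_prop) hmem)⟩ :
      C(I × Metric.sphere (0 : ℂ) 1, ℂ))
    (fun p => sub_ne_zero.2 fun h => by
      have h1 := hi (hSB p.2.2) (hmem p) h
      have h2 : ((1 + (p.1 : ℝ) : ℝ) : ℂ) * (p.2 : ℂ) = 0 := by
        push_cast; linear_combination h1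
      have h3 : (p.2 : ℂ) ≠ 0 := by
        intro h
        have : ‖(p.2 : ℂ)‖ = 1 := by simp
        simp [h] at this
      have h4 := p.1.2.1
      have : (1 + (p.1 : ℝ) : ℝ) = 0 := by
        exact_mod_cast (mul_eq_zero.1 h2).resolve_right h3
      linarith)
    L₁ (fun z => (hL₁ z).trans (by simp))
  refine not_exists_log_odd (fun z => f z - f (-z)) (fun z => ?_) ⟨L₂, fun z => (hL₂ z).trans (by simp)⟩
  simp

/-- Invariance of domain in the plane. -/
theorem isOpen_image_complex {f : ℂ → ℂ} {U : Set ℂ} (hU : IsOpen U) (hf : ContinuousOn f U)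
    (hi : InjOn f U) : IsOpen (f '' U) := by
  rw [isOpen_iff_mem_nhds]
  rintro _ ⟨x, hx, rfl⟩
  obtain ⟨r, hr, hrU⟩ := Metric.nhds_basis_closedBall.mem_iff.1 (hU.mem_nhds hx)
  let a : ℂ → ℂ := fun z => x + r * z
  have ha : MapsTo a (Metric.closedBall 0 1) U := fun z hz => hrU (by
    rw [mem_closedBall_zero_iff] at hz
    simp only [a, Metric.mem_closedBall, dist_self_add_left, norm_mul, Complex.norm_real,
      Real.norm_of_nonneg hr.le]
    nlinarith)
  have hai : a.Injective := fun z w h => by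
    have : (r : ℂ) ≠ 0 := by exact_mod_cast hr.ne'
    simpa [a, this] using h
  have := image_closedBall_mem_nhds (f := f ∘ a) (hf.comp (by fun_prop) ha)
    (hi.comp hai.injOn ha)
  have h0 : (f ∘ a) 0 = f x := by simp [a]
  rw [h0] at this
  refine Filter.mem_of_superset this ?_
  rw [image_comp]
  exact image_mono ha.image_subset

/-- Invariance of domain for maps between spaces homeomorphic to the plane. -/
theorem isOpen_image_of_homeomorph {X Y : Type*} [TopologicalSpace X] [TopologicalSpace Y]
    (a : X ≃ₜ ℂ) (b : Y ≃ₜ ℂ) {f : X → Y} {U : Set X} (hU : IsOpen U) (hf : ContinuousOn f U)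
    (hi : InjOn f U) : IsOpen (f '' U) := by
  have hm : MapsTo a.symm (a '' U) U := by rintro _ ⟨x, hx, rfl⟩; simpa using hx
  have h1 : IsOpen ((b ∘ f ∘ a.symm) '' (a '' U)) := by
    refine isOpen_image_complex (a.isOpenMap _ hU) ?_ ?_
    · exact b.continuous.comp_continuousOn (hf.comp a.symm.continuous.continuousOn hm)
    · exact b.injective.injOn.comp (hi.comp a.symm.injective.injOn hm) (mapsTo_univ _ _)
  rw [← image_comp] at h1
  have h2 : (b ∘ f ∘ a.symm) ∘ a = b ∘ f := by ext; simp
  rw [h2, image_comp] at h1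
  exact (b.isOpen_image).1 h1

/-! ### Triviality of bundles over the line -/

section Trivial

variable {P : Type*} [TopologicalSpace P] {π : P → ℝ} {F : Type*} [TopologicalSpace F]

theorem IsVerticalPlane.continuous (hP : IsVerticalPlane π) : Continuous π :=
  continuous_iff_continuousAt.2 fun p => by
    obtain ⟨e, he⟩ := hP.locally_trivial (π p)
    exact e.continuousAt_proj (e.mem_source.2 he)

/-- Nearby fibres are homeomorphic, and the base is connected. -/
theorem IsVerticalPlane.nonempty_fiber_homeomorph (hP : IsVerticalPlane π) (x y : ℝ) :
    Nonempty (π ⁻¹' {x} ≃ₜ π ⁻¹' {y}) := by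
  have key : ∀ x : ℝ, ∀ᶠ y in 𝓝 x, Nonempty (π ⁻¹' {x} ≃ₜ π ⁻¹' {y}) := fun x => by
    obtain ⟨e, he⟩ := hP.locally_trivial x
    filter_upwards [e.open_baseSet.mem_nhds he] with y hy
    exact ⟨(e.preimageSingletonHomeomorph hy).symm⟩
  refine PreconnectedSpace.induction₂' (fun x y : ℝ => Nonempty (π ⁻¹' {x} ≃ₜ π ⁻¹' {y}))
    (fun x => ?_) ⟨?_⟩ x y
  · filter_upwards [key x] with y hy
    exact ⟨hy, hy.map Homeomorph.symm⟩
  · rintro x y z ⟨a⟩ ⟨b⟩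
    exact ⟨a.trans b⟩

/-- A bundle over the line which is locally trivial with fibre `F` is trivial over every closed
interval. -/
theorem exists_trivialization_Icc (h : ∀ x : ℝ, ∃ e : Bundle.Trivialization F π, x ∈ e.baseSet) {a b : ℝ}
    (hab : a ≤ b) : ∃ e : Bundle.Trivialization F π, Icc a b ⊆ e.baseSet := by
  choose e he using h
  obtain ⟨t, ht0, htm, ⟨m, hm⟩, ht⟩ := exists_monotone_Icc_subset_open_cover_Icc hab
    (c := fun x : ℝ => ((↑) : Icc a b → ℝ) ⁻¹' (e x).baseSet)
    (fun x => (e x).open_baseSet.preimage continuous_subtype_val)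
    (fun x _ => mem_iUnion.2 ⟨x, he x⟩)
  have key : ∀ n, ∃ e : Bundle.Trivialization F π, Icc a (t n : ℝ) ⊆ e.baseSet := by
    intro n
    induction n with
    | zero => exact ⟨e a, by rw [ht0]; simp [he]⟩
    | succ n ih =>
      obtain ⟨e₁, h₁⟩ := ih
      obtain ⟨i, hi⟩ := ht n
      have h2 : ∀ x : ℝ, (t n : ℝ) ≤ x → x ≤ t (n + 1) → x ∈ (e i).baseSet := fun x hx hx' =>
        @hi ⟨x, (t n).2.1.trans hx, hx'.trans (t (n + 1)).2.2⟩ ⟨hx, hx'⟩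
      have h3 : (t n : ℝ) ≤ t (n + 1) := htm n.le_succ
      refine ⟨e₁.piecewiseLe (e i) (t n) (h₁ ⟨(t n).2.1, le_rfl⟩) (h2 _ le_rfl h3), ?_⟩
      exact subset_ite.2 ⟨fun x hx => h₁ ⟨hx.1.1, hx.2⟩,
        fun x hx => h2 x (not_le.1 hx.2).le hx.1.2⟩
  obtain ⟨e', he'⟩ := key m
  exact ⟨e', by rwa [hm m le_rfl] at he'⟩

/-- The agreement with `e` is exact, so that successive extensions stabilise over bounded intervals.
Gluing by `piecewiseLe` preserves the left-hand piece, as wanted at `a`. At `-a` it is the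
right-hand piece `e₁` that must be preserved, so `e₀` is first composed with the fibre homeomorphism
matching the two there. -/
theorem exists_trivialization_extend (h : ∀ x : ℝ, ∃ e : Bundle.Trivialization F π, x ∈ e.baseSet)
    {a b : ℝ} (ha : 0 ≤ a) (hab : a ≤ b) (e : Bundle.Trivialization F π) (he : Icc (-a) a ⊆ e.baseSet) :
    ∃ e' : Bundle.Trivialization F π, Icc (-b) b ⊆ e'.baseSet ∧ ∀ p, |π p| ≤ a → e' p = e p := by
  obtain ⟨e₀, he₀⟩ := exists_trivialization_Icc h (a := -b) (b := b) (by linarith)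
  have h1 : a ∈ e₀.baseSet := he₀ ⟨by linarith, hab⟩
  have h2 : -a ∈ e₀.baseSet := he₀ ⟨by linarith, by linarith⟩
  let e₁ := e.piecewiseLe e₀ a (he ⟨by linarith, le_rfl⟩) h1
  have he₁ : Icc (-a) b ⊆ e₁.baseSet := subset_ite.2 ⟨fun x hx => he ⟨hx.1.1, hx.2⟩,
    fun x hx => he₀ ⟨by linarith [hx.1.1], hx.1.2⟩⟩
  have h3 : -a ∈ e₁.baseSet := he₁ ⟨le_rfl, by linarith⟩
  have heq : ∀ p, π p = -a → (e₀.transFiberHomeomorph (e₀.coordChangeHomeomorph e₁ h2 h3)) p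
      = e₁ p := by
    intro p hp
    rw [← hp] at h2 h3
    ext1
    · simp [*]
    · simpa [← hp] using e₀.coordChange_apply_snd e₁ h2
  refine ⟨(e₀.transFiberHomeomorph (e₀.coordChangeHomeomorph e₁ h2 h3)).piecewiseLeOfEq e₁ (-a)
    h2 h3 heq, ?_, ?_⟩
  · exact subset_ite.2 ⟨fun x hx => he₀ hx.1, fun x hx => he₁ ⟨(not_le.1 hx.2).le, hx.1.2⟩⟩
  · intro p hp
    have h4 := abs_le.1 hp
    have h5 : e₁ p = e p := if_pos h4.2
    rw [← h5]
    rcases h4.1.eq_or_lt with h6 | h6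
    · rw [← heq p h6.symm]
      exact if_pos (show π p ≤ -a from h6.symm.le)
    · exact if_neg (fun h7 : π p ≤ -a => h6.not_ge h7)

/-- A bundle over the line which is locally trivial with fibre `F` is trivial. -/
theorem exists_homeomorph_prod (h : ∀ x : ℝ, ∃ e : Bundle.Trivialization F π, x ∈ e.baseSet) :
    ∃ T : P ≃ₜ ℝ × F, ∀ p, (T p).1 = π p := by
  obtain ⟨e₀, he₀⟩ := h 0
  have step : ∀ (n : ℕ) (e : {e : Bundle.Trivialization F π // Icc (-(n : ℝ)) n ⊆ e.baseSet}),
      ∃ e' : {e : Bundle.Trivialization F π // Icc (-((n + 1 : ℕ) : ℝ)) (n + 1 : ℕ) ⊆ e.baseSet},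
        ∀ p, |π p| ≤ n → e'.1 p = e.1 p := fun n e => by
    obtain ⟨e', h1, h2⟩ := exists_trivialization_extend h (Nat.cast_nonneg n)
      (b := ((n + 1 : ℕ) : ℝ)) (by push_cast; linarith) e.1 e.2
    exact ⟨⟨e', h1⟩, h2⟩
  choose next hnext using step
  let f : ∀ n : ℕ, {e : Bundle.Trivialization F π // Icc (-(n : ℝ)) n ⊆ e.baseSet} := fun n =>
    Nat.rec ⟨e₀, by simpa using he₀⟩ next n
  have hsucc : ∀ (n : ℕ) p, |π p| ≤ n → (f (n + 1)).1 p = (f n).1 p := fun n => hnext n (f n)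
  have hf : ∀ (n k : ℕ) p, |π p| ≤ n → (f (n + k)).1 p = (f n).1 p := by
    intro n k p hp
    induction k with
    | zero => rfl
    | succ k ih =>
      rw [← add_assoc, hsucc _ p (hp.trans (by push_cast; linarith [Nat.cast_nonneg (α := ℝ) k])), ih]
  have hf' : ∀ (n m : ℕ) p, |π p| ≤ n → |π p| ≤ m → (f n).1 p = (f m).1 p := by
    intro n m p hn hm
    rcases le_total n m with h | h
    · obtain ⟨k, rfl⟩ := Nat.exists_eq_add_of_le h
      exact (hf n k p hn).symm
    · obtain ⟨k, rfl⟩ := Nat.exists_eq_add_of_le h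
      exact hf m k p hm
  -- The index may be replaced by any larger one. Near a given point a single index serves, so `T`
  -- inherits continuity and openness from one trivialization.
  let T : P → ℝ × F := fun p => (f ⌈|π p|⌉₊).1 p
  have hT : ∀ (n : ℕ) p, |π p| ≤ n → T p = (f n).1 p := fun n p hp =>
    hf' _ _ p (Nat.le_ceil _) hp
  have hsrc : ∀ (n : ℕ) p, |π p| ≤ n → p ∈ (f n).1.source := fun n p hp =>
    (f n).1.mem_source.2 ((f n).2 (abs_le.1 hp))
  have hfst : ∀ p, (T p).1 = π p := fun p => (f _).1.coe_fst (hsrc _ p (Nat.le_ceil _))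
  have hcont : Continuous π := continuous_iff_continuousAt.2 fun p => by
    obtain ⟨e, he⟩ := h (π p)
    exact e.continuousAt_proj (e.mem_source.2 he)
  have hloc : ∀ p, ∃ n : ℕ, |π p| ≤ n ∧ T =ᶠ[𝓝 p] (f n).1 := fun p => by
    obtain ⟨n, hn⟩ := exists_nat_gt |π p|
    refine ⟨n, hn.le, ?_⟩
    filter_upwards [hcont.abs.continuousAt.eventually (gt_mem_nhds hn)] with q hq
    exact hT n q hq.le
  have hTc : Continuous T := continuous_iff_continuousAt.2 fun p => by
    obtain ⟨n, hn, hev⟩ := hloc p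
    exact ((f n).1.continuousAt (hsrc n p hn)).congr hev.symm
  have hTo : IsOpenMap T := isOpenMap_iff_nhds_le.2 fun p => by
    obtain ⟨n, hn, hev⟩ := hloc p
    rw [Filter.map_congr hev, hev.eq_of_nhds]
    exact ((f n).1.map_nhds_eq (hsrc n p hn)).ge
  have hTi : T.Injective := fun p q hpq => by
    have h1 : π p = π q := by rw [← hfst, hpq, hfst]
    have hp := Nat.le_ceil |π p|
    have hq : |π q| ≤ (⌈|π p|⌉₊ : ℝ) := h1 ▸ hp
    rw [hT _ p hp, hT _ q hq] at hpq
    exact (f _).1.injOn (hsrc _ p hp) (hsrc _ q hq) hpq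
  have hTs : T.Surjective := fun z => by
    have h1 := Nat.le_ceil |z.1|
    have h2 : z ∈ (f ⌈|z.1|⌉₊).1.target :=
      (f _).1.mem_target.2 ((f _).2 (abs_le.1 h1))
    refine ⟨(f ⌈|z.1|⌉₊).1.toOpenPartialHomeomorph.symm z, ?_⟩
    rw [hT ⌈|z.1|⌉₊ _ (by rw [(f _).1.proj_symm_apply h2]; exact h1)]
    exact (f _).1.apply_symm_apply h2
  exact ⟨(Equiv.ofBijective T ⟨hTi, hTs⟩).toHomeomorphOfContinuousOpen hTc hTo, hfst⟩

end Trivial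

/-! ### A factor of the plane whose other factor is a line -/

/-- If `F × ℝ` is a plane, then there is a continuous antisymmetric nowhere vanishing function on
the pairs of distinct points of `F`. -/
theorem exists_antisymmetric {F : Type*} [TopologicalSpace F] (h : F × ℝ ≃ₜ ℂ) :
    ∃ τ : F → F → ℝ, ContinuousOn (fun p : F × F => τ p.1 p.2) {p | p.1 ≠ p.2} ∧
      (∀ x y, τ y x = -τ x y) ∧ ∀ x y, x ≠ y → τ x y ≠ 0 := by
  have : ContractibleSpace ((F × ℝ) × (F × ℝ)) :=
    (h.prodCongr h).toHomotopyEquiv.contractibleSpace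
  -- The first point is raised by `t` times more than the difference of heights. At `t = 1` it lies
  -- strictly above the second point, so the difference of images has no zero on the contractible
  -- space of all pairs. Lowering it back to `t = 0` keeps the two points distinct for pairs in `R`.
  let push : ℝ → (F × ℝ) × (F × ℝ) → F × ℝ := fun t p =>
    (p.1.1, p.1.2 + t * (|p.2.2 - p.1.2| + 1))
  let R : Set ((F × ℝ) × (F × ℝ)) := {p | p.1.1 ≠ p.2.1 ∨ p.2.2 < p.1.2}
  have hpush : ∀ p : (F × ℝ) × (F × ℝ), h (push 1 p) - h p.2 ≠ 0 := fun p hp => by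
    have h1 := congrArg Prod.snd (h.injective (sub_eq_zero.1 hp))
    simp only [push] at h1
    linarith [le_abs_self (p.2.2 - p.1.2)]
  obtain ⟨L₀, hL₀⟩ := exists_log_of_contractible
    (⟨fun p => h (push 1 p) - h p.2, by fun_prop⟩ : C((F × ℝ) × (F × ℝ), ℂ)) hpush
  obtain ⟨L, hL⟩ := exists_log_of_homotopy
    (⟨fun q : I × R => h (push (1 - q.1) q.2.1) - h q.2.1.2, by fun_prop⟩ : C(I × R, ℂ))
    (fun q hq => by
      have h0 := h.injective (sub_eq_zero.1 hq)
      have h1 := congrArg Prod.snd h0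
      have h2 := congrArg Prod.fst h0
      simp only [push] at h1 h2
      have h3 := q.2.2.resolve_left (not_not.2 h2)
      have h4 : 0 ≤ (1 - (q.1 : ℝ)) * (|q.2.1.2.2 - q.2.1.1.2| + 1) :=
        mul_nonneg (by linarith [q.1.2.2]) (by positivity)
      linarith)
    ⟨fun p => L₀ p.1, by fun_prop⟩ (fun p => (hL₀ p.1).trans (by simp))
  have hL' : ∀ p : R, Complex.exp (L p) = h p.1.1 - h p.1.2 := fun p =>
    (hL p).trans (by simp [push])
  let r : ∀ x y : F, x ≠ y → R := fun x y hxy => ⟨((x, 0), (y, 0)), Or.inl hxy⟩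
  classical
  refine ⟨fun x y => if hxy : x ≠ y then (L (r x y hxy)).im - (L (r y x hxy.symm)).im else 0,
    ?_, ?_, ?_⟩
  · rw [continuousOn_iff_continuous_domRestrict]
    have h1 : Continuous fun p : {p : F × F | p.1 ≠ p.2} =>
        (L (r p.1.1 p.1.2 p.2)).im - (L (r p.1.2 p.1.1 p.2.symm)).im := by fun_prop
    refine h1.congr fun p => ?_
    have h2 : p.1.1 ≠ p.1.2 := p.2
    simp [h2]
  · intro x y
    by_cases hxy : x = y
    · simp [hxy]
    · simp [hxy, Ne.symm hxy]
  · intro x y hxy h0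
    simp only [ne_eq, hxy, not_false_eq_true, dite_true] at h0
    have hne : h (x, 0) - h (y, 0) ≠ 0 :=
      sub_ne_zero.2 fun h1 => hxy (congrArg Prod.fst (h.injective h1))
    -- Exchanging the two points changes the sign of the difference of images. If the imaginary
    -- parts agreed, this exponential would be positive.
    have h1 : Complex.exp (L (r x y hxy) - L (r y x hxy.symm)) = -1 := by
      rw [Complex.exp_sub, hL', hL', div_eq_iff]
      · simp [r]
      · simpa [r, sub_eq_zero] using fun h2 => hne (by rw [h2, sub_self])
    have h2 := congrArg Complex.re h1
    rw [Complex.exp_re, Complex.sub_im, h0, Real.cos_zero] at h2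
    have h3 := Real.exp_pos (L (r x y hxy) - L (r y x hxy.symm)).re
    simp only [mul_one, Complex.neg_re, Complex.one_re] at h2
    linarith

/-- A connected space with a continuous antisymmetric nowhere vanishing function on the pairs of
distinct points is linearly orderable, with open rays. -/
theorem exists_linearOrder {F : Type*} [TopologicalSpace F] [T1Space F] [PreconnectedSpace F]
    (τ : F → F → ℝ) (hc : ContinuousOn (fun p : F × F => τ p.1 p.2) {p | p.1 ≠ p.2})
    (ha : ∀ x y, τ y x = -τ x y) (h0 : ∀ x y, x ≠ y → τ x y ≠ 0) :
    ∃ _ : LinearOrder F, (∀ a : F, IsOpen (Iio a)) ∧ ∀ a : F, IsOpen (Ioi a) := by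
  have hself : ∀ x, τ x x = 0 := fun x => by linarith [ha x x]
  have hne : ∀ {x y}, 0 < τ x y → x ≠ y := fun {x y} h e => by
    rw [e, hself] at h; exact h.false
  have hU : ∀ a, IsOpen {x | 0 < τ a x} := fun a => by
    have h1 : ContinuousOn (fun x => τ a x) {a}ᶜ :=
      hc.comp (f := fun x => (a, x)) (by fun_prop) fun x hx => Ne.symm hx
    have h2 := h1.isOpen_inter_preimage isOpen_compl_singleton (isOpen_Ioi (a := (0 : ℝ)))
    convert h2 using 1
    ext x
    exact ⟨fun h => ⟨(hne h).symm, h⟩, fun h => h.2⟩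
  have hD : ∀ a, IsOpen {x | 0 < τ x a} := fun a => by
    have h1 : ContinuousOn (fun x => τ x a) {a}ᶜ :=
      hc.comp (f := fun x => (x, a)) (by fun_prop) fun x hx => hx
    have h2 := h1.isOpen_inter_preimage isOpen_compl_singleton (isOpen_Ioi (a := (0 : ℝ)))
    convert h2 using 1
    ext x
    exact ⟨fun h => ⟨hne h, h⟩, fun h => h.2⟩
  have htri : ∀ x y, 0 < τ x y ∨ x = y ∨ 0 < τ y x := fun x y => by
    by_cases h : x = y
    · exact Or.inr (Or.inl h)
    · rcases (h0 x y h).lt_or_gt with h1 | h1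
      · exact Or.inr (Or.inr (by rw [ha]; linarith))
      · exact Or.inl h1
  have hasymm : ∀ {x y}, 0 < τ x y → ¬ 0 < τ y x := fun {x y} h h' => by
    rw [ha] at h'; linarith
  have htrans : ∀ a b c, 0 < τ a b → 0 < τ b c → 0 < τ a c := by
    intro a b c hab hbc
    rcases htri a c with h | rfl | hca
    · exact h
    · exact absurd hbc (hasymm hab)
    exfalso
    -- A cycle `a < b < c < a` would make this set clopen, its complement being the points above `b`
    -- or below `c`. It contains `a` but not `b`.
    have hcl : IsClopen ({x | 0 < τ x b} ∩ {x | 0 < τ c x}) := by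
      refine ⟨?_, (hD b).inter (hU c)⟩
      rw [← isOpen_compl_iff]
      convert (hU b).union (hD c) using 1
      ext x
      simp only [mem_compl_iff, mem_inter_iff, mem_ofPred_eq, mem_union, not_and_or]
      constructor
      · rintro (h | h)
        · rcases htri x b with h' | rfl | h'
          · exact absurd h' h
          · exact Or.inr hbc
          · exact Or.inl h'
        · rcases htri c x with h' | rfl | h'
          · exact absurd h' h
          · exact Or.inl hbc
          · exact Or.inr h'
      · rintro (h | h)
        · exact Or.inl (hasymm h)
        · exact Or.inr (hasymm h)
    have h1 := hcl.eq_univ ⟨a, hab, hca⟩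
    have h2 : b ∈ {x | 0 < τ x b} ∩ {x | 0 < τ c x} := h1 ▸ mem_univ b
    exact hne h2.1 rfl
  classical
  let ord : LinearOrder F :=
    { le := fun x y => x = y ∨ 0 < τ x y
      lt := fun x y => 0 < τ x y
      le_refl := fun x => Or.inl rfl
      le_trans := by
        rintro x y z (rfl | h) (rfl | h')
        · exact Or.inl rfl
        · exact Or.inr h'
        · exact Or.inr h
        · exact Or.inr (htrans _ _ _ h h')
      lt_iff_le_not_ge := fun x y => by
        constructor
        · intro h
          refine ⟨Or.inr h, ?_⟩
          rintro (h' | h')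
          · exact hne h h'.symm
          · exact hasymm h h'
        · rintro ⟨rfl | h, h'⟩
          · exact absurd (Or.inl rfl) h'
          · exact h
      le_antisymm := by
        rintro x y (h | h) (h' | h')
        · exact h
        · exact h
        · exact h'.symm
        · exact absurd h' (hasymm h)
      le_total := fun x y => by
        rcases htri x y with h | h | h
        · exact Or.inl (Or.inr h)
        · exact Or.inl (Or.inl h)
        · exact Or.inr (Or.inr h)
      toDecidableLE := Classical.decRel _ }
  exact ⟨ord, hD, hU⟩

/-- A connected separable linearly ordered space with open rays has a continuous strictly monotone
real-valued function. -/
theorem exists_continuous_strictMono {F : Type*} [TopologicalSpace F] [LinearOrder F]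
    [PreconnectedSpace F] [TopologicalSpace.SeparableSpace F]
    (hI : ∀ a : F, IsOpen (Iio a)) (hJ : ∀ a : F, IsOpen (Ioi a)) :
    ∃ f : F → ℝ, Continuous f ∧ StrictMono f := by
  rcases subsingleton_or_nontrivial F with hs | hs
  · exact ⟨fun _ => 0, continuous_const, fun a b h => absurd (Subsingleton.elim a b) h.ne⟩
  have hd : DenselyOrdered F := ⟨fun a b hab => by
    by_contra! hcon
    have hcl : IsClopen (Ioi a) := by
      refine ⟨?_, hJ a⟩
      rw [← isOpen_compl_iff]
      convert hI b using 1
      ext x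
      simp only [mem_compl_iff, mem_Ioi, not_lt, mem_Iio]
      exact ⟨fun h => h.trans_lt hab, fun h => not_lt.1 fun h' => (hcon x h').not_gt h⟩
    have h2 : a ∈ Ioi a := (hcl.eq_univ ⟨b, hab⟩) ▸ mem_univ a
    exact lt_irrefl _ h2⟩
  obtain ⟨S, hSc, hSd⟩ := TopologicalSpace.exists_countable_dense F
  have hbet : ∀ a b : F, a < b → ∃ q ∈ S, a < q ∧ q < b := fun a b hab => by
    obtain ⟨c, hc⟩ := exists_between hab
    obtain ⟨q, hq, hqS⟩ := hSd.inter_open_nonempty _ ((hJ a).inter (hI b)) ⟨c, hc⟩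
    exact ⟨q, hqS, hq⟩
  -- Possible end points of `F` are discarded, so that Cantor's theorem applies: `Q` is order
  -- isomorphic to the rationals of `(0, 1)`.
  let Q := {q : F // q ∈ S ∧ (∃ a, a < q) ∧ ∃ b, q < b}
  have hbQ : ∀ a b : F, a < b → ∃ q : Q, a < q.1 ∧ q.1 < b := fun a b hab => by
    obtain ⟨q, hq, h1, h2⟩ := hbet a b hab
    exact ⟨⟨q, hq, ⟨a, h1⟩, b, h2⟩, h1, h2⟩
  have : Countable Q := (hSc.mono fun q (hq : q ∈ S ∧ (∃ a, a < q) ∧ ∃ b, q < b) => hq.1).to_subtype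
  have : DenselyOrdered Q := ⟨fun a b hab => by
    obtain ⟨q, h1, h2⟩ := hbQ a b hab
    exact ⟨q, h1, h2⟩⟩
  have : NoMinOrder Q := ⟨fun q => by
    obtain ⟨a, ha⟩ := q.2.2.1
    obtain ⟨r, h1, h2⟩ := hbQ a q ha
    exact ⟨r, h2⟩⟩
  have : NoMaxOrder Q := ⟨fun q => by
    obtain ⟨a, ha⟩ := q.2.2.2
    obtain ⟨r, h1, h2⟩ := hbQ q a ha
    exact ⟨r, h1⟩⟩
  have : Nonempty Q := by
    obtain ⟨a, b, hab⟩ := exists_pair_lt F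
    obtain ⟨q, -⟩ := hbQ a b hab
    exact ⟨q⟩
  let T := {t : ℚ // t ∈ Ioo 0 1}
  have : Nonempty T := ⟨⟨1 / 2, by norm_num, by norm_num⟩⟩
  have : NoMinOrder T := ⟨fun t => ⟨⟨t / 2, by linarith [t.2.1], by linarith [t.2.1, t.2.2]⟩,
    show t.1 / 2 < t by linarith [t.2.1]⟩⟩
  have : NoMaxOrder T := ⟨fun t => ⟨⟨(t + 1) / 2, by linarith [t.2.1], by linarith [t.2.2]⟩,
    show t.1 < (t + 1) / 2 by linarith [t.2.2]⟩⟩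
  have : DenselyOrdered T := ⟨fun a b hab => by
    obtain ⟨c, h1, h2⟩ := exists_between (show a.1 < b.1 from hab)
    exact ⟨⟨c, a.2.1.trans h1, h2.trans b.2.2⟩, h1, h2⟩⟩
  obtain ⟨e⟩ := Order.iso_of_countable_dense Q T
  -- The supremum of `A x` is the cut that `x` makes in `Q`, read in `[0, 1]`. The element `0` is
  -- inserted for a possible least point of `F`, which has nothing of `Q` below it.
  let A : F → Set ℝ := fun x => insert 0 {r | ∃ q : Q, q.1 < x ∧ r = ((e q).1 : ℝ)}
  have hAb : ∀ x, BddAbove (A x) := fun x => ⟨1, by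
    rintro r (rfl | ⟨q, -, rfl⟩)
    · exact zero_le_one
    · exact_mod_cast (e q).2.2.le⟩
  have hAn : ∀ x, (A x).Nonempty := fun x => ⟨0, Or.inl rfl⟩
  let f : F → ℝ := fun x => sSup (A x)
  have hlow : ∀ (q : Q) x, q.1 < x → ((e q).1 : ℝ) ≤ f x := fun q x h =>
    le_csSup (hAb x) (Or.inr ⟨q, h, rfl⟩)
  have hup : ∀ (q : Q) x, x ≤ q.1 → f x ≤ ((e q).1 : ℝ) := fun q x h =>
    csSup_le (hAn x) (by
      rintro r (rfl | ⟨q', h', rfl⟩)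
      · exact_mod_cast (e q).2.1.le
      · have : e q' < e q := e.strictMono (show q'.1 < q.1 from h'.trans_le h)
        exact_mod_cast this.le)
  have he : ∀ {q q' : Q}, q.1 < q'.1 → ((e q).1 : ℝ) < (e q').1 := fun {q q'} h => by
    have : e q < e q' := e.strictMono h
    exact_mod_cast this
  have hmono : StrictMono f := fun x y hxy => by
    obtain ⟨q, h1, h2⟩ := hbQ x y hxy
    obtain ⟨q', h3, h4⟩ := hbQ q y h2
    exact (hup q x h1.le).trans_lt ((he h3).trans_le (hlow q' y h4))
  have hf0 : ∀ x, 0 ≤ f x := fun x => le_csSup (hAb x) (Or.inl rfl)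
  have hf1 : ∀ x, f x ≤ 1 := fun x => csSup_le (hAn x) (by
    rintro r (rfl | ⟨q, -, rfl⟩)
    · exact zero_le_one
    · exact_mod_cast (e q).2.2.le)
  refine ⟨f, ?_, hmono⟩
  refine continuous_iff_continuousAt.2 fun x => ?_
  refine tendsto_order.2 ⟨fun r hr => ?_, fun r hr => ?_⟩
  · by_cases hr0 : r < 0
    · exact Filter.Eventually.of_forall fun y => hr0.trans_le (hf0 y)
    obtain ⟨s, hs, hrs⟩ := exists_lt_of_lt_csSup (hAn x) hr
    rcases hs with rfl | ⟨q, hq, rfl⟩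
    · exact absurd hrs hr0
    · filter_upwards [(hJ q.1).mem_nhds hq] with y hy
      exact hrs.trans_le (hlow q y hy)
  · by_cases hr1 : 1 < r
    · exact Filter.Eventually.of_forall fun y => (hf1 y).trans_lt hr1
    obtain ⟨t, h1, h2⟩ := exists_rat_btwn hr
    have ht0 : (0 : ℝ) < t := (hf0 x).trans_lt h1
    obtain ⟨q, hq⟩ := e.surjective ⟨t, by exact_mod_cast ht0,
      by exact_mod_cast h2.trans_le (not_lt.1 hr1)⟩
    have hqt : ((e q).1 : ℝ) = t := by rw [hq]
    obtain ⟨t', h3, h4⟩ := exists_rat_btwn h1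
    have ht0' : (0 : ℝ) < t' := (hf0 x).trans_lt h3
    obtain ⟨q', hq'⟩ := e.surjective ⟨t', by exact_mod_cast ht0',
      by exact_mod_cast (h4.trans h2).trans_le (not_lt.1 hr1)⟩
    have hqt' : ((e q').1 : ℝ) = t' := by rw [hq']
    have h5 : x ≤ q'.1 := not_lt.1 fun h => (hlow q' x h).not_gt (hqt' ▸ h3)
    have h6 : q'.1 < q.1 := by
      by_contra hcon
      rcases (not_lt.1 hcon).eq_or_lt with h7 | h7
      · rw [Subtype.ext h7, hqt'] at hqt
        exact h4.ne hqt
      · have := he h7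
        rw [hqt, hqt'] at this
        exact this.not_gt h4
    filter_upwards [(hI q.1).mem_nhds (h5.trans_lt h6)] with y hy
    exact (hup q y hy.le).trans_lt (hqt ▸ h2)

theorem nonempty_homeomorph_real {J : Set ℝ} (ho : IsOpen J) (hc : J.OrdConnected)
    (hn : J.Nonempty) (hb : Bornology.IsBounded J) : Nonempty (J ≃ₜ ℝ) := by
  have hJ : J = Ioo (sInf J) (sSup J) := by
    refine Subset.antisymm (fun x hx => ⟨?_, ?_⟩)
      (IsConnected.Ioo_csInf_csSup_subset ⟨hn, hc.isPreconnected⟩ hb.bddBelow hb.bddAbove)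
    · refine (csInf_le hb.bddBelow hx).lt_of_ne fun h => ?_
      obtain ⟨y, hy, hyJ⟩ := (mem_nhdsWithin_of_mem_nhds (ho.mem_nhds hx) :
        J ∈ 𝓝[<] x) |> fun h => (Filter.nonempty_of_mem (Filter.inter_mem self_mem_nhdsWithin h))
      exact (csInf_le hb.bddBelow hyJ).not_gt (h ▸ hy)
    · refine (le_csSup hb.bddAbove hx).lt_of_ne fun h => ?_
      obtain ⟨y, hy, hyJ⟩ := (mem_nhdsWithin_of_mem_nhds (ho.mem_nhds hx) :
        J ∈ 𝓝[>] x) |> fun h => (Filter.nonempty_of_mem (Filter.inter_mem self_mem_nhdsWithin h))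
      exact (le_csSup hb.bddAbove hyJ).not_gt (h ▸ hy)
  have hlt : sInf J < sSup J := by
    obtain ⟨x, hx⟩ := hn
    rw [hJ] at hx
    exact hx.1.trans hx.2
  have hball : J = Metric.ball ((sInf J + sSup J) / 2) ((sSup J - sInf J) / 2) := by
    rw [Real.ball_eq_Ioo]
    refine hJ.trans ?_
    congr 1 <;> ring
  rw [hball]
  let e := OpenPartialHomeomorph.univBall ((sInf J + sSup J) / 2) ((sSup J - sInf J) / 2)
  have ht : e.target = Metric.ball ((sInf J + sSup J) / 2) ((sSup J - sInf J) / 2) :=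
    OpenPartialHomeomorph.univBall_target _ (by linarith)
  have hs : e.source = univ := OpenPartialHomeomorph.univBall_source _ _
  exact ⟨(Homeomorph.setCongr ht.symm).trans (e.toHomeomorphSourceTarget.symm.trans
    ((Homeomorph.setCongr hs).trans (Homeomorph.Set.univ ℝ)))⟩

/-- A space whose product with the line is the plane is homeomorphic to the line. -/
theorem nonempty_homeomorph_real_of_prod {F : Type*} [TopologicalSpace F] (h : F × ℝ ≃ₜ ℂ) :
    Nonempty (F ≃ₜ ℝ) := by
  have hemb : IsEmbedding (fun x : F => h (x, 0)) :=
    h.isEmbedding.comp (isEmbedding_prodMkLeft 0)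
  have : T2Space F := hemb.t2Space
  have : SecondCountableTopology F := hemb.secondCountableTopology
  have hN : Nonempty F := ⟨(h.symm 0).1⟩
  have : PreconnectedSpace F := by
    have : PreconnectedSpace (F × ℝ) := h.symm.surjective.denseRange.preconnectedSpace h.symm.continuous
    exact (Prod.fst_surjective (α := F) (β := ℝ)).denseRange.preconnectedSpace continuous_fst
  obtain ⟨τ, hc, ha, h0⟩ := exists_antisymmetric h
  obtain ⟨ord, hI, hJ⟩ := exists_linearOrder τ hc ha h0
  obtain ⟨f₀, hf₀, hm₀⟩ := exists_continuous_strictMono hI hJ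
  let f : F → ℝ := fun x => Real.arctan (f₀ x)
  have hfc : Continuous f := Real.continuous_arctan.comp hf₀
  have hfi : f.Injective := Real.arctan_injective.comp hm₀.injective
  -- Openness comes from invariance of domain, applied to `f × id` on the plane `F × ℝ`.
  have hfo : IsOpenMap f := fun U hU => by
    have h1 := isOpen_image_of_homeomorph h Complex.equivRealProdCLM.toHomeomorph.symm
      (f := Prod.map f id) (hU.prod (isOpen_univ (X := ℝ)))
      (hfc.prodMap continuous_id).continuousOn (hfi.prodMap Function.injective_id).injOn
    have h2 := isOpenMap_fst _ h1
    convert h2 using 1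
    rw [← image_comp]
    ext y
    constructor
    · rintro ⟨x, hx, rfl⟩
      exact ⟨(x, 0), ⟨hx, trivial⟩, rfl⟩
    · rintro ⟨⟨x, t⟩, hx, rfl⟩
      exact ⟨x, hx.1, rfl⟩
  have hoe : IsOpenEmbedding f := .of_continuous_injective_isOpenMap hfc hfi hfo
  have hpre : IsPreconnected (range f) := isPreconnected_range hfc
  obtain ⟨e⟩ := nonempty_homeomorph_real hoe.isOpen_range hpre.ordConnected (range_nonempty f)
    (Metric.isBounded_Ioo (-(Real.pi / 2)) (Real.pi / 2) |>.subset (by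
      rintro _ ⟨x, rfl⟩
      exact Real.arctan_mem_Ioo _))
  exact ⟨hoe.isEmbedding.toHomeomorph.trans e⟩

/-- Every vertical plane is isomorphic to the product of two lines. -/
theorem IsVerticalPlane.exists_homeomorph {P : Type*} [TopologicalSpace P] {π : P → ℝ}
    (hP : IsVerticalPlane π) : ∃ Φ : P ≃ₜ ℝ × ℝ, ∀ p, (Φ p).1 = π p := by
  obtain ⟨T, hT⟩ := exists_homeomorph_prod (F := π ⁻¹' {0}) (π := π) fun x => by
    obtain ⟨e, he⟩ := hP.locally_trivial x
    obtain ⟨k⟩ := hP.nonempty_fiber_homeomorph x 0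
    exact ⟨e.transFiberHomeomorph k, he⟩
  obtain ⟨a⟩ := hP.homeomorphic_plane
  obtain ⟨k⟩ := nonempty_homeomorph_real_of_prod (((Homeomorph.prodComm _ _).trans T.symm).trans
    (a.trans Complex.equivRealProdCLM.toHomeomorph.symm))
  exact ⟨T.trans ((Homeomorph.refl ℝ).prodCongr k), hT⟩

end Fibration

/-! ### Charts of a surface in the plane -/

/-- Invariance of domain for maps defined on an open subset of the plane. -/
theorem isOpen_range_of_homeomorph {X Y : Type*} [TopologicalSpace X] [TopologicalSpace Y]
    (a : X ≃ₜ ℂ) (b : Y ≃ₜ ℂ) {U : Set X} (hU : IsOpen U) {f : U → Y} (hf : Continuous f)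
    (hi : f.Injective) : IsOpen (range f) := by
  classical
  let y : Y := b.symm 0
  let g : X → Y := fun x => if h : x ∈ U then f ⟨x, h⟩ else y
  have hg : ∀ x : U, g x = f x := fun x => dif_pos x.2
  have h1 : IsOpen (g '' U) := isOpen_image_of_homeomorph a b hU
    (continuousOn_iff_continuous_domRestrict.2 (hf.congr fun x => (hg x).symm))
    fun x hx z hz h => by
      have := hi ((hg ⟨x, hx⟩).symm.trans (h.trans (hg ⟨z, hz⟩)))
      exact congrArg Subtype.val this
  convert h1 using 1
  ext z
  constructor
  · rintro ⟨x, rfl⟩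
    exact ⟨x, x.2, hg x⟩
  · rintro ⟨x, hx, rfl⟩
    exact ⟨⟨x, hx⟩, (hg ⟨x, hx⟩).symm⟩

section Charts

variable {P : Type*} [TopologicalSpace P] {D : Set P}

/-- The part of the chart strictly inside the half-plane is open in the plane, so by invariance of
domain the inverse chart maps it onto an open set. -/
theorem mem_interior_of_chart_pos (a : P ≃ₜ ℂ) (φ : OpenPartialHomeomorph D (EuclideanHalfSpace 2))
    {p : D} (hp : p ∈ φ.source) (h0 : 0 < (φ p).1 0) : p.1 ∈ interior D := by
  obtain ⟨T, hT, hT'⟩ := isOpen_induced_iff.1 φ.open_target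
  have hO : IsOpen (T ∩ {v : EuclideanSpace ℝ (Fin 2) | 0 < v 0}) :=
    hT.inter (isOpen_lt continuous_const (by fun_prop))
  let lift : ↥(T ∩ {v : EuclideanSpace ℝ (Fin 2) | 0 < v 0}) → EuclideanHalfSpace 2 :=
    fun v => ⟨v.1, v.2.2.le⟩
  have hl : ∀ v, lift v ∈ φ.target := fun v => by rw [← hT']; exact v.2.1
  have hlc : Continuous lift := by fun_prop
  have hopen := isOpen_range_of_homeomorph
    (Complex.orthonormalBasisOneI.repr.toHomeomorph.symm) a hO
    (f := fun v => (φ.symm (lift v)).1)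
    (continuous_subtype_val.comp (φ.continuousOn_symm.comp_continuous hlc hl))
    (fun v w h => by
      have h1 := φ.symm.injOn (hl v) (hl w) (Subtype.ext h)
      exact Subtype.ext (congrArg (fun z : EuclideanHalfSpace 2 => z.1) h1))
  refine mem_interior.2 ⟨_, ?_, hopen, ?_⟩
  · rintro _ ⟨v, rfl⟩
    exact (φ.symm (lift v)).2
  · have hm : φ p ∈ φ.target := φ.map_source hp
    rw [← hT'] at hm
    exact ⟨⟨(φ p).1, hm, h0⟩, congrArg Subtype.val (φ.left_inv hp)⟩

/-- Otherwise the chart would map a plane neighbourhood of `p` onto an open subset of the plane;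
this would contain points with negative first coordinate, outside the half-plane. -/
theorem notMem_interior_of_chart_eq_zero (a : P ≃ₜ ℂ)
    (φ : OpenPartialHomeomorph D (EuclideanHalfSpace 2))
    {p : D} (hp : p ∈ φ.source) (h0 : (φ p).1 0 = 0) : p.1 ∉ interior D := by
  intro hpi
  obtain ⟨S, hS, hS'⟩ := isOpen_induced_iff.1 φ.open_source
  have hO : IsOpen (S ∩ interior D) := hS.inter isOpen_interior
  let lift : ↥(S ∩ interior D) → D := fun q => ⟨q.1, interior_subset q.2.2⟩
  have hl : ∀ q, lift q ∈ φ.source := fun q => by rw [← hS']; exact q.2.1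
  have hlc : Continuous lift := by fun_prop
  have hopen := isOpen_range_of_homeomorph a
    (Complex.orthonormalBasisOneI.repr.toHomeomorph.symm) hO
    (f := fun q => (φ (lift q)).1)
    (continuous_subtype_val.comp (φ.continuousOn.comp_continuous hlc hl))
    (fun v w h => by
      have h1 := φ.injOn (hl v) (hl w) (Subtype.ext h)
      exact Subtype.ext (congrArg (fun z : D => z.1) h1))
  have hpS : p ∈ Subtype.val ⁻¹' S := hS' ▸ hp
  have hmem : (φ p).1 ∈ range fun q => (φ (lift q)).1 := ⟨⟨p.1, hpS, hpi⟩, rfl⟩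
  let k : ℝ → EuclideanSpace ℝ (Fin 2) := fun t => !₂[t, (φ p).1 1]
  have hk : Continuous k := by fun_prop
  have hk0 : k 0 = (φ p).1 := by
    ext i; fin_cases i <;> simp [k, h0]
  have h1 : ∀ᶠ t in 𝓝[<] (0 : ℝ), k t ∈ range fun q => (φ (lift q)).1 :=
    (hk.tendsto 0).mono_left nhdsWithin_le_nhds (hopen.mem_nhds (hk0 ▸ hmem))
  obtain ⟨t, ⟨q, hq⟩, ht⟩ := (h1.and self_mem_nhdsWithin).exists
  have h2 := (φ (lift q)).2
  have h3 : (φ (lift q)).1 0 = t := by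
    have := congrArg (fun v : EuclideanSpace ℝ (Fin 2) => v 0) hq
    simpa [k] using this
  rw [h3] at h2
  exact absurd h2 (not_le.2 ht)

/-- Being a boundary point thus does not depend on the chart, and the intrinsic boundary can be
handled as a frontier. -/
theorem chart_eq_zero_iff (a : P ≃ₜ ℂ) (hc : IsClosed D)
    (φ : OpenPartialHomeomorph D (EuclideanHalfSpace 2))
    {p : D} (hp : p ∈ φ.source) : (φ p).1 0 = 0 ↔ p.1 ∈ frontier D := by
  rw [hc.frontier_eq]
  refine ⟨fun h => ⟨p.2, notMem_interior_of_chart_eq_zero a φ hp h⟩, fun h => ?_⟩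
  by_contra h0
  exact h.2 (mem_interior_of_chart_pos a φ hp ((φ p).2.lt_of_ne' h0))

theorem boundaryCurve_eq_frontier (a : P ≃ₜ ℂ) (hc : IsClosed D) (hs : IsSurface D) :
    boundaryCurve D = frontier D := by
  ext p
  constructor
  · rintro ⟨q, ⟨φ, hq, h0⟩, rfl⟩
    exact (chart_eq_zero_iff a hc φ hq).1 h0
  · intro hp
    obtain ⟨φ, hφ⟩ := hs.exists_chart ⟨p, hc.frontier_subset hp⟩
    exact ⟨_, ⟨φ, hφ, (chart_eq_zero_iff a hc φ hφ).2 hp⟩, rfl⟩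

/-- The boundary of a surface in the plane is locally an arc. -/
theorem exists_arc_of_mem_frontier (a : P ≃ₜ ℂ) (hc : IsClosed D) (hs : IsSurface D) {p : P}
    (hp : p ∈ frontier D) : ∃ r > 0, ∃ γ : ℝ → P, γ 0 = p ∧ ContinuousOn γ (Ioo (-r) r) ∧
      InjOn γ (Ioo (-r) r) ∧ MapsTo γ (Ioo (-r) r) (frontier D) ∧
      ∀ t ∈ Ioo (-r) r, ∀ ε > 0, γ '' (Ioo (-r) r ∩ Ioo (t - ε) (t + ε)) ∈ 𝓝[frontier D] (γ t) := by
  obtain ⟨φ, hφ⟩ := hs.exists_chart ⟨p, hc.frontier_subset hp⟩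
  set p' : D := ⟨p, hc.frontier_subset hp⟩
  have h0 : (φ p').1 0 = 0 := (chart_eq_zero_iff a hc φ hφ).2 hp
  set y := (φ p').1 1
  let k : ℝ → EuclideanHalfSpace 2 := fun t => ⟨!₂[0, y + t], by simp⟩
  have hk : Continuous k := by fun_prop
  have hk0 : k 0 = φ p' := by
    apply Subtype.ext
    ext i; fin_cases i <;> simp [k, h0, y]
  obtain ⟨r, hr, hrt⟩ : ∃ r > 0, ∀ t ∈ Ioo (-r) r, k t ∈ φ.target := by
    have h1 : k ⁻¹' φ.target ∈ 𝓝 (0 : ℝ) :=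
      (φ.open_target.preimage hk).mem_nhds (by rw [mem_preimage, hk0]; exact φ.map_source hφ)
    obtain ⟨r, hr, hrs⟩ := Metric.mem_nhds_iff.1 h1
    exact ⟨r, hr, fun t ht => hrs (by rw [Real.ball_eq_Ioo]; simpa using ht)⟩
  have hfr : ∀ t ∈ Ioo (-r) r, (φ.symm (k t)).1 ∈ frontier D := fun t ht => by
    refine (chart_eq_zero_iff a hc φ (φ.map_target (hrt t ht))).1 ?_
    rw [φ.right_inv (hrt t ht)]
    simp [k]
  refine ⟨r, hr, fun t => (φ.symm (k t)).1, ?_, ?_, ?_, hfr, ?_⟩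
  · change (φ.symm (k 0)).1 = p
    rw [hk0, φ.left_inv hφ]
  · exact continuous_subtype_val.comp_continuousOn
      (φ.continuousOn_symm.comp hk.continuousOn hrt)
  · intro s hs' t ht h
    have h1 := φ.symm.injOn (hrt s hs') (hrt t ht) (Subtype.ext h)
    have h2 := congrArg (fun z : EuclideanHalfSpace 2 => z.1 1) h1
    simpa [k] using h2
  · intro t ht ε hε
    set q := φ.symm (k t)
    have hq : q ∈ φ.source := φ.map_target (hrt t ht)
    have hq1 : (φ q).1 1 = y + t := by
      rw [φ.right_inv (hrt t ht)]; simp [k]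
    have hcont : ContinuousAt (fun z : D => (φ z).1 1 - y) q :=
      ((by fun_prop : Continuous fun z : EuclideanHalfSpace 2 => z.1 1 - y).continuousAt).comp
        (φ.continuousAt hq)
    have hev : ∀ᶠ z in 𝓝 q, z ∈ φ.source ∧
        (φ z).1 1 - y ∈ Ioo (-r) r ∩ Ioo (t - ε) (t + ε) := by
      refine Filter.Eventually.and (φ.open_source.mem_nhds hq)
        (hcont ((isOpen_Ioo.inter isOpen_Ioo).mem_nhds ?_))
      change (φ q).1 1 - y ∈ _
      rw [hq1, add_sub_cancel_left]
      exact ⟨ht, by constructor <;> linarith⟩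
    have h1 : Subtype.val '' {z : D | z ∈ φ.source ∧
        (φ z).1 1 - y ∈ Ioo (-r) r ∩ Ioo (t - ε) (t + ε)} ∈ 𝓝[D] q.1 := by
      rw [nhdsWithin_eq_map_subtype_coe q.2]
      exact Filter.image_mem_map hev
    have h2 := nhdsWithin_mono q.1 hc.frontier_subset h1
    filter_upwards [h2, self_mem_nhdsWithin] with z hz hzf
    obtain ⟨w, ⟨hw, hw'⟩, rfl⟩ := hz
    refine ⟨_, hw', ?_⟩
    have hw0 := (chart_eq_zero_iff a hc φ hw).2 hzf
    have h3 : k ((φ w).1 1 - y) = φ w := by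
      apply Subtype.ext
      ext i; fin_cases i <;> simp [k, hw0]
    change (φ.symm (k ((φ w).1 1 - y))).1 = w.1
    rw [h3, φ.left_inv hw]

/-- A surface in the plane is the closure of its interior. -/
theorem mem_closure_interior_of_mem_frontier (a : P ≃ₜ ℂ) (hc : IsClosed D) (hs : IsSurface D)
    {p : P} (hp : p ∈ frontier D) : p ∈ closure (interior D) := by
  obtain ⟨φ, hφ⟩ := hs.exists_chart ⟨p, hc.frontier_subset hp⟩
  set p' : D := ⟨p, hc.frontier_subset hp⟩
  have h0 : (φ p').1 0 = 0 := (chart_eq_zero_iff a hc φ hφ).2 hp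
  -- The absolute value keeps the path in the half-plane for every `t`; only `t > 0` is used in the
  -- end.
  let k : ℝ → EuclideanHalfSpace 2 := fun t => ⟨!₂[|t|, (φ p').1 1], by simp⟩
  have hk : Continuous k := by fun_prop
  have hk0 : k 0 = φ p' := by
    apply Subtype.ext
    ext i; fin_cases i <;> simp [k, h0]
  have ht : ∀ᶠ t in 𝓝 (0 : ℝ), k t ∈ φ.target :=
    (φ.open_target.preimage hk).mem_nhds (by rw [mem_preimage, hk0]; exact φ.map_source hφ)
  have hlim : Filter.Tendsto (fun t => (φ.symm (k t)).1) (𝓝[>] (0 : ℝ)) (𝓝 p) := by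
    have h1 : ContinuousAt (fun t => (φ.symm (k t)).1) 0 := by
      refine continuous_subtype_val.continuousAt.comp ?_
      refine ContinuousAt.comp (g := φ.symm) ?_ hk.continuousAt
      rw [hk0]
      exact φ.continuousAt_symm (φ.map_source hφ)
    have h2 : (φ.symm (k 0)).1 = p := by rw [hk0, φ.left_inv hφ]
    have h3 := h1.tendsto
    rw [h2] at h3
    exact h3.mono_left nhdsWithin_le_nhds
  refine mem_closure_of_tendsto hlim ?_
  filter_upwards [self_mem_nhdsWithin, mem_nhdsWithin_of_mem_nhds ht] with t ht0 htt
  refine mem_interior_of_chart_pos a φ (φ.map_target htt) ?_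
  rw [φ.right_inv htt]
  simpa [k] using (ne_of_gt ht0)

end Charts

/-! ### The boundary as a pair of graphs -/

theorem injOn_Ico_of_locally {X : ℝ → ℝ} {r : ℝ} (hc : ContinuousOn X (Ico 0 r))
    (hl : ∀ t ∈ Ioo 0 r, ∃ V ∈ 𝓝 t, InjOn X V) : InjOn X (Ico 0 r) := by
  have key : ∀ a ∈ Ico 0 r, ∀ b ∈ Ico 0 r, a < b → X a ≠ X b := by
    intro a ha b hb hab heq
    have hsub : Icc a b ⊆ Ico 0 r := fun x hx => ⟨ha.1.trans hx.1, hx.2.trans_lt hb.2⟩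
    -- Equal values at two points give a local extremum strictly between them, which a locally
    -- injective, hence locally strictly monotone, continuous function does not have.
    obtain ⟨t, ht, hext⟩ := exists_isLocalExtr_Ioo hab (hc.mono hsub) heq
    have ht' : t ∈ Ioo 0 r := ⟨ha.1.trans_lt ht.1, ht.2.trans hb.2⟩
    obtain ⟨V, hV, hVi⟩ := hl t ht'
    have hW : V ∩ Ioo 0 r ∈ 𝓝 t := Filter.inter_mem hV (isOpen_Ioo.mem_nhds ht')
    obtain ⟨W, hWs, hW'⟩ : ∃ W ∈ 𝓝 t, W ⊆ V ∩ Ioo 0 r ∧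
        ((∀ x ∈ W, X t ≤ X x) ∨ ∀ x ∈ W, X x ≤ X t) := by
      rcases hext with h | h
      · exact ⟨_, Filter.inter_mem hW h, inter_subset_left, Or.inl fun x hx => hx.2⟩
      · exact ⟨_, Filter.inter_mem hW h, inter_subset_left, Or.inr fun x hx => hx.2⟩
    obtain ⟨η, hη, hηW⟩ := Metric.nhds_basis_closedBall.mem_iff.1 hWs
    rw [Real.closedBall_eq_Icc] at hηW
    have hm : t ∈ Icc (t - η) (t + η) := ⟨by linarith, by linarith⟩
    have h1 : t - η ∈ Icc (t - η) (t + η) := ⟨le_rfl, by linarith⟩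
    have h2 : t + η ∈ Icc (t - η) (t + η) := ⟨by linarith, le_rfl⟩
    have hlr := ContinuousOn.strictMonoOn_of_injOn_Icc' (f := X) (a := t - η) (b := t + η)
      (by linarith) (hc.mono fun x hx => ⟨(hW'.1 (hηW hx)).2.1.le, (hW'.1 (hηW hx)).2.2⟩)
      (hVi.mono fun x hx => (hW'.1 (hηW hx)).1)
    rcases hlr with h | h <;> rcases hW'.2 with h' | h'
    · exact (h h1 hm (by linarith)).not_ge (h' _ (hηW h1))
    · exact (h hm h2 (by linarith)).not_ge (h' _ (hηW h2))
    · exact (h hm h2 (by linarith)).not_ge (h' _ (hηW h2))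
    · exact (h h1 hm (by linarith)).not_ge (h' _ (hηW h1))
  intro a ha b hb h
  rcases lt_trichotomy a b with h1 | h1 | h1
  · exact absurd h (key a ha b hb h1)
  · exact h1
  · exact absurd h.symm (key b hb a ha h1)

/-- A continuous injective function on `[0, r)` moves away from its value at `0` in a direction `s`,
and has a continuous inverse near that value. -/
theorem exists_inverse_of_injOn {X : ℝ → ℝ} {r : ℝ} (hr : 0 < r) (hc : ContinuousOn X (Ico 0 r))
    (hi : InjOn X (Ico 0 r)) : ∃ s : ℝ, (s = 1 ∨ s = -1) ∧
      (∀ t ∈ Ico 0 r, 0 ≤ s * (X t - X 0)) ∧ ∃ ε > 0, ∃ T : ℝ → ℝ, T 0 = 0 ∧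
        ContinuousOn T (Ico 0 ε) ∧ ∀ u ∈ Ico 0 ε, T u ∈ Ico 0 r ∧ X (T u) = X 0 + s * u := by
  have h0 : (0 : ℝ) ∈ Ico 0 r := ⟨le_rfl, hr⟩
  obtain ⟨s, hs, hmono⟩ : ∃ s : ℝ, (s = 1 ∨ s = -1) ∧
      StrictMonoOn (fun t => s * (X t - X 0)) (Ico 0 r) := by
    have key : StrictMonoOn X (Ico 0 r) ∨ StrictAntiOn X (Ico 0 r) := by
      have h1 : 0 < r / 2 := by linarith
      have hsub : ∀ b ∈ Ico 0 r, Icc 0 b ⊆ Ico 0 r := fun b hb x hx => ⟨hx.1, hx.2.trans_lt hb.2⟩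
      have hb : ∀ b ∈ Ico 0 r, StrictMonoOn X (Icc 0 b) ∨ StrictAntiOn X (Icc 0 b) := fun b hb =>
        ContinuousOn.strictMonoOn_of_injOn_Icc' hb.1 (hc.mono (hsub b hb)) (hi.mono (hsub b hb))
      -- The behaviour on `[0, r / 2]` fixes the direction. The interval up to `max b (r / 2)`
      -- contains it, so it has the same direction.
      rcases hb (r / 2) ⟨h1.le, by linarith⟩ with h2 | h2
      · left
        intro a ha b hb' hab
        have hm : max b (r / 2) ∈ Ico 0 r := ⟨le_max_of_le_left hb'.1, max_lt hb'.2 (by linarith)⟩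
        rcases hb _ hm with h3 | h3
        · exact h3 ⟨ha.1, hab.le.trans (le_max_left _ _)⟩ ⟨hb'.1, le_max_left _ _⟩ hab
        · have h4 := h2 ⟨le_rfl, h1.le⟩ ⟨h1.le, le_rfl⟩ h1
          have h5 := h3 ⟨le_rfl, hm.1⟩ ⟨h1.le, le_max_right _ _⟩ h1
          exact absurd h4 h5.not_gt
      · right
        intro a ha b hb' hab
        have hm : max b (r / 2) ∈ Ico 0 r := ⟨le_max_of_le_left hb'.1, max_lt hb'.2 (by linarith)⟩
        rcases hb _ hm with h3 | h3
        · have h4 := h2 ⟨le_rfl, h1.le⟩ ⟨h1.le, le_rfl⟩ h1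
          have h5 := h3 ⟨le_rfl, hm.1⟩ ⟨h1.le, le_max_right _ _⟩ h1
          exact absurd h4 h5.not_gt
        · exact h3 ⟨ha.1, hab.le.trans (le_max_left _ _)⟩ ⟨hb'.1, le_max_left _ _⟩ hab
    rcases key with h | h
    · exact ⟨1, Or.inl rfl, fun a ha b hb hab => by have := h ha hb hab; dsimp only; linarith⟩
    · exact ⟨-1, Or.inr rfl, fun a ha b hb hab => by have := h ha hb hab; dsimp only; linarith⟩
  have hss : s * s = 1 := by rcases hs with rfl | rfl <;> norm_num
  refine ⟨s, hs, fun t ht => ?_, ?_⟩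
  · have := hmono.monotoneOn h0 ht ht.1
    simpa using this
  have h2 : Icc 0 (r / 2) ⊆ Ico 0 r := fun x hx => ⟨hx.1, by linarith [hx.2]⟩
  have hr2 : 0 < r / 2 := by linarith
  let W : Icc 0 (r / 2) → ℝ := fun t => s * (X t - X 0)
  have hWc : Continuous W := by
    have : Continuous fun t : Icc 0 (r / 2) => X t :=
      continuousOn_iff_continuous_domRestrict.1 (hc.mono h2)
    exact continuous_const.mul (this.sub continuous_const)
  have hWi : W.Injective := fun a b h => Subtype.ext (hmono.injOn (h2 a.2) (h2 b.2) h)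
  have hemb := hWc.isClosedEmbedding hWi
  let e := hemb.isEmbedding.toHomeomorph
  have he : ∀ t, e t = ⟨W t, t, rfl⟩ := fun t => rfl
  have hε : 0 < s * (X (r / 2) - X 0) := by
    have := hmono h0 (h2 ⟨hr2.le, le_rfl⟩) hr2
    simpa using this
  have hW0 : W ⟨0, le_rfl, hr2.le⟩ = 0 := by simp [W]
  have hsub : Ico 0 (s * (X (r / 2) - X 0)) ⊆ range W := by
    have : PreconnectedSpace (Icc 0 (r / 2)) := Subtype.preconnectedSpace isPreconnected_Icc
    have h3 := intermediate_value_univ (⟨0, le_rfl, hr2.le⟩ : Icc 0 (r / 2))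
      ⟨r / 2, hr2.le, le_rfl⟩ hWc (f := W)
    rw [hW0] at h3
    exact Ico_subset_Icc_self.trans h3
  classical
  let T : ℝ → ℝ := fun u => if h : u ∈ range W then (e.symm ⟨u, h⟩ : ℝ) else 0
  have hT : ∀ u (h : u ∈ range W), T u = e.symm ⟨u, h⟩ := fun u h => dif_pos h
  have hWT : ∀ u (h : u ∈ range W), W (e.symm ⟨u, h⟩) = u := fun u h => by
    have := e.apply_symm_apply ⟨u, h⟩
    rw [he] at this
    exact congrArg Subtype.val this
  refine ⟨_, hε, T, ?_, ?_, fun u hu => ?_⟩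
  · have hm : (0 : ℝ) ∈ range W := ⟨_, hW0⟩
    rw [hT 0 hm]
    have : e.symm ⟨0, hm⟩ = ⟨0, le_rfl, hr2.le⟩ := hWi ((hWT 0 hm).trans hW0.symm)
    rw [this]
  · refine ContinuousOn.mono ?_ hsub
    rw [continuousOn_iff_continuous_domRestrict]
    exact (continuous_subtype_val.comp e.symm.continuous).congr fun u => (hT u.1 u.2).symm
  · have hu' := hsub hu
    rw [hT u hu']
    refine ⟨h2 (e.symm ⟨u, hu'⟩).2, ?_⟩
    have h3 := hWT u hu'
    simp only [W] at h3
    linear_combination s * h3 - (X (e.symm ⟨u, hu'⟩) - X 0) * hss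

/-- A boundary point of a surface in the plane near which, except perhaps at the point itself,
`Prod.fst` is locally injective on the boundary, is the common end of two graphs which make up
the boundary locally. -/
theorem exists_frontier_graphs {A : Set (ℝ × ℝ)} (hc : IsClosed A) (hs : IsSurface A) {c d : ℝ}
    (hp : (c, d) ∈ frontier A)
    (hl : ∀ᶠ q in 𝓝[≠] (c, d), q ∈ frontier A → ∃ U ∈ 𝓝 q, InjOn Prod.fst (frontier A ∩ U)) :
    ∃ s t : ℝ, (s = 1 ∨ s = -1) ∧ (t = 1 ∨ t = -1) ∧ ∃ ε > 0, ∃ δ > 0, ∃ g h : ℝ → ℝ,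
      ContinuousOn g (Ico 0 ε) ∧ ContinuousOn h (Ico 0 ε) ∧ g 0 = d ∧ h 0 = d ∧
      (∀ u ∈ Ico 0 ε, |g u - d| < δ / 2 ∧ |h u - d| < δ / 2) ∧
      (∀ x y, |x - c| < ε → |y - d| < δ → ((x, y) ∈ frontier A ↔
        (0 ≤ s * (x - c) ∧ y = g (s * (x - c))) ∨ (0 ≤ t * (x - c) ∧ y = h (t * (x - c))))) ∧
      (s = t → ∀ u ∈ Ioo 0 ε, g u ≠ h u) := by
  obtain ⟨r, hr, γ, hγ0, hγc, hγi, hγA, hγn⟩ := exists_arc_of_mem_frontier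
    Complex.equivRealProdCLM.toHomeomorph.symm hc hs hp
  have h0r : (0 : ℝ) ∈ Ioo (-r) r := ⟨by linarith, hr⟩
  -- The points where `Prod.fst` may fail to be locally injective do not accumulate at `(c, d)`. On
  -- a shorter arc the abscissa is therefore locally injective away from the parameter `0`, and each
  -- half of the arc projects injectively.
  obtain ⟨r₁, hr₁, hr₁r, hloc⟩ : ∃ r₁ > 0, r₁ ≤ r ∧ ∀ t ∈ Ioo (-r₁) r₁, t ≠ 0 →
      ∃ U ∈ 𝓝 (γ t), InjOn Prod.fst (frontier A ∩ U) := by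
    have h1 : Filter.Tendsto γ (𝓝[≠] 0) (𝓝[≠] (c, d)) := by
      refine tendsto_nhdsWithin_iff.2 ⟨?_, ?_⟩
      · rw [← hγ0]
        exact (hγc.continuousAt (isOpen_Ioo.mem_nhds h0r)).tendsto.mono_left nhdsWithin_le_nhds
      · filter_upwards [self_mem_nhdsWithin,
          mem_nhdsWithin_of_mem_nhds (isOpen_Ioo.mem_nhds h0r)] with t ht htr h
        exact ht (hγi htr h0r (h.trans hγ0.symm))
    have h2 := eventually_nhdsWithin_iff.1 (h1.eventually hl)
    obtain ⟨η, hη, hηs⟩ := Metric.eventually_nhds_iff_ball.1 h2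
    refine ⟨min η r, lt_min hη hr, min_le_right _ _, fun t ht ht0 => ?_⟩
    have ht1 : |t| < min η r := abs_lt.2 ht
    refine hηs t (by simpa using ht1.trans_le (min_le_left _ _)) ht0 (hγA (abs_lt.1 ?_))
    exact ht1.trans_le (min_le_right _ _)
  have hsub : Ioo (-r₁) r₁ ⊆ Ioo (-r) r := Ioo_subset_Ioo (by linarith) hr₁r
  have hpos : ∀ t ∈ Ico 0 r₁, t ∈ Ioo (-r₁) r₁ := fun t ht => ⟨by linarith [ht.1], ht.2⟩
  have hneg : ∀ t ∈ Ico 0 r₁, -t ∈ Ioo (-r₁) r₁ := fun t ht => ⟨by linarith [ht.2], by linarith [ht.1]⟩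
  have hlocX : ∀ t ∈ Ioo (-r₁) r₁, t ≠ 0 → ∃ V ∈ 𝓝 t, InjOn (fun t => (γ t).1) V := by
    intro t ht ht0
    obtain ⟨U, hU, hUi⟩ := hloc t ht ht0
    refine ⟨Ioo (-r₁) r₁ ∩ γ ⁻¹' U, Filter.inter_mem (isOpen_Ioo.mem_nhds ht)
      (hγc.continuousAt (isOpen_Ioo.mem_nhds (hsub ht)) hU), fun x hx z hz h => ?_⟩
    exact hγi (hsub hx.1) (hsub hz.1)
      (hUi ⟨hγA (hsub hx.1), hx.2⟩ ⟨hγA (hsub hz.1), hz.2⟩ h)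
  have hX : ContinuousOn (fun t => (γ t).1) (Ico 0 r₁) :=
    continuous_fst.comp_continuousOn (hγc.mono fun t ht => hsub (hpos t ht))
  have hX' : ContinuousOn (fun t => (γ (-t)).1) (Ico 0 r₁) :=
    continuous_fst.comp_continuousOn
      (hγc.comp continuous_neg.continuousOn fun t ht => hsub (hneg t ht))
  have hXi := injOn_Ico_of_locally hX fun t ht => hlocX t (hpos t ⟨ht.1.le, ht.2⟩) ht.1.ne'
  have hXi' := injOn_Ico_of_locally hX' fun t ht => by
    obtain ⟨V, hV, hVi⟩ := hlocX (-t) (hneg t ⟨ht.1.le, ht.2⟩) (neg_ne_zero.2 ht.1.ne')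
    exact ⟨_, continuous_neg.continuousAt hV,
      fun x hx z hz h => neg_injective (hVi hx hz h)⟩
  obtain ⟨s, hs1, hs2, ε₁, hε₁, T, hT0, hTc, hT⟩ := exists_inverse_of_injOn hr₁ hX hXi
  obtain ⟨t, ht1, ht2, ε₂, hε₂, T', hT0', hTc', hT'⟩ := exists_inverse_of_injOn hr₁ hX' hXi'
  simp only [neg_zero, hγ0] at hs2 hT ht2 hT'
  have hss : s * s = 1 := by rcases hs1 with rfl | rfl <;> norm_num
  have htt : t * t = 1 := by rcases ht1 with rfl | rfl <;> norm_num
  let g : ℝ → ℝ := fun u => (γ (T u)).2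
  let h : ℝ → ℝ := fun u => (γ (-T' u)).2
  have hgc : ContinuousOn g (Ico 0 ε₁) := continuous_snd.comp_continuousOn
    (hγc.comp hTc fun u hu => hsub (hpos _ (hT u hu).1))
  have hhc : ContinuousOn h (Ico 0 ε₂) := continuous_snd.comp_continuousOn
    (hγc.comp hTc'.neg fun u hu => hsub (hneg _ (hT' u hu).1))
  have hg0 : g 0 = d := by simp only [g, hT0, hγ0]
  have hh0 : h 0 = d := by simp only [h, hT0', neg_zero, hγ0]
  -- In a small box the frontier contains nothing but the arc.
  obtain ⟨δ, hδ, hbox⟩ : ∃ δ > 0, ∀ x y, |x - c| < δ → |y - d| < δ → (x, y) ∈ frontier A →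
      ∃ t ∈ Ioo (-r₁) r₁, γ t = (x, y) := by
    have h1 := hγn 0 h0r r₁ hr₁
    rw [hγ0, mem_nhdsWithin_iff_exists_mem_nhds_inter] at h1
    obtain ⟨u, hu, hus⟩ := h1
    obtain ⟨δ, hδ, hδu⟩ := Metric.mem_nhds_iff.1 hu
    refine ⟨δ, hδ, fun x y hx hy hxy => ?_⟩
    obtain ⟨t, ht, hte⟩ := hus ⟨hδu (by
      rw [Metric.mem_ball, Prod.dist_eq]; exact max_lt hx hy), hxy⟩
    exact ⟨t, by simpa using ht.2, hte⟩
  have hsmall : ∀ k : ℝ → ℝ, ∀ η > 0, ContinuousOn k (Ico 0 η) → k 0 = d →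
      ∃ ε > 0, ε ≤ η ∧ ∀ u ∈ Ico 0 ε, |k u - d| < δ / 2 := by
    intro k η hη hk hk0
    obtain ⟨ε, hε, h1⟩ := Metric.continuousWithinAt_iff.1 (hk 0 ⟨le_rfl, hη⟩) (δ / 2) (half_pos hδ)
    refine ⟨min ε η, lt_min hε hη, min_le_right _ _, fun u hu => ?_⟩
    have := h1 (x := u) ⟨hu.1, hu.2.trans_le (min_le_right _ _)⟩ (by
      rw [Real.dist_eq, sub_zero, abs_of_nonneg hu.1]
      exact hu.2.trans_le (min_le_left _ _))
    rwa [hk0] at this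
  obtain ⟨ε₃, hε₃, hε₃', hgδ⟩ := hsmall g ε₁ hε₁ hgc hg0
  obtain ⟨ε₄, hε₄, hε₄', hhδ⟩ := hsmall h ε₂ hε₂ hhc hh0
  set ε := min δ (min ε₃ ε₄)
  have hεδ : ε ≤ δ := min_le_left _ _
  have hε3 : ε ≤ ε₃ := (min_le_right _ _).trans (min_le_left _ _)
  have hε4 : ε ≤ ε₄ := (min_le_right _ _).trans (min_le_right _ _)
  have habs : ∀ {s x : ℝ}, (s = 1 ∨ s = -1) → |x - c| < ε → s * (x - c) < ε := by
    rintro s x (rfl | rfl) hx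
    · linarith [le_abs_self (x - c)]
    · linarith [neg_abs_le (x - c)]
  refine ⟨s, t, hs1, ht1, ε, lt_min hδ (lt_min hε₃ hε₄), δ, hδ, g, h,
    hgc.mono (Ico_subset_Ico_right (hε3.trans hε₃')),
    hhc.mono (Ico_subset_Ico_right (hε4.trans hε₄')), hg0, hh0,
    fun u hu => ⟨hgδ u ⟨hu.1, hu.2.trans_le hε3⟩, hhδ u ⟨hu.1, hu.2.trans_le hε4⟩⟩, ?_, ?_⟩
  · intro x y hx hy
    constructor
    · intro hxy
      obtain ⟨w, hw, hwe⟩ := hbox x y (hx.trans_le hεδ) hy hxy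
      rcases le_total 0 w with hw0 | hw0
      · left
        have hw' : w ∈ Ico 0 r₁ := ⟨hw0, hw.2⟩
        have h1 := hs2 w hw'
        rw [hwe] at h1
        have h2 := hT (s * (x - c)) ⟨h1, (habs hs1 hx).trans_le (hε3.trans hε₃')⟩
        refine ⟨h1, ?_⟩
        have h3 : T (s * (x - c)) = w := hXi h2.1 hw' (by
          change (γ (T (s * (x - c)))).1 = (γ w).1
          rw [h2.2, hwe]; linear_combination (x - c) * hss)
        simp only [g, h3, hwe]
      · right
        have hw' : -w ∈ Ico 0 r₁ := ⟨by linarith, by linarith [hw.1]⟩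
        have h1 := ht2 (-w) hw'
        rw [neg_neg, hwe] at h1
        have h2 := hT' (t * (x - c)) ⟨h1, (habs ht1 hx).trans_le (hε4.trans hε₄')⟩
        refine ⟨h1, ?_⟩
        have h3 : T' (t * (x - c)) = -w := hXi' h2.1 hw' (by
          change (γ (-T' (t * (x - c)))).1 = (γ (- -w)).1
          rw [h2.2, neg_neg, hwe]; linear_combination (x - c) * htt)
        simp only [h, h3, neg_neg, hwe]
    · rintro (⟨h1, rfl⟩ | ⟨h1, rfl⟩)
      · have h2 := hT (s * (x - c)) ⟨h1, (habs hs1 hx).trans_le (hε3.trans hε₃')⟩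
        convert hγA (hsub (hpos _ h2.1)) using 1
        refine Prod.ext ?_ rfl
        rw [h2.2]; linear_combination -(x - c) * hss
      · have h2 := hT' (t * (x - c)) ⟨h1, (habs ht1 hx).trans_le (hε4.trans hε₄')⟩
        convert hγA (hsub (hneg _ h2.1)) using 1
        refine Prod.ext ?_ rfl
        rw [h2.2]; linear_combination -(x - c) * htt
  -- A common point of the two branches would have parameters `T u ≥ 0` and `-T' u ≤ 0`. Injectivity
  -- of the arc makes both zero, hence `u = 0`.
  · rintro rfl u hu heq
    have h2 := hT u ⟨hu.1.le, hu.2.trans_le (hε3.trans hε₃')⟩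
    have h3 := hT' u ⟨hu.1.le, hu.2.trans_le (hε4.trans hε₄')⟩
    have h4 : γ (T u) = γ (-T' u) := Prod.ext (h2.2.trans h3.2.symm) heq
    have h5 := hγi (hsub (hpos _ h2.1)) (hsub (hneg _ h3.1)) h4
    have h6 : T u = 0 := by linarith [h2.1.1, h3.1.1]
    have h7 := h2.2
    rw [h6, hγ0] at h7
    have h8 : s * u = 0 := by linarith
    rcases mul_eq_zero.1 h8 with h9 | h9
    · rw [h9] at hss; norm_num at hss
    · exact hu.1.ne' h9

/-! ### Position of the surface relative to its boundary graphs -/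

theorem exists_injOn_of_notMem_topCriticalSet {P : Type*} [TopologicalSpace P] {π : P → ℝ}
    {C : Set P} {p : P} (hp : p ∈ C) (hp' : p ∉ topCriticalSet π C) :
    ∃ U ∈ 𝓝 p, InjOn π (C ∩ U) := by
  by_contra hcon
  push Not at hcon
  exact hp' ⟨hp, fun ⟨U, hU, h⟩ => hcon U hU (injOn_iff_injective.2 h.injective)⟩

/-- Each point of `R` slides vertically to the connected skeleton `B`. Connectedness of a region
bounded by graphs thus reduces to that of a curve chosen inside it. -/
theorem isPreconnected_of_vertical {R B : Set (ℝ × ℝ)} (hB : IsPreconnected B) (hBR : B ⊆ R)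
    (H : ∀ x y, (x, y) ∈ R → ∃ y', (x, y') ∈ B ∧ ∀ z ∈ uIcc y y', (x, z) ∈ R) :
    IsPreconnected R := by
  rcases R.eq_empty_or_nonempty with h0 | ⟨q, hq⟩
  · rw [h0]; exact isPreconnected_empty
  obtain ⟨b, hb, -⟩ := H q.1 q.2 hq
  refine isPreconnected_of_forall (q.1, b) fun p hp => ?_
  obtain ⟨y', hy', hz⟩ := H p.1 p.2 hp
  refine ⟨({p.1} ×ˢ uIcc p.2 y') ∪ B, ?_, Or.inr hb, Or.inl ⟨rfl, left_mem_uIcc⟩, ?_⟩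
  · rintro ⟨x, z⟩ (⟨h1, h2⟩ | h)
    · obtain rfl : x = p.1 := h1
      exact hz z h2
    · exact hBR h
  · exact (isPreconnected_singleton.prod isPreconnected_uIcc).union (p.1, y')
      ⟨rfl, right_mem_uIcc⟩ hy' hB

/-- Off the frontier, the space is covered by the disjoint open sets `interior A` and `(closure
A)ᶜ`. -/
theorem subset_or_disjoint_of_disjoint_frontier {X : Type*} [TopologicalSpace X] {A R : Set X}
    (hR : IsPreconnected R) (hd : ∀ p ∈ R, p ∉ frontier A) : R ⊆ A ∨ ∀ p ∈ R, p ∉ A := by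
  by_contra! hcon
  obtain ⟨h1, p, hp, hpA⟩ := hcon
  obtain ⟨q, hq, hqA⟩ := not_subset.1 h1
  have hcov : R ⊆ interior A ∪ (closure A)ᶜ := fun z hz => by
    by_cases hz' : z ∈ closure A
    · exact Or.inl (by_contra fun h => hd z hz ⟨hz', h⟩)
    · exact Or.inr hz'
  obtain ⟨z, -, hz1, hz2⟩ := hR _ _ isOpen_interior isClosed_closure.isOpen_compl hcov
    ⟨p, hp, (hcov hp).resolve_right fun h => h (subset_closure hpA)⟩
    ⟨q, hq, (hcov hq).resolve_left fun h => hqA (interior_subset h)⟩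
  exact hz2 (subset_closure (interior_subset hz1))

section Shapes

variable {A : Set (ℝ × ℝ)} {c d ε δ : ℝ}

theorem box_mem_nhds (hε : 0 < ε) (hδ : 0 < δ) :
    {q : ℝ × ℝ | |q.1 - c| < ε ∧ |q.2 - d| < δ} ∈ 𝓝 (c, d) :=
  ((isOpen_lt (f := fun q : ℝ × ℝ => |q.1 - c|) (by fun_prop) continuous_const).inter
    (isOpen_lt (f := fun q : ℝ × ℝ => |q.2 - d|) (by fun_prop) continuous_const)).mem_nhds
    (by simp [hε, hδ])

theorem not_forall_box_mem (hp : (c, d) ∈ frontier A) (hε : 0 < ε) (hδ : 0 < δ) :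
    ∃ x y, |x - c| < ε ∧ |y - d| < δ ∧ (x, y) ∉ A := by
  by_contra! hcon
  exact hp.2 (mem_interior_iff_mem_nhds.2
    (Filter.mem_of_superset (box_mem_nhds hε hδ) fun q hq => hcon _ _ hq.1 hq.2))

theorem exists_box_mem_interior (hc : IsClosed A) (hs : IsSurface A) (hp : (c, d) ∈ frontier A)
    (hε : 0 < ε) (hδ : 0 < δ) :
    ∃ x y, |x - c| < ε ∧ |y - d| < δ ∧ (x, y) ∈ A ∧ (x, y) ∉ frontier A := by
  obtain ⟨q, hq, hqi⟩ := mem_closure_iff_nhds.1 (mem_closure_interior_of_mem_frontier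
    Complex.equivRealProdCLM.toHomeomorph.symm hc hs hp) _ (box_mem_nhds hε hδ)
  exact ⟨q.1, q.2, hq.1, hq.2, interior_subset hqi, fun h => h.2 hqi⟩

/-- Two graphs which leave a point on opposite sides form a single graph. -/
theorem exists_frontier_graph {s : ℝ} (hs : s = 1 ∨ s = -1) {g h : ℝ → ℝ}
    (hε : 0 < ε) (hg : ContinuousOn g (Ico 0 ε)) (hh : ContinuousOn h (Ico 0 ε)) (hg0 : g 0 = d) (hh0 : h 0 = d)
    (hb : ∀ u ∈ Ico 0 ε, |g u - d| < δ / 2 ∧ |h u - d| < δ / 2)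
    (hf : ∀ x y, |x - c| < ε → |y - d| < δ → ((x, y) ∈ frontier A ↔
      (0 ≤ s * (x - c) ∧ y = g (s * (x - c))) ∨ (0 ≤ -s * (x - c) ∧ y = h (-s * (x - c))))) :
    ∃ G : ℝ → ℝ, ContinuousOn G (Ioo (c - ε) (c + ε)) ∧ (∀ x, |x - c| < ε → |G x - d| < δ / 2) ∧
      ∀ x y, |x - c| < ε → |y - d| < δ → ((x, y) ∈ frontier A ↔ y = G x) := by
  have habs : ∀ {s x : ℝ}, (s = 1 ∨ s = -1) → |x - c| < ε → s * (x - c) < ε := by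
    rintro s x (rfl | rfl) hx
    · linarith [le_abs_self (x - c)]
    · linarith [neg_abs_le (x - c)]
  have hs' : -s = 1 ∨ -s = -1 := by rcases hs with rfl | rfl <;> simp
  -- One of the two terms always equals `d`, so this formula gives the right branch on each side and
  -- is visibly continuous.
  let G : ℝ → ℝ := fun x => g (max 0 (s * (x - c))) + h (max 0 (-s * (x - c))) - d
  have h1 : ∀ x, 0 ≤ s * (x - c) → G x = g (s * (x - c)) := fun x hx => by
    simp only [G]
    rw [max_eq_right hx, max_eq_left (by linarith), hh0]; ring
  have h2 : ∀ x, 0 ≤ -s * (x - c) → G x = h (-s * (x - c)) := fun x hx => by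
    simp only [G]
    rw [max_eq_right hx, max_eq_left (by linarith), hg0]; ring
  have hm : ∀ {s x : ℝ}, (s = 1 ∨ s = -1) → |x - c| < ε → max 0 (s * (x - c)) ∈ Ico 0 ε :=
    fun hs hx => ⟨le_max_left _ _, max_lt hε (habs hs hx)⟩
  have hI : ∀ {x}, x ∈ Ioo (c - ε) (c + ε) → |x - c| < ε := fun hx =>
    abs_lt.2 ⟨by linarith [hx.1], by linarith [hx.2]⟩
  refine ⟨G, ?_, fun x hx => ?_, fun x y hx hy => ?_⟩
  · exact ((hg.comp (by fun_prop) fun x hx => hm hs (hI hx)).add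
      (hh.comp (by fun_prop) fun x hx => hm hs' (hI hx))).sub continuousOn_const
  · rcases le_total 0 (s * (x - c)) with h3 | h3
    · rw [h1 x h3]; exact (hb _ ⟨h3, habs hs hx⟩).1
    · have h4 : 0 ≤ -s * (x - c) := by linarith
      rw [h2 x h4]; exact (hb _ ⟨h4, habs hs' hx⟩).2
  · rw [hf x y hx hy]
    rcases le_total 0 (s * (x - c)) with h3 | h3
    · rw [h1 x h3]
      refine ⟨?_, fun h => Or.inl ⟨h3, h⟩⟩
      rintro (⟨-, h4⟩ | ⟨h4, h5⟩)
      · exact h4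
      · have h6 : s * (x - c) = 0 := by linarith
        rw [h5, h6, neg_mul, h6, neg_zero, hg0, hh0]
    · have h4 : 0 ≤ -s * (x - c) := by linarith
      rw [h2 x h4]
      refine ⟨?_, fun h => Or.inr ⟨h4, h⟩⟩
      rintro (⟨h4, h5⟩ | ⟨-, h4⟩)
      · have h6 : s * (x - c) = 0 := by linarith
        rw [h5, h6, neg_mul, h6, neg_zero, hg0, hh0]
      · exact h4

/-- In the box the projection is a left inverse of the homeomorphism `x ↦ (x, G x)` onto the
frontier. -/
theorem notMem_topCriticalSet_of_graph (hε : 0 < ε) (hδ : 0 < δ) {G : ℝ → ℝ}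
    (hG : ContinuousOn G (Ioo (c - ε) (c + ε)))
    (hf : ∀ x y, |x - c| < ε → |y - d| < δ → ((x, y) ∈ frontier A ↔ y = G x)) :
    (c, d) ∉ topCriticalSet Prod.fst (frontier A) := by
  intro h
  refine h.2 ⟨_, box_mem_nhds hε hδ, ?_⟩
  set Z := frontier A ∩ {q : ℝ × ℝ | |q.1 - c| < ε ∧ |q.2 - d| < δ}
  have hI : ∀ q : Z, q.1.1 ∈ Ioo (c - ε) (c + ε) := fun q => by
    have := abs_lt.1 q.2.2.1
    constructor <;> linarith
  let f : Z → Ioo (c - ε) (c + ε) := fun q => ⟨q.1.1, hI q⟩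
  let k : Ioo (c - ε) (c + ε) → ℝ × ℝ := fun x => (x, G x)
  have hf' : IsEmbedding f := by
    refine .of_comp (g := k) (by fun_prop)
      (continuous_subtype_val.prodMk (continuousOn_iff_continuous_domRestrict.1 hG)) ?_
    convert IsEmbedding.subtypeVal (p := fun q => q ∈ Z) using 1
    ext1 q
    exact Prod.ext rfl ((hf _ _ q.2.2.1 q.2.2.2).1 q.2.1).symm
  exact IsEmbedding.subtypeVal.comp hf'

/-- Near a graph in its boundary, a surface in the plane lies on one side of that graph. -/
theorem above_or_below_of_graph (hc : IsClosed A) (hs : IsSurface A) (hp : (c, d) ∈ frontier A)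
    (hε : 0 < ε) (hδ : 0 < δ) {G : ℝ → ℝ} (hb : ∀ x, |x - c| < ε → |G x - d| < δ / 2)
    (hf : ∀ x y, |x - c| < ε → |y - d| < δ → ((x, y) ∈ frontier A ↔ y = G x)) :
    (∀ x y, |x - c| < ε → |y - d| < δ → ((x, y) ∈ A ↔ G x ≤ y)) ∨
    (∀ x y, |x - c| < ε → |y - d| < δ → ((x, y) ∈ A ↔ y ≤ G x)) := by
  have hb' : ∀ {x}, |x - c| < ε → d - δ / 2 < G x ∧ G x < d + δ / 2 := fun {x} hx => by
    have := abs_lt.1 (hb x hx); constructor <;> linarith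
  have hI : ∀ {x}, x ∈ Ioo (c - ε) (c + ε) ↔ |x - c| < ε := fun {x} => by
    rw [abs_lt]; constructor <;> rintro ⟨h1, h2⟩ <;> constructor <;> linarith
  have hline : ∀ k : ℝ, IsPreconnected (Ioo (c - ε) (c + ε) ×ˢ {k}) := fun k =>
    isPreconnected_Ioo.prod isPreconnected_singleton
  have hup : IsPreconnected {q : ℝ × ℝ | |q.1 - c| < ε ∧ G q.1 < q.2 ∧ q.2 < d + δ} := by
    refine isPreconnected_of_vertical (hline (d + δ / 2)) ?_ ?_
    · rintro ⟨x, y⟩ ⟨hx, rfl⟩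
      exact ⟨hI.1 hx, (hb' (hI.1 hx)).2, by dsimp only; linarith⟩
    · rintro x y ⟨hx, h1, h2⟩
      refine ⟨d + δ / 2, ⟨hI.2 hx, rfl⟩, fun z hz => ⟨hx, ?_⟩⟩
      exact ordConnected_Ioo.uIcc_subset (s := Ioo (G x) (d + δ)) ⟨h1, h2⟩
        ⟨(hb' hx).2, by linarith⟩ hz
  have hdn : IsPreconnected {q : ℝ × ℝ | |q.1 - c| < ε ∧ d - δ < q.2 ∧ q.2 < G q.1} := by
    refine isPreconnected_of_vertical (hline (d - δ / 2)) ?_ ?_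
    · rintro ⟨x, y⟩ ⟨hx, rfl⟩
      exact ⟨hI.1 hx, by dsimp only; linarith, (hb' (hI.1 hx)).1⟩
    · rintro x y ⟨hx, h1, h2⟩
      refine ⟨d - δ / 2, ⟨hI.2 hx, rfl⟩, fun z hz => ⟨hx, ?_⟩⟩
      exact ordConnected_Ioo.uIcc_subset (s := Ioo (d - δ) (G x)) ⟨h1, h2⟩
        ⟨by linarith, (hb' hx).1⟩ hz
  have hup' := subset_or_disjoint_of_disjoint_frontier hup fun q hq h => by
    have := (hf q.1 q.2 hq.1 (abs_lt.2 ⟨by linarith [hq.2.1, (hb' hq.1).1], by linarith [hq.2.2]⟩)).1 h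
    exact hq.2.1.ne' this
  have hdn' := subset_or_disjoint_of_disjoint_frontier hdn fun q hq h => by
    have := (hf q.1 q.2 hq.1 (abs_lt.2 ⟨by linarith [hq.2.1], by linarith [hq.2.2, (hb' hq.1).2]⟩)).1 h
    exact hq.2.2.ne this
  have hgr : ∀ x y, |x - c| < ε → |y - d| < δ → y = G x → (x, y) ∈ A := fun x y hx hy h =>
    hc.frontier_subset ((hf x y hx hy).2 h)
  -- If both sides were in `A`, the point would be interior; if neither were, `A` would have no
  -- interior points in the box, although it is the closure of its interior.
  rcases hup' with hu | hu <;> rcases hdn' with hd | hd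
  · obtain ⟨x, y, hx, hy, hA⟩ := not_forall_box_mem hp hε hδ
    have hy' := abs_lt.1 hy
    rcases lt_trichotomy y (G x) with h | h | h
    · exact absurd (hd ⟨hx, by linarith, h⟩) hA
    · exact absurd (hgr x y hx hy h) hA
    · exact absurd (hu ⟨hx, h, by linarith⟩) hA
  · refine Or.inl fun x y hx hy => ⟨fun h => not_lt.1 fun h' => ?_, fun h => ?_⟩
    · exact hd (x, y) ⟨hx, by linarith [(abs_lt.1 hy).1], h'⟩ h
    · rcases h.eq_or_lt with h' | h'
      · exact hgr x y hx hy h'.symm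
      · exact hu ⟨hx, h', by linarith [(abs_lt.1 hy).2]⟩
  · refine Or.inr fun x y hx hy => ⟨fun h => not_lt.1 fun h' => ?_, fun h => ?_⟩
    · exact hu (x, y) ⟨hx, h', by linarith [(abs_lt.1 hy).2]⟩ h
    · rcases h.eq_or_lt with h' | h'
      · exact hgr x y hx hy h'
      · exact hd ⟨hx, by linarith [(abs_lt.1 hy).1], h'⟩
  · obtain ⟨x, y, hx, hy, hA, hF⟩ := exists_box_mem_interior hc hs hp hε hδ
    have hy' := abs_lt.1 hy
    rcases lt_trichotomy y (G x) with h | h | h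
    · exact absurd hA (hd (x, y) ⟨hx, by linarith, h⟩)
    · exact absurd ((hf x y hx hy).2 h) hF
    · exact absurd hA (hu (x, y) ⟨hx, h, by linarith⟩)

/-- Near two graphs in its boundary which leave a point on the same side, a surface in the plane
lies either between the two graphs or outside of them. -/
theorem inside_or_outside_of_graphs (hc : IsClosed A) (hs : IsSurface A)
    (hp : (c, d) ∈ frontier A) {s : ℝ} (hs1 : s = 1 ∨ s = -1) (hε : 0 < ε) (hδ : 0 < δ)
    {g h : ℝ → ℝ} (hg : ContinuousOn g (Ico 0 ε)) (hh : ContinuousOn h (Ico 0 ε))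
    (hg0 : g 0 = d) (hh0 : h 0 = d)
    (hb : ∀ u ∈ Ico 0 ε, |g u - d| < δ / 2 ∧ |h u - d| < δ / 2)
    (hf : ∀ x y, |x - c| < ε → |y - d| < δ → ((x, y) ∈ frontier A ↔
      (0 ≤ s * (x - c) ∧ y = g (s * (x - c))) ∨ (0 ≤ s * (x - c) ∧ y = h (s * (x - c)))))
    (hgh : ∀ u ∈ Ioo 0 ε, g u < h u) :
    (∀ x y, |x - c| < ε → |y - d| < δ → ((x, y) ∈ A ↔
      0 ≤ s * (x - c) ∧ g (s * (x - c)) ≤ y ∧ y ≤ h (s * (x - c)))) ∨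
    (∀ x y, |x - c| < ε → |y - d| < δ → ((x, y) ∈ A ↔
      s * (x - c) < 0 ∨ y ≤ g (s * (x - c)) ∨ h (s * (x - c)) ≤ y)) := by
  have hss : s * s = 1 := by rcases hs1 with rfl | rfl <;> norm_num
  have habs : ∀ {x}, |x - c| < ε → s * (x - c) < ε := by
    intro x hx
    rcases hs1 with rfl | rfl
    · linarith [le_abs_self (x - c)]
    · linarith [neg_abs_le (x - c)]
  have habs' : ∀ {u}, |u| < ε → |c + s * u - c| < ε := by
    intro u hu
    rcases hs1 with rfl | rfl <;> simpa using hu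
  have hb' : ∀ {u}, u ∈ Ico 0 ε → (d - δ / 2 < g u ∧ g u < d + δ / 2) ∧
      (d - δ / 2 < h u ∧ h u < d + δ / 2) := fun {u} hu => by
    have h1 := abs_lt.1 (hb u hu).1
    have h2 := abs_lt.1 (hb u hu).2
    refine ⟨⟨?_, ?_⟩, ?_, ?_⟩ <;> linarith
  have hle : ∀ {u}, u ∈ Ico 0 ε → g u ≤ h u := fun {u} hu => by
    rcases hu.1.eq_or_lt with rfl | h1
    · rw [hg0, hh0]
    · exact (hgh u ⟨h1, hu.2⟩).le
  have hI : ∀ {x}, x ∈ Ioo (c - ε) (c + ε) ↔ |x - c| < ε := fun {x} => by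
    rw [abs_lt]; constructor <;> rintro ⟨h1, h2⟩ <;> constructor <;> linarith
  have hline : ∀ k : ℝ, IsPreconnected (Ioo (c - ε) (c + ε) ×ˢ {k}) := fun k =>
    isPreconnected_Ioo.prod isPreconnected_singleton
  have hin : IsPreconnected {q : ℝ × ℝ | |q.1 - c| < ε ∧ 0 < s * (q.1 - c) ∧
      g (s * (q.1 - c)) < q.2 ∧ q.2 < h (s * (q.1 - c))} := by
    refine isPreconnected_of_vertical
      (B := (fun u => (c + s * u, (g u + h u) / 2)) '' Ioo 0 ε) ?_ ?_ ?_
    · refine isPreconnected_Ioo.image _ (ContinuousOn.prodMk (by fun_prop) ?_)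
      exact ((hg.mono Ioo_subset_Ico_self).add (hh.mono Ioo_subset_Ico_self)).div_const 2
    · rintro _ ⟨u, hu, rfl⟩
      have h1 : s * (c + s * u - c) = u := by linear_combination u * hss
      have h2 := hgh u hu
      refine ⟨habs' (by rw [abs_of_pos hu.1]; exact hu.2), ?_⟩
      dsimp only
      rw [h1]
      exact ⟨hu.1, by linarith, by linarith⟩
    · rintro x y ⟨hx, h0, h1, h2⟩
      dsimp only at hx h0 h1 h2
      refine ⟨_, ⟨s * (x - c), ⟨h0, habs hx⟩, Prod.ext ?_ rfl⟩, fun z hz => ⟨hx, h0, ?_⟩⟩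
      · dsimp only; linear_combination (x - c) * hss
      · exact ordConnected_Ioo.uIcc_subset (s := Ioo (g (s * (x - c))) (h (s * (x - c)))) ⟨h1, h2⟩
          ⟨by linarith, by linarith⟩ hz
  have hout : IsPreconnected {q : ℝ × ℝ | |q.1 - c| < ε ∧ |q.2 - d| < δ ∧ (s * (q.1 - c) < 0 ∨
      q.2 < g (s * (q.1 - c)) ∨ h (s * (q.1 - c)) < q.2)} := by
    -- The outer region retracts vertically to three sides of a frame: one line above both graphs,
    -- one below, and a vertical segment on the side where there are no graphs.
    refine isPreconnected_of_vertical
      (B := (Ioo (c - ε) (c + ε) ×ˢ {d + δ / 2} ∪ {c + s * (-(ε / 2))} ×ˢ Ioo (d - δ) (d + δ)) ∪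
        Ioo (c - ε) (c + ε) ×ˢ {d - δ / 2}) ?_ ?_ ?_
    · have hm : c + s * (-(ε / 2)) ∈ Ioo (c - ε) (c + ε) :=
        hI.2 (habs' (by rw [abs_neg, abs_of_pos (by linarith)]; linarith))
      refine IsPreconnected.union (c + s * (-(ε / 2)), d - δ / 2) (Or.inr ⟨rfl, ?_⟩) ⟨hm, rfl⟩
        (IsPreconnected.union (c + s * (-(ε / 2)), d + δ / 2) ⟨hm, rfl⟩ ⟨rfl, ?_⟩ (hline _)
          (isPreconnected_singleton.prod isPreconnected_Ioo)) (hline _)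
      all_goals dsimp only; constructor <;> linarith
    · rintro ⟨x, y⟩ ((⟨hx, hy⟩ | ⟨hx, hy⟩) | ⟨hx, hy⟩)
      · obtain rfl : y = d + δ / 2 := hy
        have hx' := hI.1 hx
        refine ⟨hx', by dsimp only; rw [abs_lt]; constructor <;> linarith, ?_⟩
        by_cases h0 : s * (x - c) < 0
        · exact Or.inl h0
        · exact Or.inr (Or.inr (hb' ⟨not_lt.1 h0, habs hx'⟩).2.2)
      · obtain rfl : x = c + s * (-(ε / 2)) := hx
        refine ⟨habs' (by rw [abs_neg, abs_of_pos (by linarith)]; linarith), ?_, Or.inl ?_⟩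
        · rw [abs_lt]; constructor <;> linarith [hy.1, hy.2]
        · have h1 : s * (c + s * (-(ε / 2)) - c) = -(ε / 2) := by
            linear_combination (-(ε / 2)) * hss
          dsimp only
          linarith
      · obtain rfl : y = d - δ / 2 := hy
        have hx' := hI.1 hx
        refine ⟨hx', by dsimp only; rw [abs_lt]; constructor <;> linarith, ?_⟩
        by_cases h0 : s * (x - c) < 0
        · exact Or.inl h0
        · exact Or.inr (Or.inl (hb' ⟨not_lt.1 h0, habs hx'⟩).1.1)
    · rintro x y ⟨hx, hy, h1⟩
      dsimp only at hx hy h1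
      have hy' := abs_lt.1 hy
      have hyI : y ∈ Ioo (d - δ) (d + δ) := ⟨by linarith, by linarith⟩
      have hbox : ∀ k ∈ Ioo (d - δ) (d + δ), ∀ z ∈ uIcc y k, |z - d| < δ := fun k hk z hz => by
        have := ordConnected_Ioo.uIcc_subset hyI hk hz
        rw [abs_lt]; constructor <;> linarith [this.1, this.2]
      have hk1 : d + δ / 2 ∈ Ioo (d - δ) (d + δ) := ⟨by linarith, by linarith⟩
      have hk2 : d - δ / 2 ∈ Ioo (d - δ) (d + δ) := ⟨by linarith, by linarith⟩
      by_cases h0 : s * (x - c) < 0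
      · exact ⟨d + δ / 2, Or.inl (Or.inl ⟨hI.2 hx, rfl⟩),
          fun z hz => ⟨hx, hbox _ hk1 z hz, Or.inl h0⟩⟩
      · have hu : s * (x - c) ∈ Ico 0 ε := ⟨not_lt.1 h0, habs hx⟩
        rcases h1.resolve_left h0 with h2 | h2
        · refine ⟨d - δ / 2, Or.inr ⟨hI.2 hx, rfl⟩,
            fun z hz => ⟨hx, hbox _ hk2 z hz, Or.inr (Or.inl ?_)⟩⟩
          exact ordConnected_Iio.uIcc_subset (s := Iio (g (s * (x - c)))) h2 (hb' hu).1.1 hz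
        · refine ⟨d + δ / 2, Or.inl (Or.inl ⟨hI.2 hx, rfl⟩),
            fun z hz => ⟨hx, hbox _ hk1 z hz, Or.inr (Or.inr ?_)⟩⟩
          exact ordConnected_Ioi.uIcc_subset (s := Ioi (h (s * (x - c)))) h2 (hb' hu).2.2 hz
  have hin' := subset_or_disjoint_of_disjoint_frontier hin fun q hq h1 => by
    obtain ⟨hx, h0, h2, h3⟩ := hq
    have hu := hb' ⟨h0.le, habs hx⟩
    rcases (hf q.1 q.2 hx (abs_lt.2 ⟨by linarith [hu.1.1], by linarith [hu.2.2]⟩)).1 h1 with h | h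
    · exact h2.ne' h.2
    · exact h3.ne h.2
  have hout' := subset_or_disjoint_of_disjoint_frontier hout fun q hq h1 => by
    obtain ⟨hx, hy, h2⟩ := hq
    have h3 := (hf q.1 q.2 hx hy).1 h1
    have h0 : 0 ≤ s * (q.1 - c) := by rcases h3 with h | h <;> exact h.1
    have hu := hle ⟨h0, habs hx⟩
    rcases h2 with h2 | h2 | h2 <;> rcases h3 with h | h <;> linarith [h.1, h.2]
  have hgr : ∀ x y, |x - c| < ε → |y - d| < δ → 0 ≤ s * (x - c) →
      (y = g (s * (x - c)) ∨ y = h (s * (x - c))) → (x, y) ∈ A := fun x y hx hy h0 h1 =>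
    hc.frontier_subset ((hf x y hx hy).2 (h1.imp (⟨h0, ·⟩) (⟨h0, ·⟩)))
  have hcover : ∀ x y, |x - c| < ε → |y - d| < δ →
      (0 < s * (x - c) ∧ g (s * (x - c)) < y ∧ y < h (s * (x - c))) ∨
      (0 ≤ s * (x - c) ∧ (y = g (s * (x - c)) ∨ y = h (s * (x - c)))) ∨
      (s * (x - c) < 0 ∨ y < g (s * (x - c)) ∨ h (s * (x - c)) < y) := by
    intro x y hx hy
    rcases lt_or_ge (s * (x - c)) 0 with h0 | h0
    · exact Or.inr (Or.inr (Or.inl h0))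
    rcases lt_trichotomy y (g (s * (x - c))) with h1 | h1 | h1
    · exact Or.inr (Or.inr (Or.inr (Or.inl h1)))
    · exact Or.inr (Or.inl ⟨h0, Or.inl h1⟩)
    rcases lt_trichotomy y (h (s * (x - c))) with h2 | h2 | h2
    · refine Or.inl ⟨h0.lt_of_ne fun h3 => ?_, h1, h2⟩
      rw [← h3, hg0] at h1
      rw [← h3, hh0] at h2
      exact lt_asymm h1 h2
    · exact Or.inr (Or.inl ⟨h0, Or.inr h2⟩)
    · exact Or.inr (Or.inr (Or.inr (Or.inr h2)))
  -- The cases where the inner and outer regions agree are excluded as for a single graph: one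
  -- contradicts being a frontier point, the other being a limit of interior points.
  rcases hin' with hi | hi <;> rcases hout' with ho | ho
  · obtain ⟨x, y, hx, hy, hA⟩ := not_forall_box_mem hp hε hδ
    rcases hcover x y hx hy with h1 | h1 | h1
    · exact absurd (hi ⟨hx, h1⟩) hA
    · exact absurd (hgr x y hx hy h1.1 h1.2) hA
    · exact absurd (ho ⟨hx, hy, h1⟩) hA
  · refine Or.inl fun x y hx hy => ⟨fun hA => ?_, fun h1 => ?_⟩
    · rcases hcover x y hx hy with h1 | ⟨h0, h1⟩ | h1
      · exact ⟨h1.1.le, h1.2.1.le, h1.2.2.le⟩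
      · have := hle ⟨h0, habs hx⟩
        rcases h1 with h1 | h1
        · exact ⟨h0, h1.ge, h1.le.trans this⟩
        · exact ⟨h0, this.trans h1.ge, h1.le⟩
      · exact absurd hA (ho (x, y) ⟨hx, hy, h1⟩)
    · rcases hcover x y hx hy with h2 | h2 | h2
      · exact hi ⟨hx, h2⟩
      · exact hgr x y hx hy h2.1 h2.2
      · rcases h2 with h2 | h2 | h2 <;> linarith [h1.1, h1.2.1, h1.2.2]
  · refine Or.inr fun x y hx hy => ⟨fun hA => ?_, fun h1 => ?_⟩
    · rcases hcover x y hx hy with h1 | h1 | h1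
      · exact absurd hA (hi (x, y) ⟨hx, h1⟩)
      · exact Or.inr (h1.2.imp (·.le) (·.ge))
      · exact h1.imp id (Or.imp (·.le) (·.le))
    · rcases hcover x y hx hy with h2 | h2 | h2
      · rcases h1 with h1 | h1 | h1 <;> linarith [h2.1, h2.2.1, h2.2.2]
      · exact hgr x y hx hy h2.1 h2.2
      · exact ho ⟨hx, hy, h2⟩
  · obtain ⟨x, y, hx, hy, hA, hF⟩ := exists_box_mem_interior hc hs hp hε hδ
    rcases hcover x y hx hy with h1 | h1 | h1
    · exact absurd hA (hi (x, y) ⟨hx, h1⟩)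
    · exact absurd ((hf x y hx hy).2 (h1.2.imp (⟨h1.1, ·⟩) (⟨h1.1, ·⟩))) hF
    · exact absurd hA (ho (x, y) ⟨hx, hy, h1⟩)

end Shapes

/-! ### Fibres of the surface near critical and noncritical components -/

/-- The points of `A` at heights `y` and `y'` over `x` are joined by a vertical segment in `A`. -/
def Joined (A : Set (ℝ × ℝ)) (x y y' : ℝ) : Prop :=
  ∀ z ∈ uIcc y y', (x, z) ∈ A

namespace Joined

variable {A : Set (ℝ × ℝ)} {x y y' y'' : ℝ}

theorem symm (h : Joined A x y y') : Joined A x y' y := fun z hz => h z (uIcc_comm y y' ▸ hz)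

theorem trans (h : Joined A x y y') (h' : Joined A x y' y'') : Joined A x y y'' := fun z hz =>
  (uIcc_subset_uIcc_union_uIcc hz).elim (h z) (h' z)

theorem left (h : Joined A x y y') : (x, y) ∈ A := h y left_mem_uIcc

theorem right (h : Joined A x y y') : (x, y') ∈ A := h y' right_mem_uIcc

theorem refl (h : (x, y) ∈ A) : Joined A x y y := fun z hz => by
  rw [uIcc_self] at hz
  obtain rfl : z = y := hz
  exact h

theorem of_mem (h : Joined A x y y') {z : ℝ} (hz : z ∈ uIcc y y') : Joined A x y z :=
  fun w hw => h w (uIcc_subset_uIcc_left hz hw)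

end Joined

section Shapes

variable {A : Set (ℝ × ℝ)} {c d : ℝ}

/-- Finiteness of the critical set makes its points isolated; a frontier point close to `p` and
different from it is noncritical. -/
theorem eventually_exists_injOn (hfin : (topCriticalSet Prod.fst (frontier A)).Finite)
    (p : ℝ × ℝ) : ∀ᶠ q in 𝓝[≠] p, q ∈ frontier A → ∃ U ∈ 𝓝 q, InjOn Prod.fst (frontier A ∩ U) := by
  have h1 : ∀ᶠ q in 𝓝 p, q ∉ topCriticalSet Prod.fst (frontier A) \ {p} :=
    (hfin.subset sdiff_subset).isClosed.isOpen_compl.mem_nhds fun h => h.2 rfl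
  filter_upwards [self_mem_nhdsWithin, mem_nhdsWithin_of_mem_nhds h1] with q hq hq' hqA
  exact exists_injOn_of_notMem_topCriticalSet hqA fun h => hq' ⟨h, hq⟩

/-- Two branches on the same side would give two distinct frontier points with the same abscissa
arbitrarily close to the point, against local injectivity. So the branches leave on opposite sides
and form one graph. -/
theorem exists_graph_of_notMem (hc : IsClosed A) (hs : IsSurface A)
    (hfin : (topCriticalSet Prod.fst (frontier A)).Finite) (hp : (c, d) ∈ frontier A)
    (hp' : (c, d) ∉ topCriticalSet Prod.fst (frontier A)) :
    ∃ ε > 0, ∃ δ > 0, ∃ G : ℝ → ℝ, G c = d ∧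
      ((∀ x y, |x - c| < ε → |y - d| < δ → ((x, y) ∈ A ↔ G x ≤ y)) ∨
       (∀ x y, |x - c| < ε → |y - d| < δ → ((x, y) ∈ A ↔ y ≤ G x))) := by
  obtain ⟨s, t, hs1, ht1, ε, hε, δ, hδ, g, h, hg, hh, hg0, hh0, hb, hf, hne⟩ :=
    exists_frontier_graphs hc hs hp (eventually_exists_injOn hfin _)
  have hss : s * s = 1 := by rcases hs1 with rfl | rfl <;> norm_num
  have hst : s ≠ t := by
    rintro rfl
    obtain ⟨U, hU, hUi⟩ := exists_injOn_of_notMem_topCriticalSet hp hp'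
    have hlim : ∀ k : ℝ → ℝ, ContinuousOn k (Ico 0 ε) → k 0 = d →
        ∀ᶠ u in 𝓝[>] (0 : ℝ), (c + s * u, k u) ∈ U := fun k hk hk0 => by
      have h1 : ContinuousWithinAt (fun u => (c + s * u, k u)) (Ico 0 ε) 0 :=
        ((by fun_prop : Continuous fun u : ℝ => c + s * u).continuousWithinAt).prodMk
          (hk 0 ⟨le_rfl, hε⟩)
      have h2 : (c + s * 0, k 0) = (c, d) := by simp [hk0]
      have h3 := h1.tendsto
      rw [h2] at h3
      have h4 := (h3.mono_left (nhdsWithin_mono _ Ioo_subset_Ico_self)).eventually hU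
      rwa [nhdsWithin_Ioo_eq_nhdsGT hε] at h4
    obtain ⟨u, ⟨h1, h2⟩, hu⟩ := (((hlim g hg hg0).and (hlim h hh hh0)).and
      (Ioo_mem_nhdsGT hε)).exists
    have h3 : s * (c + s * u - c) = u := by linear_combination u * hss
    have h4 : |c + s * u - c| < ε := by
      rcases hs1 with rfl | rfl <;> simp [abs_of_pos hu.1, hu.2]
    have h5 := hb u ⟨hu.1.le, hu.2⟩
    have h6 : (c + s * u, g u) ∈ frontier A :=
      (hf _ _ h4 (by linarith)).2 (Or.inl ⟨by rw [h3]; exact hu.1.le, by rw [h3]⟩)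
    have h7 : (c + s * u, h u) ∈ frontier A :=
      (hf _ _ h4 (by linarith)).2 (Or.inr ⟨by rw [h3]; exact hu.1.le, by rw [h3]⟩)
    exact hne rfl u hu (congrArg Prod.snd (hUi ⟨h6, h1⟩ ⟨h7, h2⟩ rfl))
  have ht : t = -s := by
    rcases hs1 with rfl | rfl <;> rcases ht1 with rfl | rfl <;> simp at hst ⊢
  subst ht
  obtain ⟨G, -, hGb, hGf⟩ := exists_frontier_graph hs1 hε hg hh hg0 hh0 hb hf
  refine ⟨ε, hε, δ, hδ, G, ?_, above_or_below_of_graph hc hs hp hε hδ hGb hGf⟩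
  exact ((hGf c d (by simpa) (by simpa)).1 hp).symm

/-- Branches on opposite sides would form one graph, and the point would not be critical. Branches
on the same side never meet again, so one stays below the other; `g` is chosen to be the lower one.
-/
theorem exists_graphs_of_mem (hc : IsClosed A) (hs : IsSurface A)
    (hfin : (topCriticalSet Prod.fst (frontier A)).Finite)
    (hp : (c, d) ∈ topCriticalSet Prod.fst (frontier A)) :
    ∃ s : ℝ, (s = 1 ∨ s = -1) ∧ ∃ ε > 0, ∃ δ > 0, ∃ g h : ℝ → ℝ, ContinuousOn g (Ico 0 ε) ∧
      g 0 = d ∧ h 0 = d ∧ (∀ u ∈ Ico 0 ε, |g u - d| < δ / 2 ∧ |h u - d| < δ / 2) ∧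
      (∀ u ∈ Ioo 0 ε, g u < h u) ∧
      ((∀ x y, |x - c| < ε → |y - d| < δ → ((x, y) ∈ A ↔
        0 ≤ s * (x - c) ∧ g (s * (x - c)) ≤ y ∧ y ≤ h (s * (x - c)))) ∨
      (∀ x y, |x - c| < ε → |y - d| < δ → ((x, y) ∈ A ↔
        s * (x - c) < 0 ∨ y ≤ g (s * (x - c)) ∨ h (s * (x - c)) ≤ y))) := by
  obtain ⟨s, t, hs1, ht1, ε, hε, δ, hδ, g, h, hg, hh, hg0, hh0, hb, hf, hne⟩ :=
    exists_frontier_graphs hc hs hp.1 (eventually_exists_injOn hfin _)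
  have hst : s = t := by
    by_contra hst
    have ht : t = -s := by
      rcases hs1 with rfl | rfl <;> rcases ht1 with rfl | rfl <;> simp at hst ⊢
    subst ht
    obtain ⟨G, hG, hGb, hGf⟩ := exists_frontier_graph hs1 hε hg hh hg0 hh0 hb hf
    exact notMem_topCriticalSet_of_graph hε hδ hG hGf hp
  subst hst
  have hsign : (∀ u ∈ Ioo 0 ε, g u < h u) ∨ ∀ u ∈ Ioo 0 ε, h u < g u := by
    by_contra! hcon
    obtain ⟨⟨u, hu, h1⟩, v, hv, h2⟩ := hcon
    obtain ⟨w, hw, h3⟩ := isPreconnected_Ioo.intermediate_value₂ hv hu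
      (hg.mono Ioo_subset_Ico_self) (hh.mono Ioo_subset_Ico_self) h2 h1
    exact hne rfl w hw h3
  rcases hsign with hsg | hsg
  · exact ⟨s, hs1, ε, hε, δ, hδ, g, h, hg, hg0, hh0, hb, hsg,
      inside_or_outside_of_graphs hc hs hp.1 hs1 hε hδ hg hh hg0 hh0 hb hf hsg⟩
  · have hb' : ∀ u ∈ Ico 0 ε, |h u - d| < δ / 2 ∧ |g u - d| < δ / 2 := fun u hu => (hb u hu).symm
    exact ⟨s, hs1, ε, hε, δ, hδ, h, g, hh, hh0, hg0, hb', hsg,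
      inside_or_outside_of_graphs hc hs hp.1 hs1 hε hδ hh hg hh0 hg0 hb'
        (fun x y hx hy => (hf x y hx hy).trans or_comm) hsg⟩

/-- Near a critical point, a surface in the plane is either a disk attached on one side of the
vertical line, or has two branches on one side of that line. -/
theorem turn_of_mem (hc : IsClosed A) (hs : IsSurface A)
    (hfin : (topCriticalSet Prod.fst (frontier A)).Finite)
    (hp : (c, d) ∈ topCriticalSet Prod.fst (frontier A)) :
    ∃ s : ℝ, (s = 1 ∨ s = -1) ∧ ∃ ε > 0,
      ((∃ δ > 0, ∃ g : ℝ → ℝ, ContinuousOn g (Ioo 0 ε) ∧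
        (∀ u ∈ Ioo 0 ε, (c + s * u, g u) ∈ A) ∧
        ∀ x y, |x - c| < ε → |y - d| < δ → (x, y) ∈ A → 0 ≤ s * (x - c) ∧ (x = c → y = d) ∧
          Joined A x y (g (s * (x - c)))) ∨
      (∃ y₁ y₂, y₁ < d ∧ d < y₂ ∧ Joined A c y₁ y₂ ∧
        (∀ x, |x - c| < ε → (x, y₁) ∈ A ∧ (x, y₂) ∈ A) ∧
        ∀ x, |x - c| < ε → 0 < s * (x - c) → ¬ Joined A x y₁ y₂)) := by
  obtain ⟨s, hs1, ε, hε, δ, hδ, g, h, hg, hg0, hh0, hb, hgh, hcase⟩ :=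
    exists_graphs_of_mem hc hs hfin hp
  have hss : s * s = 1 := by rcases hs1 with rfl | rfl <;> norm_num
  have habs : ∀ {x}, |x - c| < ε → s * (x - c) < ε := by
    intro x hx
    rcases hs1 with rfl | rfl
    · linarith [le_abs_self (x - c)]
    · linarith [neg_abs_le (x - c)]
  have hb' : ∀ {u}, u ∈ Ico 0 ε → (d - δ / 2 < g u ∧ g u < d + δ / 2) ∧
      (d - δ / 2 < h u ∧ h u < d + δ / 2) := fun {u} hu => by
    have h1 := abs_lt.1 (hb u hu).1
    have h2 := abs_lt.1 (hb u hu).2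
    refine ⟨⟨?_, ?_⟩, ?_, ?_⟩ <;> linarith
  refine ⟨s, hs1, ε, hε, ?_⟩
  rcases hcase with hin | hout
  · refine Or.inl ⟨δ, hδ, g, hg.mono Ioo_subset_Ico_self, fun u hu => ?_, fun x y hx hy hA => ?_⟩
    · have h1 : s * (c + s * u - c) = u := by linear_combination u * hss
      have h2 := hb' ⟨hu.1.le, hu.2⟩
      refine (hin _ _ ?_ (abs_lt.2 ⟨by linarith [h2.1.1], by linarith [h2.1.2]⟩)).2 ?_
      · rcases hs1 with rfl | rfl <;> simp [abs_of_pos hu.1, hu.2]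
      · rw [h1]
        exact ⟨hu.1.le, le_rfl, (hgh u hu).le⟩
    · have h1 := (hin x y hx hy).1 hA
      refine ⟨h1.1, ?_, fun z hz => ?_⟩
      · rintro rfl
        have h2 := h1.2
        rw [sub_self, mul_zero, hg0, hh0] at h2
        exact le_antisymm h2.2 h2.1
      · have h2 := hb' ⟨h1.1, habs hx⟩
        have h3 := abs_lt.1 hy
        rw [uIcc_of_ge h1.2.1] at hz
        exact (hin x z hx (abs_lt.2 ⟨by linarith [hz.1, h2.1.1], by linarith [hz.2]⟩)).2
          ⟨h1.1, hz.1, hz.2.trans h1.2.2⟩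
  · right
    have hd1 : ∀ {z}, z ∈ Icc (d - δ / 2) (d + δ / 2) → |z - d| < δ := fun {z} hz =>
      abs_lt.2 ⟨by linarith [hz.1], by linarith [hz.2]⟩
    -- Both graphs stay within `δ / 2` of `d`, so these two heights remain in `A` over the whole
    -- box. On the side `s` the gap between the graphs separates them.
    refine ⟨d - δ / 2, d + δ / 2, by linarith, by linarith, fun z hz => ?_, fun x hx => ⟨?_, ?_⟩,
      fun x hx h0 hJ => ?_⟩
    · rw [uIcc_of_le (by linarith)] at hz
      refine (hout c z (by simpa) (hd1 hz)).2 (Or.inr ?_)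
      rw [sub_self, mul_zero, hg0, hh0]
      exact le_total z d
    · refine (hout x _ hx (hd1 ⟨le_rfl, by linarith⟩)).2 ?_
      rcases lt_or_ge (s * (x - c)) 0 with h0 | h0
      · exact Or.inl h0
      · exact Or.inr (Or.inl (hb' ⟨h0, habs hx⟩).1.1.le)
    · refine (hout x _ hx (hd1 ⟨by linarith, le_rfl⟩)).2 ?_
      rcases lt_or_ge (s * (x - c)) 0 with h0 | h0
      · exact Or.inl h0
      · exact Or.inr (Or.inr (hb' ⟨h0, habs hx⟩).2.2.le)
    · have h1 := hb' ⟨h0.le, habs hx⟩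
      have h2 := hgh _ ⟨h0, habs hx⟩
      have h3 : (g (s * (x - c)) + h (s * (x - c))) / 2 ∈ Icc (d - δ / 2) (d + δ / 2) :=
        ⟨by linarith [h1.1.1, h1.2.1], by linarith [h1.1.2, h1.2.2]⟩
      have h4 := (hout x _ hx (hd1 h3)).1 (hJ _ (by rwa [uIcc_of_le (by linarith)]))
      rcases h4 with h4 | h4 | h4 <;> linarith

/-- Nearby points in a fibre of a surface in the plane are joined in that fibre. -/
theorem exists_joined_of_mem (hc : IsClosed A) (hs : IsSurface A)
    (hfin : (topCriticalSet Prod.fst (frontier A)).Finite) (hp : (c, d) ∈ A) :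
    ∃ δ > 0, ∀ y, |y - d| < δ → (c, y) ∈ A → Joined A c d y := by
  have hd : ∀ {y δ : ℝ}, |y - d| < δ → ∀ z ∈ uIcc d y, |z - d| < δ := fun {y δ} hy z hz => by
    have h := abs_sub_left_of_mem_uIcc hz
    exact h.trans_lt hy
  by_cases hf : (c, d) ∈ frontier A
  · by_cases hS : (c, d) ∈ topCriticalSet Prod.fst (frontier A)
    · obtain ⟨s, hs1, ε, hε, δ, hδ, g, h, hg, hg0, hh0, hb, hgh, hcase⟩ :=
        exists_graphs_of_mem hc hs hfin hS
      refine ⟨δ, hδ, fun y hy hA z hz => ?_⟩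
      rcases hcase with hin | hout
      · have h1 := ((hin c y (by simpa) hy).1 hA).2
        rw [sub_self, mul_zero, hg0, hh0] at h1
        obtain rfl : y = d := le_antisymm h1.2 h1.1
        exact Joined.refl hp z hz
      · refine (hout c z (by simpa) (hd hy z hz)).2 (Or.inr ?_)
        rw [sub_self, mul_zero, hg0, hh0]
        exact le_total z d
    · obtain ⟨ε, hε, δ, hδ, G, hG, hcase⟩ := exists_graph_of_notMem hc hs hfin hf hS
      refine ⟨δ, hδ, fun y hy hA z hz => ?_⟩
      have h0 : |c - c| < ε := by simpa
      rcases hcase with h | h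
      · exact (h c z h0 (hd hy z hz)).2 (ordConnected_Ici.uIcc_subset (s := Ici (G c)) hG.le
          ((h c y h0 hy).1 hA) hz)
      · exact (h c z h0 (hd hy z hz)).2 (ordConnected_Iic.uIcc_subset (s := Iic (G c)) hG.ge
          ((h c y h0 hy).1 hA) hz)
  · have hi : (c, d) ∈ interior A := by
      by_contra h
      exact hf ⟨subset_closure hp, h⟩
    have h1 : ∀ᶠ y in 𝓝 d, (c, y) ∈ A :=
      (by fun_prop : Continuous fun y : ℝ => (c, y)).continuousAt (mem_interior_iff_mem_nhds.1 hi)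
    obtain ⟨δ, hδ, h2⟩ := Metric.eventually_nhds_iff_ball.1 h1
    exact ⟨δ, hδ, fun y hy _ z hz => h2 z (hd hy z hz)⟩

/-- Near a component of a fibre of `A` which contains no critical point, the fibres of `A` are
segments through the points at a fixed height `m`. -/
theorem exists_band_of_noncritical (hc : IsClosed A) (hs : IsSurface A)
    (hfin : (topCriticalSet Prod.fst (frontier A)).Finite) (hcpt : IsCompact {y | (c, y) ∈ A})
    (hp : (c, d) ∈ A)
    (hno : ∀ z, Joined A c d z → (c, z) ∉ topCriticalSet Prod.fst (frontier A)) :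
    ∃ m, ∃ ε > 0, ∃ W : Set (ℝ × ℝ), IsOpen W ∧ (∀ z, Joined A c d z → (c, z) ∈ W) ∧
      Joined A c d m ∧ (∀ x, |x - c| < ε → (x, m) ∈ A) ∧
      ∀ x y, (x, y) ∈ W → (x, y) ∈ A → |x - c| < ε ∧ Joined A x y m := by
  -- The fibre is compact, so the component of `d` is an interval `[a, b]`.
  obtain ⟨a, b, had, hdb, hab, hend⟩ : ∃ a b, a ≤ d ∧ d ≤ b ∧ Joined A c a b ∧
      ∀ z, Joined A c d z → z ∈ Icc a b := by
    have hdK : d ∈ {y | (c, y) ∈ A} := hp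
    have hKc : IsClosed (connectedComponentIn {y | (c, y) ∈ A} d) :=
      isClosed_of_closure_subset <| isPreconnected_connectedComponentIn.closure.subset_connectedComponentIn
        (subset_closure (mem_connectedComponentIn hdK))
        (hcpt.isClosed.closure_subset_iff.2 (connectedComponentIn_subset _ _))
    have hK : IsCompact (connectedComponentIn {y | (c, y) ∈ A} d) :=
      hcpt.of_isClosed_subset hKc (connectedComponentIn_subset _ _)
    have hK' := eq_Icc_of_connected_compact (isConnected_connectedComponentIn_iff.2 hdK) hK
    set K := connectedComponentIn {y | (c, y) ∈ A} d
    have hdK' : d ∈ K := mem_connectedComponentIn hdK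
    have h1 : d ∈ Icc (sInf K) (sSup K) := hK' ▸ hdK'
    refine ⟨sInf K, sSup K, h1.1, h1.2, fun z hz => ?_, fun z hz => ?_⟩
    · rw [uIcc_of_le (h1.1.trans h1.2), ← hK'] at hz
      exact connectedComponentIn_subset {y | (c, y) ∈ A} d hz
    · rw [← hK']
      exact isPreconnected_uIcc.subset_connectedComponentIn left_mem_uIcc (fun w hw => hz w hw)
        right_mem_uIcc
  have hIcc : ∀ {z}, z ∈ Icc a b → (c, z) ∈ A := fun {z} hz =>
    hab z (by rwa [uIcc_of_le (had.trans hdb)])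
  have hJ : ∀ {z}, z ∈ Icc a b → Joined A c d z := fun {z} hz w hw =>
    hIcc (ordConnected_Icc.uIcc_subset ⟨had, hdb⟩ hz hw)
  have h0 : ∀ {η : ℝ}, 0 < η → |c - c| < η := fun hη => by simpa
  -- An end interior to `A` would let the component extend beyond it. The same contradiction then
  -- shows on which side of its boundary graph `A` lies at each end.
  have hfra : (c, a) ∈ frontier A := by
    refine ⟨subset_closure (hab.left), fun hi => ?_⟩
    have h1 : ∀ᶠ y in 𝓝 a, (c, y) ∈ A :=
      (by fun_prop : Continuous fun y : ℝ => (c, y)).continuousAt (mem_interior_iff_mem_nhds.1 hi)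
    obtain ⟨η, hη, h2⟩ := Metric.eventually_nhds_iff_ball.1 h1
    have h3 : Joined A c d (a - η / 2) := (hJ ⟨le_rfl, had.trans hdb⟩).trans fun z hz => by
      rw [uIcc_of_ge (by linarith)] at hz
      refine h2 z ?_
      rw [Metric.mem_ball, Real.dist_eq, abs_lt]
      constructor <;> linarith [hz.1, hz.2]
    linarith [(hend _ h3).1]
  have hfrb : (c, b) ∈ frontier A := by
    refine ⟨subset_closure (hab.right), fun hi => ?_⟩
    have h1 : ∀ᶠ y in 𝓝 b, (c, y) ∈ A :=
      (by fun_prop : Continuous fun y : ℝ => (c, y)).continuousAt (mem_interior_iff_mem_nhds.1 hi)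
    obtain ⟨η, hη, h2⟩ := Metric.eventually_nhds_iff_ball.1 h1
    have h3 : Joined A c d (b + η / 2) := (hJ ⟨had.trans hdb, le_rfl⟩).trans fun z hz => by
      rw [uIcc_of_le (by linarith)] at hz
      refine h2 z ?_
      rw [Metric.mem_ball, Real.dist_eq, abs_lt]
      constructor <;> linarith [hz.1, hz.2]
    linarith [(hend _ h3).2]
  obtain ⟨ε₁, hε₁, δ₁, hδ₁, G, hG, hGA⟩ : ∃ ε > 0, ∃ δ > 0, ∃ G : ℝ → ℝ, G c = a ∧
      ∀ x y, |x - c| < ε → |y - a| < δ → ((x, y) ∈ A ↔ G x ≤ y) := by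
    obtain ⟨ε, hε, δ, hδ, G, hG, h | h⟩ := exists_graph_of_notMem hc hs hfin hfra
      (hno a (hJ ⟨le_rfl, had.trans hdb⟩))
    · exact ⟨ε, hε, δ, hδ, G, hG, h⟩
    · exfalso
      have h3 : Joined A c d (a - δ / 2) := (hJ ⟨le_rfl, had.trans hdb⟩).trans fun z hz => by
        rw [uIcc_of_ge (by linarith)] at hz
        exact (h c z (h0 hε) (abs_lt.2 ⟨by linarith [hz.1], by linarith [hz.2]⟩)).2
          (hG.symm ▸ hz.2)
      linarith [(hend _ h3).1]
  obtain ⟨ε₂, hε₂, δ₂, hδ₂, H, hH, hHA⟩ : ∃ ε > 0, ∃ δ > 0, ∃ G : ℝ → ℝ, G c = b ∧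
      ∀ x y, |x - c| < ε → |y - b| < δ → ((x, y) ∈ A ↔ y ≤ G x) := by
    obtain ⟨ε, hε, δ, hδ, G, hG, h | h⟩ := exists_graph_of_notMem hc hs hfin hfrb
      (hno b (hJ ⟨had.trans hdb, le_rfl⟩))
    · exfalso
      have h3 : Joined A c d (b + δ / 2) := (hJ ⟨had.trans hdb, le_rfl⟩).trans fun z hz => by
        rw [uIcc_of_le (by linarith)] at hz
        exact (h c z (h0 hε) (abs_lt.2 ⟨by linarith [hz.1], by linarith [hz.2]⟩)).2
          (hG.symm ▸ hz.1)
      linarith [(hend _ h3).2]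
    · exact ⟨ε, hε, δ, hδ, G, hG, h⟩
  have hlt : a < b := by
    have h3 : Joined A c d (a + δ₁ / 2) := (hJ ⟨le_rfl, had.trans hdb⟩).trans fun z hz => by
      rw [uIcc_of_le (by linarith)] at hz
      exact (hGA c z (h0 hε₁) (abs_lt.2 ⟨by linarith [hz.1], by linarith [hz.2]⟩)).2
        (hG.symm ▸ hz.1)
    linarith [(hend _ h3).2]
  -- A frontier point strictly inside would be noncritical, so `A` would lie on one side of it in
  -- the fibre, whereas `[a, b]` surrounds it.
  have hint : ∀ z ∈ Ioo a b, (c, z) ∈ interior A := by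
    intro z hz
    by_contra hzi
    have hzf : (c, z) ∈ frontier A := ⟨subset_closure (hIcc ⟨hz.1.le, hz.2.le⟩), hzi⟩
    obtain ⟨ε, hε, δ, hδ, K, hK, h⟩ := exists_graph_of_notMem hc hs hfin hzf
      (hno z (hJ ⟨hz.1.le, hz.2.le⟩))
    rcases h with h | h
    · have h1 : max a (z - δ / 2) < z := max_lt hz.1 (by linarith)
      have h2 := (h c (max a (z - δ / 2)) (h0 hε)
        (abs_lt.2 ⟨by linarith [le_max_right a (z - δ / 2)], by linarith⟩)).1
        (hIcc ⟨le_max_left _ _, (h1.trans hz.2).le⟩)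
      linarith
    · have h1 : z < min b (z + δ / 2) := lt_min hz.2 (by linarith)
      have h2 := (h c (min b (z + δ / 2)) (h0 hε)
        (abs_lt.2 ⟨by linarith, by linarith [min_le_right b (z + δ / 2)]⟩)).1
        (hIcc ⟨(hz.1.trans h1).le, min_le_left _ _⟩)
      linarith
  -- The quarter of the length leaves the midpoint in `[a + δ / 2, b - δ / 2]`, over which a whole
  -- tube lies in `A` by compactness; the boxes at the two ends overlap this tube.
  obtain ⟨δ, hδ, hδ1, hδ2, hδ4⟩ : ∃ δ > 0, δ ≤ δ₁ ∧ δ ≤ δ₂ ∧ δ ≤ (b - a) / 4 :=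
    ⟨min δ₁ (min δ₂ ((b - a) / 4)), lt_min hδ₁ (lt_min hδ₂ (by linarith)), min_le_left _ _,
      (min_le_right _ _).trans (min_le_left _ _), (min_le_right _ _).trans (min_le_right _ _)⟩
  have htube : ∀ᶠ x in 𝓝 c, ∀ z ∈ Icc (a + δ / 2) (b - δ / 2), (x, z) ∈ A :=
    isCompact_Icc.eventually_forall_of_forall_eventually fun z hz =>
      mem_interior_iff_mem_nhds.1 (hint z ⟨by linarith [hz.1], by linarith [hz.2]⟩)
  obtain ⟨ε₃, hε₃, h3⟩ := Metric.eventually_nhds_iff_ball.1 htube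
  obtain ⟨ε, hε, hεε₁, hεε₂, hεε₃⟩ : ∃ ε > 0, ε ≤ ε₁ ∧ ε ≤ ε₂ ∧ ε ≤ ε₃ :=
    ⟨min ε₁ (min ε₂ ε₃), lt_min hε₁ (lt_min hε₂ hε₃), min_le_left _ _,
      (min_le_right _ _).trans (min_le_left _ _), (min_le_right _ _).trans (min_le_right _ _)⟩
  have hmid : ∀ {x z}, |x - c| < ε → z ∈ Icc (a + δ / 2) (b - δ / 2) → (x, z) ∈ A :=
    fun {x z} hx hz => h3 x (hx.trans_le hεε₃) z hz
  have hm : (a + b) / 2 ∈ Icc (a + δ / 2) (b - δ / 2) := ⟨by linarith, by linarith⟩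
  refine ⟨(a + b) / 2, ε, hε, {q | |q.1 - c| < ε ∧ a - δ < q.2 ∧ q.2 < b + δ}, ?_, fun z hz => ?_,
    hJ ⟨by linarith, by linarith⟩, fun x hx => hmid hx hm, ?_⟩
  · exact (isOpen_lt (f := fun q : ℝ × ℝ => |q.1 - c|) (by fun_prop) continuous_const).inter
      ((isOpen_lt continuous_const continuous_snd).inter (isOpen_lt continuous_snd continuous_const))
  · have := hend z hz
    exact ⟨h0 hε, by linarith [this.1], by linarith [this.2]⟩
  · rintro x y ⟨hx, hy1, hy2⟩ hA
    dsimp only at hx hy1 hy2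
    refine ⟨hx, fun z hz => ?_⟩
    rcases lt_or_ge y (a + δ) with hya | hya
    · have h4 := (hGA x y (hx.trans_le hεε₁) (abs_lt.2 ⟨by linarith, by linarith⟩)).1 hA
      rw [uIcc_of_le (by linarith)] at hz
      rcases lt_or_ge z (a + δ) with hza | hza
      · exact (hGA x z (hx.trans_le hεε₁) (abs_lt.2 ⟨by linarith [hz.1], by linarith⟩)).2
          (h4.trans hz.1)
      · exact hmid hx ⟨by linarith, by linarith [hz.2]⟩
    rcases lt_or_ge (b - δ) y with hyb | hyb
    · have h4 := (hHA x y (hx.trans_le hεε₂) (abs_lt.2 ⟨by linarith, by linarith⟩)).1 hA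
      rw [uIcc_of_ge (by linarith)] at hz
      rcases lt_or_ge (b - δ) z with hzb | hzb
      · exact (hHA x z (hx.trans_le hεε₂) (abs_lt.2 ⟨by linarith, by linarith [hz.2]⟩)).2
          (hz.2.trans h4)
      · exact hmid hx ⟨by linarith [hz.1], by linarith⟩
    · exact hmid hx (ordConnected_Icc.uIcc_subset ⟨by linarith, by linarith⟩ hm hz)

end Shapes

/-! ### Sections over intervals and connected components -/

section Sections

variable {Q : Type*} [TopologicalSpace Q] {f : Q → ℝ} {Y : Set Q}

/-- `s` is a section of `f` with values in `Y` over the set `J`. -/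
structure IsSectionOn (f : Q → ℝ) (Y : Set Q) (s : ℝ → Q) (J : Set ℝ) : Prop where
  continuousOn : ContinuousOn s J
  mapsTo : MapsTo s J Y
  apply : ∀ x ∈ J, f (s x) = x

/-- Locally, `Y` is the image of a section of `f` over an interval. -/
def HasLocalSections (f : Q → ℝ) (Y : Set Q) : Prop :=
  ∀ v ∈ Y, ∃ ε > 0, ∃ s : ℝ → Q, IsSectionOn f Y s (Ioo (f v - ε) (f v + ε)) ∧ s (f v) = v ∧
    ∃ U ∈ 𝓝 v, ∀ w ∈ Y ∩ U, f w ∈ Ioo (f v - ε) (f v + ε) ∧ s (f w) = w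

theorem IsSectionOn.mono {s : ℝ → Q} {J J' : Set ℝ} (h : IsSectionOn f Y s J) (hJ : J' ⊆ J) :
    IsSectionOn f Y s J' :=
  ⟨h.continuousOn.mono hJ, h.mapsTo.mono_left hJ, fun x hx => h.apply x (hJ hx)⟩

/-- The coincidence set is closed since `Q` is Hausdorff, and open since near a point of `Y` a point
of `Y` is determined by its value under `f`. -/
theorem IsSectionOn.eqOn [T2Space Q] (hY : HasLocalSections f Y) {s t : ℝ → Q} {J : Set ℝ}
    (hJ : IsPreconnected J) (hs : IsSectionOn f Y s J) (ht : IsSectionOn f Y t J) {x₀ : ℝ}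
    (hx₀ : x₀ ∈ J) (h : s x₀ = t x₀) : EqOn s t J := by
  have : PreconnectedSpace J := Subtype.preconnectedSpace hJ
  have hsc := continuousOn_iff_continuous_domRestrict.1 hs.continuousOn
  have htc := continuousOn_iff_continuous_domRestrict.1 ht.continuousOn
  have hcl : IsClopen {x : J | s x = t x} := by
    refine ⟨isClosed_eq hsc htc, isOpen_iff_mem_nhds.2 fun x hx => ?_⟩
    obtain ⟨ε, -, k, -, -, U, hU, hk⟩ := hY (s x) (hs.mapsTo x.2)
    have hx' : s x = t x := hx
    have h1 : ∀ᶠ z : J in 𝓝 x, s z ∈ U := hsc.continuousAt hU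
    have h2 : ∀ᶠ z : J in 𝓝 x, t z ∈ U := htc.continuousAt (by rw [hx'] at hU; exact hU)
    filter_upwards [h1, h2] with z hz1 hz2
    have h3 := (hk _ ⟨hs.mapsTo z.2, hz1⟩).2
    have h4 := (hk _ ⟨ht.mapsTo z.2, hz2⟩).2
    rw [hs.apply _ z.2] at h3
    rw [ht.apply _ z.2] at h4
    exact h3.symm.trans h4
  intro x hx
  have h1 : (⟨x, hx⟩ : J) ∈ {x : J | s x = t x} := by
    rw [hcl.eq_univ ⟨⟨x₀, hx₀⟩, h⟩]; trivial
  exact h1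

/-- `v` and `w` lie on a common section of `f` over an interval. -/
def SectionRel (f : Q → ℝ) (Y : Set Q) (v w : Q) : Prop :=
  ∃ a b s, IsSectionOn f Y s (Ioo a b) ∧ f v ∈ Ioo a b ∧ f w ∈ Ioo a b ∧ s (f v) = v ∧ s (f w) = w

theorem SectionRel.symm {v w : Q} : SectionRel f Y v w → SectionRel f Y w v := by
  rintro ⟨a, b, s, hs, hv, hw, h1, h2⟩
  exact ⟨a, b, s, hs, hw, hv, h2, h1⟩

/-- The two sections agree over `f w`, hence over the whole overlap of their intervals, and can be
glued. -/
theorem SectionRel.trans [T2Space Q] (hY : HasLocalSections f Y) {v w u : Q} :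
    SectionRel f Y v w → SectionRel f Y w u → SectionRel f Y v u := by
  rintro ⟨a, b, s, hs, hv, hw, h1, h2⟩ ⟨a', b', s', hs', hw', hu, h3, h4⟩
  classical
  have heq : EqOn s s' (Ioo a b ∩ Ioo a' b') := by
    refine IsSectionOn.eqOn hY ?_ (hs.mono inter_subset_left) (hs'.mono inter_subset_right)
      ⟨hw, hw'⟩ (h2.trans h3.symm)
    exact (ordConnected_Ioo.inter ordConnected_Ioo).isPreconnected
  let k : ℝ → Q := fun x => if x ∈ Ioo a b then s x else s' x
  have hk : EqOn k s (Ioo a b) := fun x hx => if_pos hx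
  have hk' : EqOn k s' (Ioo a' b') := fun x hx => by
    by_cases h : x ∈ Ioo a b
    · rw [hk h]; exact heq ⟨h, hx⟩
    · exact if_neg h
  have hun : ∀ x ∈ Ioo (min a a') (max b b'), x ∈ Ioo a b ∨ x ∈ Ioo a' b' := by
    intro x hx
    rcases lt_trichotomy x (f w) with h | h | h
    · rcases min_lt_iff.1 hx.1 with h' | h'
      · exact Or.inl ⟨h', h.trans hw.2⟩
      · exact Or.inr ⟨h', h.trans hw'.2⟩
    · exact Or.inl (h ▸ hw)
    · rcases lt_max_iff.1 hx.2 with h' | h'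
      · exact Or.inl ⟨hw.1.trans h, h'⟩
      · exact Or.inr ⟨hw'.1.trans h, h'⟩
  refine ⟨min a a', max b b', k, ⟨fun x hx => ?_, fun x hx => ?_, fun x hx => ?_⟩,
    ⟨(min_le_left _ _).trans_lt hv.1, hv.2.trans_le (le_max_left _ _)⟩,
    ⟨(min_le_right _ _).trans_lt hu.1, hu.2.trans_le (le_max_right _ _)⟩,
    (hk hv).trans h1, (hk' hu).trans h4⟩
  · rcases hun x hx with h | h
    · exact ((hs.continuousOn.continuousAt (isOpen_Ioo.mem_nhds h)).congr
        (hk.eventuallyEq_of_mem (isOpen_Ioo.mem_nhds h)).symm).continuousWithinAt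
    · exact ((hs'.continuousOn.continuousAt (isOpen_Ioo.mem_nhds h)).congr
        (hk'.eventuallyEq_of_mem (isOpen_Ioo.mem_nhds h)).symm).continuousWithinAt
  · rcases hun x hx with h | h
    · rw [hk h]; exact hs.mapsTo h
    · rw [hk' h]; exact hs'.mapsTo h
  · rcases hun x hx with h | h
    · rw [hk h]; exact hs.apply x h
    · rw [hk' h]; exact hs'.apply x h

/-- The relation is symmetric, transitive and holds between a point of `Y` and its neighbours in
`Y`, so it holds throughout a connected part. Conversely, the image of an interval is connected. -/
theorem mem_connectedComponentIn_iff_sectionRel [T2Space Q] (hY : HasLocalSections f Y) {v w : Q}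
    (hv : v ∈ Y) : w ∈ connectedComponentIn Y v ↔ SectionRel f Y v w := by
  constructor
  · intro hw
    refine isPreconnected_connectedComponentIn.induction₂ (SectionRel f Y) (fun u hu => ?_)
      (fun _ _ _ _ _ _ => SectionRel.trans hY) (fun _ _ _ _ => SectionRel.symm)
      (mem_connectedComponentIn hv) hw
    obtain ⟨ε, hε, s, hs, hsu, U, hU, h⟩ := hY u (connectedComponentIn_subset _ _ hu)
    filter_upwards [self_mem_nhdsWithin, mem_nhdsWithin_of_mem_nhds hU] with z hz hzU
    obtain ⟨h1, h2⟩ := h z ⟨connectedComponentIn_subset _ _ hz, hzU⟩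
    exact ⟨_, _, s, hs, ⟨by linarith, by linarith⟩, h1, hsu, h2⟩
  · rintro ⟨a, b, s, hs, h1, h2, h3, h4⟩
    have h5 := (isPreconnected_Ioo.image s hs.continuousOn).subset_connectedComponentIn
      ⟨_, h1, h3⟩ hs.mapsTo.image_subset
    exact h5 ⟨_, h2, h4⟩

theorem injOn_connectedComponentIn [T2Space Q] (hY : HasLocalSections f Y) {v : Q} (hv : v ∈ Y) :
    InjOn f (connectedComponentIn Y v) := fun u hu w hw h => by
  obtain ⟨a, b, s, -, -, -, h1, h2⟩ :=
    ((mem_connectedComponentIn_iff_sectionRel hY hv).1 hu).symm.trans hY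
      ((mem_connectedComponentIn_iff_sectionRel hY hv).1 hw)
  rw [← h1, ← h2, h]

theorem exists_nhds_inter_subset_connectedComponentIn [T2Space Q] (hY : HasLocalSections f Y)
    {v : Q} (hv : v ∈ Y) : ∃ U ∈ 𝓝 v, Y ∩ U ⊆ connectedComponentIn Y v := by
  obtain ⟨ε, hε, s, hs, hsv, U, hU, h⟩ := hY v hv
  refine ⟨U, hU, fun w hw => (mem_connectedComponentIn_iff_sectionRel hY hv).2 ?_⟩
  exact ⟨_, _, s, hs, ⟨by linarith, by linarith⟩, (h w hw).1, hsv, (h w hw).2⟩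

/-- Components of `Y` are relatively open, hence also relatively closed. -/
theorem closure_connectedComponentIn_inter_subset [T2Space Q] (hY : HasLocalSections f Y) (v : Q) :
    closure (connectedComponentIn Y v) ∩ Y ⊆ connectedComponentIn Y v := by
  rintro w ⟨hw, hwY⟩
  obtain ⟨U, hU, hUY⟩ := exists_nhds_inter_subset_connectedComponentIn hY hwY
  obtain ⟨u, huU, hu⟩ := mem_closure_iff_nhds.1 hw U hU
  have h1 := hUY ⟨connectedComponentIn_subset _ _ hu, huU⟩
  rw [connectedComponentIn_eq hu, ← connectedComponentIn_eq h1]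
  exact mem_connectedComponentIn hwY

/-- A component is the image of a section over an open interval. -/
theorem exists_section_connectedComponentIn [T2Space Q] (hf : Continuous f)
    (hY : HasLocalSections f Y) {v : Q} (hv : v ∈ Y) :
    IsOpen (f '' connectedComponentIn Y v) ∧ (f '' connectedComponentIn Y v).OrdConnected ∧
    ∃ s : ℝ → Q, IsSectionOn f (connectedComponentIn Y v) s (f '' connectedComponentIn Y v) ∧
      ∀ w ∈ connectedComponentIn Y v, s (f w) = w := by
  have hinj := injOn_connectedComponentIn hY hv
  set E := connectedComponentIn Y v
  have : Nonempty Q := ⟨v⟩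
  let k := Function.invFunOn f E
  have hkE : MapsTo k (f '' E) E := fun x hx => Function.invFunOn_mem hx
  have hkf : ∀ x ∈ f '' E, f (k x) = x := fun x hx => Function.invFunOn_eq hx
  have hkk : ∀ w ∈ E, k (f w) = w := fun w hw =>
    hinj (hkE ⟨w, hw, rfl⟩) hw (hkf _ ⟨w, hw, rfl⟩)
  have hloc : ∀ w ∈ E, f '' E ∈ 𝓝 (f w) ∧ ContinuousAt k (f w) := by
    intro w hw
    obtain ⟨ε, hε, s, hs, hsw, -⟩ := hY w (connectedComponentIn_subset _ _ hw)
    have hm : f w ∈ Ioo (f w - ε) (f w + ε) := ⟨by linarith, by linarith⟩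
    have hsE : MapsTo s (Ioo (f w - ε) (f w + ε)) E := fun x hx => by
      have h5 := (isPreconnected_Ioo.image s hs.continuousOn).subset_connectedComponentIn
        ⟨_, hm, hsw⟩ hs.mapsTo.image_subset
      rw [← connectedComponentIn_eq hw] at h5
      exact h5 ⟨x, hx, rfl⟩
    have hI := isOpen_Ioo.mem_nhds hm
    refine ⟨Filter.mem_of_superset hI fun x hx => ⟨s x, hsE hx, hs.apply x hx⟩, ?_⟩
    refine (hs.continuousOn.continuousAt hI).congr ?_
    filter_upwards [hI] with x hx
    have := hkk (s x) (hsE hx)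
    rw [hs.apply x hx] at this
    exact this.symm
  refine ⟨isOpen_iff_mem_nhds.2 ?_, (isPreconnected_connectedComponentIn.image f
    hf.continuousOn).ordConnected, k, ⟨?_, hkE, hkf⟩, hkk⟩
  · rintro _ ⟨w, hw, rfl⟩
    exact (hloc w hw).1
  · rintro _ ⟨w, hw, rfl⟩
    exact (hloc w hw).2.continuousWithinAt

end Sections

/-! ### Intervals and their end points -/

section Intervals

theorem encard_closure_diff_le_two {J : Set ℝ} (hJ : J.OrdConnected) :
    (closure J \ J).encard ≤ 2 := by
  by_contra! hcon
  obtain ⟨S, hS, hS3⟩ := exists_subset_encard_eq (show (3 : ℕ∞) ≤ _ from by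
    have := Order.add_one_le_of_lt hcon
    norm_num at this
    exact this)
  obtain ⟨x, y, z, hxy, hxz, hyz, rfl⟩ := encard_eq_three.1 hS3
  have hx := hS (mem_insert x _)
  have hy := hS (mem_insert_of_mem x (mem_insert y _))
  have hz := hS (mem_insert_of_mem x (mem_insert_of_mem y (mem_singleton z)))
  -- The middle one of three points of the closure lies between two points of `J`, hence in `J`.
  have key : ∀ {x y z}, x ∈ closure J \ J → y ∈ closure J \ J → z ∈ closure J \ J →
      x < y → y < z → False := by
    intro x y z hx hy hz hxy hyz
    obtain ⟨u, hu, huJ⟩ := mem_closure_iff.1 hx.1 _ isOpen_Iio hxy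
    obtain ⟨w, hw, hwJ⟩ := mem_closure_iff.1 hz.1 _ isOpen_Ioi hyz
    exact hy.2 (hJ.out huJ hwJ ⟨le_of_lt hu, le_of_lt hw⟩)
  rcases hxy.lt_or_gt with h1 | h1 <;> rcases hxz.lt_or_gt with h2 | h2 <;>
    rcases hyz.lt_or_gt with h3 | h3
  · exact key hx hy hz h1 h3
  · exact key hx hz hy h2 h3
  · linarith
  · exact key hz hx hy h2 h1
  · exact key hy hx hz h1 h2
  · linarith
  · exact key hy hz hx h3 h2
  · exact key hz hy hx h3 h1

/-- The open intervals whose end points lie in a given finite set all meet some finite set. -/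
theorem exists_finite_inter_nonempty {K : Set ℝ} (hK : K.Finite) : ∃ T : Set ℝ, T.Finite ∧
    ∀ J : Set ℝ, IsOpen J → J.OrdConnected → J.Nonempty → closure J \ J ⊆ K →
      (J ∩ T).Nonempty := by
  -- One family for each kind of interval: the whole line, half-lines going up, half-lines going
  -- down, and bounded intervals, represented by their midpoints.
  refine ⟨{0} ∪ ((fun k => k + 1) '' K ∪ ((fun k => k - 1) '' K ∪
    (fun p : ℝ × ℝ => (p.1 + p.2) / 2) '' (K ×ˢ K))), ?_, ?_⟩
  · exact (finite_singleton 0).union ((hK.image _).union ((hK.image _).union ((hK.prod hK).image _)))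
  intro J ho hc hn hJK
  have hsup : BddAbove J → sSup J ∈ K := fun hb => hJK ⟨csSup_mem_closure hn hb, fun h => by
    obtain ⟨y, hy, hyJ⟩ := Filter.nonempty_of_mem (Filter.inter_mem self_mem_nhdsWithin
      (mem_nhdsWithin_of_mem_nhds (ho.mem_nhds h) : J ∈ 𝓝[>] (sSup J)))
    exact (le_csSup hb hyJ).not_gt hy⟩
  have hinf : BddBelow J → sInf J ∈ K := fun hb => hJK ⟨csInf_mem_closure hn hb, fun h => by
    obtain ⟨y, hy, hyJ⟩ := Filter.nonempty_of_mem (Filter.inter_mem self_mem_nhdsWithin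
      (mem_nhdsWithin_of_mem_nhds (ho.mem_nhds h) : J ∈ 𝓝[<] (sInf J)))
    exact (csInf_le hb hyJ).not_gt hy⟩
  have hp := hc.isPreconnected
  by_cases ha : BddAbove J <;> by_cases hb : BddBelow J
  · refine ⟨(sInf J + sSup J) / 2, IsConnected.Ioo_csInf_csSup_subset ⟨hn, hp⟩ hb ha ?_,
      Or.inr (Or.inr (Or.inr ⟨(sInf J, sSup J), ⟨hinf hb, hsup ha⟩, rfl⟩))⟩
    have hlt : sInf J < sSup J := by
      refine (csInf_le_csSup hn hb ha).lt_of_ne fun h => ?_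
      obtain ⟨x, hx⟩ := hn
      have h1 := (csInf_le hb hx).antisymm (h ▸ le_csSup ha hx)
      have h2 := hinf hb
      obtain ⟨y, hy, hyJ⟩ := Filter.nonempty_of_mem (Filter.inter_mem self_mem_nhdsWithin
        (mem_nhdsWithin_of_mem_nhds (ho.mem_nhds hx) : J ∈ 𝓝[<] x))
      exact (h1 ▸ csInf_le hb hyJ).not_gt hy
    constructor <;> linarith
  · exact ⟨sSup J - 1, hp.Iio_csSup_subset hb ha (by simp), Or.inr (Or.inr (Or.inl
      ⟨_, hsup ha, rfl⟩))⟩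
  · exact ⟨sInf J + 1, hp.Ioi_csInf_subset hb ha (by simp), Or.inr (Or.inl ⟨_, hinf hb, rfl⟩)⟩
  · refine ⟨0, ?_, Or.inl rfl⟩
    rw [hp.eq_univ_of_unbounded hb ha]
    trivial

end Intervals

/-! ### Transversal graphs from local sections -/

section Graph

variable {Q : Type*} [TopologicalSpace Q] [T2Space Q] {f : Q → ℝ} {G V : Set Q}

/-- Two distinct limit points of an edge over the same end value can be separated inside the finite
fibre. Properness confines the nearby part of `G` to the separating open sets, and the end of the
edge, being connected, cannot enter both. -/
theorem injOn_closure_connectedComponentIn (hf : Continuous f) (hG : IsClosed G)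
    (hprop : IsProperMap (G.domRestrict f)) (hfib : ∀ c, (G ∩ f ⁻¹' {c}).Finite)
    (hY : HasLocalSections f (G \ V)) {v : Q} (hv : v ∈ G \ V) :
    InjOn f (closure (connectedComponentIn (G \ V) v)) := by
  obtain ⟨ho, hoc, s, hs, hsE⟩ := exists_section_connectedComponentIn hf hY hv
  have hinj := injOn_connectedComponentIn hY hv
  have hEG : connectedComponentIn (G \ V) v ⊆ G := (connectedComponentIn_subset _ _).trans sdiff_subset
  set E := connectedComponentIn (G \ V) v
  have hcl : closure E ⊆ G := closure_minimal hEG hG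
  -- Over the open interval `f '' E` the closure adds nothing: `s (f w) = w` on `E` passes to the
  -- limit.
  have hmem : ∀ u ∈ closure E, f u ∈ f '' E → u ∈ E := fun u hu hfu => by
    have : (𝓝[E] u).NeBot := mem_closure_iff_nhdsWithin_neBot.1 hu
    have h1 : Filter.Tendsto (fun w => s (f w)) (𝓝[E] u) (𝓝 (s (f u))) :=
      ((hs.continuousOn.continuousAt (ho.mem_nhds hfu)).comp hf.continuousAt).tendsto.mono_left
        nhdsWithin_le_nhds
    have h2 : Filter.Tendsto (fun w => s (f w)) (𝓝[E] u) (𝓝 u) := by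
      refine (Filter.tendsto_id.mono_left nhdsWithin_le_nhds).congr' ?_
      filter_upwards [self_mem_nhdsWithin] with w hw
      exact (hsE w hw).symm
    rw [tendsto_nhds_unique h2 h1]
    exact hs.mapsTo hfu
  intro u hu u' hu' huu
  by_cases hfu : f u ∈ f '' E
  · exact hinj (hmem u hu hfu) (hmem u' hu' (huu ▸ hfu)) huu
  by_contra hne
  obtain ⟨U, U', hU, hU', huU, hfU', hd⟩ := SeparatedNhds.of_isCompact_isCompact
    (isCompact_singleton (x := u)) ((hfib (f u)).subset (sdiff_subset (t := {u}))).isCompact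
    (disjoint_singleton_left.2 fun h => h.2 rfl)
  have hu'U : u' ∈ U' := hfU' ⟨⟨hcl hu', huu.symm⟩, fun h => hne h.symm⟩
  obtain ⟨ε, hε, hball⟩ : ∃ ε > 0, ∀ w ∈ G, |f w - f u| < ε → w ∈ U ∪ U' := by
    have h1 : IsClosed (G.domRestrict f '' (Subtype.val ⁻¹' (U ∪ U')ᶜ)) :=
      hprop.isClosedMap _ ((hU.union hU').isClosed_compl.preimage continuous_subtype_val)
    have h2 : f u ∉ G.domRestrict f '' (Subtype.val ⁻¹' (U ∪ U')ᶜ) := by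
      rintro ⟨w, hw, hwu⟩
      refine hw ?_
      by_cases h : w.1 = u
      · exact Or.inl (huU h)
      · exact Or.inr (hfU' ⟨⟨w.2, hwu⟩, h⟩)
    obtain ⟨ε, hε, h3⟩ := Metric.mem_nhds_iff.1 (h1.isOpen_compl.mem_nhds h2)
    exact ⟨ε, hε, fun w hw hwu => by_contra fun h => h3 (a := f w) hwu ⟨⟨w, hw⟩, h, rfl⟩⟩
  have hpre : IsPreconnected (s '' (f '' E ∩ Metric.ball (f u) ε)) := by
    refine IsPreconnected.image ?_ s (hs.continuousOn.mono inter_subset_left)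
    rw [Real.ball_eq_Ioo]
    exact (hoc.inter ordConnected_Ioo).isPreconnected
  have hmeet : ∀ w ∈ closure E, f w = f u → ∀ O, IsOpen O → w ∈ O →
      (s '' (f '' E ∩ Metric.ball (f u) ε) ∩ O).Nonempty := fun w hw hwu O hO hwO => by
    obtain ⟨z, ⟨hzO, hz⟩, hzE⟩ := mem_closure_iff.1 hw (O ∩ f ⁻¹' Metric.ball (f u) ε)
      (hO.inter (Metric.isOpen_ball.preimage hf))
      ⟨hwO, by rw [mem_preimage, hwu]; exact Metric.mem_ball_self hε⟩
    exact ⟨z, ⟨f z, ⟨⟨z, hzE, rfl⟩, hz⟩, hsE z hzE⟩, hzO⟩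
  obtain ⟨z, -, hz, hz'⟩ := hpre U U' hU hU' (by
      rintro _ ⟨x, ⟨hx, hxb⟩, rfl⟩
      exact hball _ (hEG (hs.mapsTo hx)) (by rw [hs.apply x hx]; exact hxb))
    (hmeet u hu rfl U hU (huU rfl)) (hmeet u' hu' huu.symm U' hU' hu'U)
  exact hd.le_bot ⟨hz, hz'⟩

theorem isClosedEmbedding_closure_connectedComponentIn (hf : Continuous f) (hG : IsClosed G)
    (hprop : IsProperMap (G.domRestrict f)) (hfib : ∀ c, (G ∩ f ⁻¹' {c}).Finite)
    (hY : HasLocalSections f (G \ V)) {v : Q} (hv : v ∈ G \ V) :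
    IsClosedEmbedding ((closure (connectedComponentIn (G \ V) v)).domRestrict f) := by
  have hEG : connectedComponentIn (G \ V) v ⊆ G := (connectedComponentIn_subset _ _).trans sdiff_subset
  have hcl := closure_minimal hEG hG
  refine .of_continuous_injective_isClosedMap (hf.comp continuous_subtype_val)
    (injOn_iff_injective.1 (injOn_closure_connectedComponentIn hf hG hprop hfib hY hv)) ?_
  have h1 : IsClosedEmbedding (inclusion hcl) :=
    (isClosed_closure.preimage continuous_subtype_val : IsClosed (Subtype.val ⁻¹' _ : Set G)) |>
    fun h => ⟨IsEmbedding.inclusion hcl, by rwa [range_inclusion]⟩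
  exact hprop.isClosedMap.comp h1.isClosedMap

/-- A closed set with finite fibres, which is locally a section away from a finite set `V` of
vertices, is a transversal graph. -/
theorem isTransversalGraph_of_hasLocalSections (hf : Continuous f) (hG : IsClosed G)
    (hprop : IsProperMap (G.domRestrict f)) (hfib : ∀ c, (G ∩ f ⁻¹' {c}).Finite)
    (hV : V.Finite) (hVG : V ⊆ G) (hY : HasLocalSections f (G \ V)) :
    IsTransversalGraph f G V {E | ∃ v ∈ G \ V, E = connectedComponentIn (G \ V) v} := by
  have hEG : ∀ v, connectedComponentIn (G \ V) v ⊆ G := fun v =>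
    (connectedComponentIn_subset _ _).trans sdiff_subset
  have hemb : ∀ {v}, v ∈ G \ V → _ := fun {v} hv =>
    isClosedEmbedding_closure_connectedComponentIn hf hG hprop hfib hY hv
  have hends : ∀ v, closure (connectedComponentIn (G \ V) v) \ connectedComponentIn (G \ V) v ⊆ V :=
    fun v w hw => by
      by_contra hwV
      exact hw.2 (closure_connectedComponentIn_inter_subset hY v
        ⟨hw.1, closure_minimal (hEG v) hG hw.1, hwV⟩)
  have hdiff : ∀ {v}, v ∈ G \ V → f '' (closure (connectedComponentIn (G \ V) v) \
      connectedComponentIn (G \ V) v) =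
      closure (f '' connectedComponentIn (G \ V) v) \ f '' connectedComponentIn (G \ V) v := by
    intro v hv
    rw [InjOn.image_sdiff_subset (injOn_closure_connectedComponentIn hf hG hprop hfib hY hv)
      subset_closure]
    congr 1
    refine Subset.antisymm (image_closure_subset_closure_image hf) ?_
    refine closure_minimal (image_mono subset_closure) ?_
    have := (hemb hv).isClosed_range
    rwa [range_domRestrict] at this
  refine ⟨hG, hV, ?_, ?_, ?_, ?_, ?_, ?_, ?_, ?_, ?_, hprop⟩
  -- The interval under an open edge has its end points in the finite set `f '' V`, so it meets a
  -- fixed finite set `T`. Each edge thus passes through one of the finitely many points of `G` over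
  -- `T`.
  · obtain ⟨T, hT, hTJ⟩ := exists_finite_inter_nonempty (hV.image f)
    refine ((hT.biUnion fun t _ => hfib t).image
      fun v => connectedComponentIn (G \ V) v).subset ?_
    rintro _ ⟨v, hv, rfl⟩
    obtain ⟨ho, hoc, -⟩ := exists_section_connectedComponentIn hf hY hv
    obtain ⟨_, ⟨w, hw, rfl⟩, ht⟩ := hTJ _ ho hoc ⟨f v, v, mem_connectedComponentIn hv, rfl⟩ (by
      rw [← hdiff hv]
      exact image_mono (hends v))
    exact ⟨w, mem_biUnion ht ⟨hEG v hw, rfl⟩, (connectedComponentIn_eq hw).symm⟩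
  · ext w
    constructor
    · rintro (hw | ⟨_, ⟨v, hv, rfl⟩, hw⟩)
      · exact hVG hw
      · exact hEG v hw
    · intro hw
      by_cases hwV : w ∈ V
      · exact Or.inl hwV
      · exact Or.inr ⟨_, ⟨w, ⟨hw, hwV⟩, rfl⟩, mem_connectedComponentIn ⟨hw, hwV⟩⟩
  · rintro _ ⟨v, hv, rfl⟩ _ ⟨w, hw, rfl⟩ hne
    refine Set.disjoint_left.2 fun z hz hz' => hne ?_
    exact (connectedComponentIn_eq hz).trans (connectedComponentIn_eq hz').symm
  · rintro _ ⟨v, hv, rfl⟩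
    exact Set.disjoint_left.2 fun z hz hzV => (connectedComponentIn_subset _ _ hz).2 hzV
  · rintro _ ⟨v, hv, rfl⟩
    obtain ⟨ho, hoc, -⟩ := exists_section_connectedComponentIn hf hY hv
    refine ⟨_, ho, hoc, ⟨f v, v, mem_connectedComponentIn hv, rfl⟩, ?_⟩
    have h1 : IsEmbedding ((connectedComponentIn (G \ V) v).domRestrict f) :=
      (hemb hv).isEmbedding.comp (IsEmbedding.inclusion subset_closure)
    exact ⟨h1.toHomeomorph.trans (Homeomorph.setCongr (range_domRestrict _ _))⟩
  · rintro _ ⟨v, hv, rfl⟩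
    obtain ⟨ho, -⟩ := exists_section_connectedComponentIn hf hY hv
    refine ⟨f '' closure (connectedComponentIn (G \ V) v), ?_,
      (isPreconnected_connectedComponentIn.closure.image f hf.continuousOn).ordConnected, ?_,
      ⟨(hemb hv).isEmbedding.toHomeomorph.trans (Homeomorph.setCongr (range_domRestrict _ _))⟩⟩
    · have := (hemb hv).isClosed_range
      rwa [range_domRestrict] at this
    · have h1 := ho.mem_nhds ⟨v, mem_connectedComponentIn hv, rfl⟩
      exact (infinite_of_mem_nhds (f v) h1).nontrivial.mono (image_mono subset_closure)
  · rintro _ ⟨v, hv, rfl⟩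
    exact hends v
  · rintro _ ⟨v, hv, rfl⟩
    obtain ⟨-, hoc, -⟩ := exists_section_connectedComponentIn hf hY hv
    have hi := (injOn_closure_connectedComponentIn hf hG hprop hfib hY hv).mono
      (sdiff_subset (t := connectedComponentIn (G \ V) v))
    rw [← hi.encard_image, hdiff hv]
    exact encard_closure_diff_le_two hoc
  · rintro _ ⟨v, hv, rfl⟩
    exact (hemb hv).isEmbedding

end Graph

/-! ### Transport along homeomorphisms -/

section Transport

variable {P Q : Type*} [TopologicalSpace P] [TopologicalSpace Q]

theorem IsSurface.of_homeomorph (h : P ≃ₜ Q) (hP : IsSurface P) : IsSurface Q where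
  t2 := haveI := hP.t2; h.t2Space
  secondCountable := haveI := hP.secondCountable; h.symm.secondCountableTopology
  exists_chart x := by
    obtain ⟨φ, hφ⟩ := hP.exists_chart (h.symm x)
    exact ⟨h.symm.toOpenPartialHomeomorph.trans φ, by simpa using hφ⟩

theorem subset_preimage_topCriticalSet (e : P ≃ₜ Q) {f : P → ℝ} {g : Q → ℝ} (h : ∀ p, g (e p) = f p)
    (C : Set Q) : topCriticalSet f (e ⁻¹' C) ⊆ e ⁻¹' topCriticalSet g C := by
  rintro p ⟨hp, hp'⟩
  refine ⟨hp, fun ⟨U, hU, hUe⟩ => hp' ⟨e ⁻¹' U, e.continuous.continuousAt hU, ?_⟩⟩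
  have hm : MapsTo e (e ⁻¹' C ∩ e ⁻¹' U) (C ∩ U) := fun x hx => hx
  have := hUe.comp (e.isEmbedding.restrict hm)
  convert this using 1
  funext x
  exact (h x).symm

theorem preimage_topCriticalSet (e : P ≃ₜ Q) {f : P → ℝ} {g : Q → ℝ} (h : ∀ p, g (e p) = f p)
    (C : Set Q) : e ⁻¹' topCriticalSet g C = topCriticalSet f (e ⁻¹' C) := by
  refine Subset.antisymm (fun p hp => ?_) (subset_preimage_topCriticalSet e h C)
  have := subset_preimage_topCriticalSet e.symm (f := g) (g := f)
    (fun q => by rw [← h, e.apply_symm_apply]) (e ⁻¹' C)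
  rw [← preimage_comp] at this
  simp only [e.self_comp_symm, preimage_id_eq, id] at this
  simpa using this hp

end Transport

/-! ### Collapsing vertical segments by measuring length outside the surface -/

section Planar

variable {A : Set (ℝ × ℝ)}

/-- On a vertical line the noncritical frontier points are isolated from one another by local
injectivity, and a discrete subset of the line is countable. Countability makes the frontier null on
every vertical line, as the continuity of `outerHeight` requires. -/
theorem countable_frontier_fibre (hfin : (topCriticalSet Prod.fst (frontier A)).Finite) (x : ℝ) :
    {y | (x, y) ∈ frontier A}.Countable := by
  set T : Set ℝ := {y | (x, y) ∈ frontier A ∧ (x, y) ∉ topCriticalSet Prod.fst (frontier A)}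
  have hT : T.Countable := by
    have : DiscreteTopology T := by
      rw [discreteTopology_subtype_iff]
      intro y hy
      obtain ⟨U, hU, hi⟩ := exists_injOn_of_notMem_topCriticalSet hy.1 hy.2
      have h1 : ∀ᶠ z in 𝓝 y, (x, z) ∈ U :=
        (by fun_prop : Continuous fun z : ℝ => (x, z)).continuousAt hU
      have h2 : ∀ᶠ z in 𝓝[≠] y ⊓ Filter.principal T, False := by
        rw [Filter.eventually_inf_principal]
        filter_upwards [mem_nhdsWithin_of_mem_nhds h1, self_mem_nhdsWithin] with z hz hne hzT
        exact hne (congrArg Prod.snd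
          (hi ⟨hzT.1, hz⟩ ⟨hy.1, mem_of_mem_nhds hU⟩ rfl : (x, z) = (x, y)))
      exact Filter.eventually_false_iff_eq_bot.1 h2
    exact countable_coe_iff.1 (TopologicalSpace.separableSpace_iff_countable.1 inferInstance)
  have hF : {y | (x, y) ∈ topCriticalSet Prod.fst (frontier A)}.Finite :=
    hfin.preimage (f := fun y => (x, y)) fun a _ b _ h => congrArg Prod.snd h
  refine (hT.union hF.countable).mono fun y hy => ?_
  by_cases h : (x, y) ∈ topCriticalSet Prod.fst (frontier A)
  · exact Or.inr h
  · exact Or.inl ⟨hy, h⟩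

end Planar

section Height

variable {A : Set (ℝ × ℝ)} {x y y' : ℝ}

/-- The signed length of the part of the vertical segment from `(x, 0)` to `(x, y)` that lies
outside `A`. -/
noncomputable def outerHeight (A : Set (ℝ × ℝ)) (x y : ℝ) : ℝ :=
  ∫ t in (0 : ℝ)..y, Aᶜ.indicator (fun _ => (1 : ℝ)) (x, t)

theorem intervalIntegrable_indicator_compl (hA : IsClosed A) (x a b : ℝ) :
    IntervalIntegrable (fun t => Aᶜ.indicator (fun _ => (1 : ℝ)) (x, t)) MeasureTheory.volume a b := by
  refine (intervalIntegrable_const (c := (1 : ℝ))).mono_fun ?_ ?_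
  · exact ((measurable_const.indicator hA.isOpen_compl.measurableSet).comp
      measurable_prodMk_left).aestronglyMeasurable
  · exact Filter.Eventually.of_forall fun t => by
      by_cases h : (x, t) ∈ Aᶜ <;> simp [h]

theorem outerHeight_sub (hA : IsClosed A) (x y y' : ℝ) :
    outerHeight A x y' - outerHeight A x y =
      ∫ t in y..y', Aᶜ.indicator (fun _ => (1 : ℝ)) (x, t) :=
  intervalIntegral.integral_interval_sub_left (intervalIntegrable_indicator_compl hA x 0 y')
    (intervalIntegrable_indicator_compl hA x 0 y)

theorem outerHeight_zero (x : ℝ) : outerHeight A x 0 = 0 := intervalIntegral.integral_same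

theorem monotone_outerHeight (hA : IsClosed A) (x : ℝ) : Monotone (outerHeight A x) := by
  intro y y' h
  rw [← sub_nonneg, outerHeight_sub hA]
  exact intervalIntegral.integral_nonneg h fun t _ => indicator_nonneg (fun _ _ => zero_le_one) _

theorem lipschitzWith_outerHeight (hA : IsClosed A) (x : ℝ) : LipschitzWith 1 (outerHeight A x) := by
  refine LipschitzWith.of_dist_le_mul fun y y' => ?_
  rw [dist_comm, dist_comm y, Real.dist_eq, Real.dist_eq, outerHeight_sub hA, NNReal.coe_one,
    ← Real.norm_eq_abs]
  refine intervalIntegral.norm_integral_le_of_norm_le_const fun t _ => ?_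
  by_cases h : (x, t) ∈ Aᶜ <;> simp [h]

/-- The Lipschitz bound in the height reduces the claim to continuity in `x`, which is dominated
convergence: at a non-frontier point the indicator is locally constant. -/
theorem continuous_outerHeight (hA : IsClosed A)
    (hf : ∀ x, {y | (x, y) ∈ frontier A}.Countable) :
    Continuous fun p : ℝ × ℝ => outerHeight A p.1 p.2 := by
  refine continuous_prod_of_continuous_lipschitzWith' (fun p : ℝ × ℝ => outerHeight A p.1 p.2) 1
    (fun x => lipschitzWith_outerHeight hA x) (fun y => ?_)
  refine continuous_iff_continuousAt.2 fun x => ?_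
  refine intervalIntegral.continuousAt_of_dominated_interval (bound := fun _ => 1)
    (Filter.Eventually.of_forall fun x => ?_) (Filter.Eventually.of_forall fun x => ?_)
    intervalIntegrable_const ?_
  · exact ((measurable_const.indicator hA.isOpen_compl.measurableSet).comp
      measurable_prodMk_left).aestronglyMeasurable
  · exact Filter.Eventually.of_forall fun t _ => by
      by_cases h : (x, t) ∈ Aᶜ <;> simp [h]
  · have h0 := (hf x).ae_notMem MeasureTheory.volume
    filter_upwards [h0] with t ht _
    have hc : ContinuousAt (fun x => (x, t)) x := by fun_prop
    have hcases : (x, t) ∈ interior A ∨ (x, t) ∈ Aᶜ := by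
      by_contra! h
      exact ht ⟨subset_closure (not_notMem.1 h.2), h.1⟩
    rcases hcases with h | h
    · refine (continuousAt_const (y := (0 : ℝ))).congr ?_
      filter_upwards [hc (isOpen_interior.mem_nhds h)] with z hz
      exact (indicator_of_notMem (not_not.2 (interior_subset hz)) _).symm
    · refine (continuousAt_const (y := (1 : ℝ))).congr ?_
      filter_upwards [hc (hA.isOpen_compl.mem_nhds h)] with z hz
      exact (indicator_of_mem (s := Aᶜ) hz (fun _ => (1 : ℝ))).symm

theorem outerHeight_sub_of_disjoint (hA : IsClosed A) (h : ∀ z ∈ Ioo y y', (x, z) ∉ A) (hy : y ≤ y') :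
    outerHeight A x y' - outerHeight A x y = y' - y := by
  rw [outerHeight_sub hA]
  have : ∫ t in y..y', Aᶜ.indicator (fun _ => (1 : ℝ)) (x, t) = ∫ t in y..y', (1 : ℝ) := by
    rw [intervalIntegral.integral_of_le hy, intervalIntegral.integral_of_le hy,
      MeasureTheory.integral_Ioc_eq_integral_Ioo, MeasureTheory.integral_Ioc_eq_integral_Ioo]
    exact MeasureTheory.setIntegral_congr_fun measurableSet_Ioo fun t ht =>
      indicator_of_mem (s := Aᶜ) (h t ht) (fun _ => (1 : ℝ))
  rw [this]
  simp

/-- A point outside `A` between the two heights brings a whole interval outside `A`, which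
contributes positive length. The alternative `y = y'` is there for points that are not in `A`. -/
theorem outerHeight_eq_iff (hA : IsClosed A) :
    outerHeight A x y = outerHeight A x y' ↔ y = y' ∨ Joined A x y y' := by
  constructor
  · intro h
    by_contra! hne
    wlog hlt : y < y' generalizing y y'
    · exact this h.symm ⟨hne.1.symm, fun h => hne.2 h.symm⟩
        (lt_of_le_of_ne (not_lt.1 hlt) hne.1.symm)
    obtain ⟨z, hz, hzA⟩ : ∃ z ∈ uIcc y y', (x, z) ∉ A := by
      by_contra! h'
      exact hne.2 h'
    -- The point found may be an end point; it is moved into the open interval, using that the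
    -- complement of `A` is open.
    rw [uIcc_of_le hlt.le, ← closure_Ioo hlt.ne] at hz
    have hop : IsOpen {t | (x, t) ∉ A} :=
      hA.isOpen_compl.preimage (by fun_prop : Continuous fun t : ℝ => (x, t))
    obtain ⟨w, hwA, hw⟩ := mem_closure_iff.1 hz _ hop hzA
    obtain ⟨a, b, hab, hsub⟩ := mem_nhds_iff_exists_Ioo_subset.1
      ((hop.inter isOpen_Ioo).mem_nhds ⟨hwA, hw⟩)
    have hab' : a < b := hab.1.trans hab.2
    have hcl : Icc a b ⊆ Icc y y' := by
      rw [← closure_Ioo hab'.ne, ← closure_Ioo hlt.ne]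
      exact closure_mono fun t ht => (hsub ht).2
    have h1 := outerHeight_sub_of_disjoint (x := x) hA (fun t ht => (hsub ht).1) hab'.le
    have h2 := monotone_outerHeight hA x (hcl (left_mem_Icc.2 hab'.le)).1
    have h3 := monotone_outerHeight hA x (hcl (right_mem_Icc.2 hab'.le)).2
    linarith
  · rintro (rfl | h)
    · rfl
    · rw [eq_comm, ← sub_eq_zero, outerHeight_sub hA]
      rw [intervalIntegral.integral_congr (g := fun _ => (0 : ℝ))
        fun t ht => indicator_of_notMem (not_not.2 (h t ht)) _]
      simp

/-- Beyond a bound for the fibre of `A` the outer height grows with slope one. With the symmetric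
estimate below, this makes the collapse surjective and proper. -/
theorem le_outerHeight (hA : IsClosed A) {M : ℝ} (hM : 0 ≤ M) (h : ∀ z, (x, z) ∈ A → |z| ≤ M)
    (hy : M ≤ y) : y - M ≤ outerHeight A x y := by
  have h1 := outerHeight_sub_of_disjoint (x := x) hA
    (fun z hz hzA => absurd (h z hzA) (not_le.2 (hz.1.trans_le (le_abs_self z)))) hy
  have h2 := monotone_outerHeight hA x hM
  rw [outerHeight_zero] at h2
  linarith

theorem outerHeight_le (hA : IsClosed A) {M : ℝ} (hM : 0 ≤ M) (h : ∀ z, (x, z) ∈ A → |z| ≤ M)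
    (hy : y ≤ -M) : outerHeight A x y ≤ y + M := by
  have h1 := outerHeight_sub_of_disjoint (x := x) hA
    (fun z hz hzA => absurd (h z hzA) (not_le.2 ((lt_neg_of_lt_neg hz.2).trans_le (neg_le_abs z)))) hy
  have h2 := monotone_outerHeight hA x (neg_nonpos.2 hM)
  rw [outerHeight_zero] at h2
  linarith

/-- The map that collapses the vertical segments contained in `A`. -/
noncomputable def verticalCollapse (A : Set (ℝ × ℝ)) (p : ℝ × ℝ) : ℝ × ℝ :=
  (p.1, outerHeight A p.1 p.2)

theorem verticalCollapse_surjective (hA : IsClosed A)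
    (hb : ∀ a b, ∃ M, 0 ≤ M ∧ ∀ x ∈ Icc a b, ∀ y, (x, y) ∈ A → |y| ≤ M) :
    Function.Surjective (verticalCollapse A) := by
  rintro ⟨x, c⟩
  obtain ⟨M, hM, h⟩ := hb x x
  replace h := h x ⟨le_rfl, le_rfl⟩
  have h1 := le_outerHeight hA hM h (y := M + |c|) (by linarith [abs_nonneg c])
  have h2 := outerHeight_le hA hM h (y := -(M + |c|)) (by linarith [abs_nonneg c])
  obtain ⟨y, -, hy⟩ := intermediate_value_Icc (by linarith [abs_nonneg c])
    ((lipschitzWith_outerHeight hA x).continuous.continuousOn (s := Icc (-(M + |c|)) (M + |c|)))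
    (show c ∈ Icc _ _ from ⟨by linarith [neg_abs_le c], by linarith [le_abs_self c]⟩)
  exact ⟨(x, y), Prod.ext rfl hy⟩

theorem isProperMap_verticalCollapse (hA : IsClosed A)
    (hf : ∀ x, {y | (x, y) ∈ frontier A}.Countable)
    (hb : ∀ a b, ∃ M, 0 ≤ M ∧ ∀ x ∈ Icc a b, ∀ y, (x, y) ∈ A → |y| ≤ M) :
    IsProperMap (verticalCollapse A) := by
  have hcont : Continuous (verticalCollapse A) := continuous_fst.prodMk (continuous_outerHeight hA hf)
  refine isProperMap_iff_isCompact_preimage.2 ⟨hcont, fun K hK => ?_⟩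
  obtain ⟨R, hR⟩ := hK.isBounded.subset_closedBall 0
  obtain ⟨M, hM, h⟩ := hb (-R) R
  refine (isCompact_Icc (a := ((-R, -(M + R)) : ℝ × ℝ)) (b := (R, M + R))).of_isClosed_subset
    (hK.isClosed.preimage hcont) ?_
  rintro ⟨x, y⟩ hp
  have hn := hR hp
  rw [mem_closedBall_zero_iff, Prod.norm_def, max_le_iff, Real.norm_eq_abs, Real.norm_eq_abs] at hn
  obtain ⟨hx, hψ⟩ := hn
  rw [abs_le] at hx hψ
  simp only [verticalCollapse] at hx hψ
  have hR0 : 0 ≤ R := by linarith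
  refine ⟨⟨hx.1, ?_⟩, ⟨hx.2, ?_⟩⟩
  · rcases le_total y (-M) with h' | h'
    · have := outerHeight_le hA hM (h x hx) h'
      simp only
      linarith
    · simp only
      linarith
  · rcases le_total M y with h' | h'
    · have := le_outerHeight hA hM (h x hx) h'
      simp only
      linarith
    · simp only
      linarith

theorem verticalCollapse_eq_iff (hA : IsClosed A) {p q : ℝ × ℝ} :
    verticalCollapse A p = verticalCollapse A q ↔
      p.1 = q.1 ∧ (p.2 = q.2 ∨ Joined A p.1 p.2 q.2) := by
  obtain ⟨x, y⟩ := p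
  obtain ⟨x', y'⟩ := q
  simp only [verticalCollapse, Prod.mk.injEq]
  constructor
  · rintro ⟨rfl, h⟩
    exact ⟨rfl, (outerHeight_eq_iff hA).1 h⟩
  · rintro ⟨rfl, h⟩
    exact ⟨rfl, (outerHeight_eq_iff hA).2 h⟩

end Height

/-! ### The collapse in coordinates -/

section Chart

variable {P : Type*} [TopologicalSpace P] {π : P → ℝ} {D : Set P} {Φ : P ≃ₜ ℝ × ℝ}

theorem IsDomainOfFiniteType.boundaryCurve_eq (hD : IsDomainOfFiniteType π D) (Φ : P ≃ₜ ℝ × ℝ) :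
    boundaryCurve D = frontier D :=
  boundaryCurve_eq_frontier (Φ.trans Complex.equivRealProdCLM.toHomeomorph.symm) hD.isClosed
    hD.isSurface

theorem IsDomainOfFiniteType.isSurface_preimage (hD : IsDomainOfFiniteType π D) (Φ : P ≃ₜ ℝ × ℝ) :
    IsSurface (Φ.symm ⁻¹' D) :=
  hD.isSurface.of_homeomorph (Φ.sets (by ext; simp))

theorem IsDomainOfFiniteType.preimage_topCriticalSet (hD : IsDomainOfFiniteType π D)
    (hΦ : ∀ p, (Φ p).1 = π p) :
    topCriticalSet Prod.fst (frontier (Φ.symm ⁻¹' D)) =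
      Φ.symm ⁻¹' topCriticalSet π (boundaryCurve D) := by
  rw [hD.boundaryCurve_eq Φ, ← Φ.symm.preimage_frontier]
  refine (PoincareReeb.preimage_topCriticalSet Φ.symm (fun z => ?_) _).symm
  rw [← hΦ, Φ.apply_symm_apply]

theorem IsDomainOfFiniteType.finite_topCriticalSet_preimage (hD : IsDomainOfFiniteType π D)
    (hΦ : ∀ p, (Φ p).1 = π p) :
    (topCriticalSet Prod.fst (frontier (Φ.symm ⁻¹' D))).Finite := by
  rw [hD.preimage_topCriticalSet hΦ]
  exact hD.finite_topCriticalSet.preimage Φ.symm.injective.injOn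

theorem IsDomainOfFiniteType.isCompact_inter (hD : IsDomainOfFiniteType π D) {K : Set ℝ}
    (hK : IsCompact K) : IsCompact (D ∩ π ⁻¹' K) := by
  have := (hD.proper.isCompact_preimage hK).image continuous_subtype_val
  convert this using 1
  ext p
  simp [and_comm]

theorem IsDomainOfFiniteType.isCompact_preimage_inter (hD : IsDomainOfFiniteType π D)
    (hΦ : ∀ p, (Φ p).1 = π p) {K : Set ℝ} (hK : IsCompact K) :
    IsCompact (Φ.symm ⁻¹' D ∩ Prod.fst ⁻¹' K) := by
  have := (hD.isCompact_inter hK).image Φ.continuous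
  convert this using 1
  ext z
  rw [Φ.image_eq_preimage_symm]
  simp [← hΦ]

theorem IsDomainOfFiniteType.exists_bound (hD : IsDomainOfFiniteType π D)
    (hΦ : ∀ p, (Φ p).1 = π p) (a b : ℝ) :
    ∃ M, 0 ≤ M ∧ ∀ x ∈ Icc a b, ∀ y, (x, y) ∈ Φ.symm ⁻¹' D → |y| ≤ M := by
  obtain ⟨R, hR⟩ :=
    (hD.isCompact_preimage_inter hΦ (isCompact_Icc (a := a) (b := b))).isBounded.subset_closedBall 0
  refine ⟨|R|, abs_nonneg _, fun x hx y hy => ?_⟩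
  have := mem_closedBall_zero_iff.1 (hR ⟨hy, hx⟩)
  rw [Prod.norm_def, max_le_iff] at this
  exact this.2.trans (le_abs_self R)

/-- In the coordinates `Φ` a fibre is a line, where connected sets are the convex ones. -/
theorem mem_fiberComponent_iff (hΦ : ∀ p, (Φ p).1 = π p) {p q : P} (hp : p ∈ D) :
    q ∈ fiberComponent π D p ↔
      π p = π q ∧ Joined (Φ.symm ⁻¹' D) (π p) (Φ p).2 (Φ q).2 := by
  have key : ∀ w, Φ.symm (π w, (Φ w).2) = w := fun w => by
    rw [← hΦ]
    exact Φ.symm_apply_apply w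
  have hpF : p ∈ π ⁻¹' {π p} ∩ D := ⟨rfl, hp⟩
  constructor
  · intro hq
    have hsub := connectedComponentIn_subset (π ⁻¹' {π p} ∩ D) p
    refine ⟨(hsub hq).1.symm, fun z hz => ?_⟩
    have hpre : IsPreconnected ((fun w => (Φ w).2) '' fiberComponent π D p) :=
      isPreconnected_connectedComponentIn.image _ (by fun_prop : Continuous _).continuousOn
    obtain ⟨w, hw, rfl⟩ := hpre.ordConnected.uIcc_subset
      (mem_image_of_mem _ (mem_connectedComponentIn hpF)) (mem_image_of_mem _ hq) hz
    rw [mem_preimage, show π p = π w from (hsub hw).1.symm]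
    simpa only [key] using (hsub hw).2
  · rintro ⟨hpq, hj⟩
    have hpre : IsPreconnected ((fun z => Φ.symm (π p, z)) '' uIcc (Φ p).2 (Φ q).2) :=
      isPreconnected_uIcc.image _ (by fun_prop : Continuous _).continuousOn
    refine hpre.subset_connectedComponentIn ⟨_, left_mem_uIcc, key p⟩ ?_ ⟨_, right_mem_uIcc, ?_⟩
    · rintro _ ⟨z, hz, rfl⟩
      refine ⟨?_, hj z hz⟩
      change π (Φ.symm (π p, z)) = π p
      rw [← hΦ (Φ.symm _), Φ.apply_symm_apply]
    · rw [hpq]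
      exact key q

theorem vertEquiv_iff (hΦ : ∀ p, (Φ p).1 = π p) {p q : P} :
    VertEquiv π D p q ↔ π p = π q ∧ ((Φ p).2 = (Φ q).2 ∨
      Joined (Φ.symm ⁻¹' D) (π p) (Φ p).2 (Φ q).2) := by
  refine and_congr_right fun h => ?_
  have hinj : (Φ p).2 = (Φ q).2 ↔ p = q := by
    refine ⟨fun h' => Φ.injective (Prod.ext ?_ h'), fun h' => h' ▸ rfl⟩
    rw [hΦ, hΦ, h]
  by_cases hp : p ∈ D
  · rw [mem_fiberComponent_iff hΦ hp, hinj]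
    have hpA : (π p, (Φ p).2) ∈ Φ.symm ⁻¹' D := by
      rw [← hΦ]
      simpa using hp
    constructor
    · rintro (h' | h')
      · exact Or.inr h'.2
      · exact absurd hp h'.2
    · rintro (rfl | h')
      · exact Or.inl ⟨rfl, Joined.refl hpA⟩
      · exact Or.inl ⟨h, h'⟩
  · have h1 : ¬Joined (Φ.symm ⁻¹' D) (π p) (Φ p).2 (Φ q).2 := fun hj => by
      have := hj.left
      rw [← hΦ] at this
      exact hp (by simpa using this)
    have h2 : q ∉ fiberComponent π D p := fun hq =>
      hp (connectedComponentIn_nonempty_iff.1 ⟨q, hq⟩).2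
    simp [h1, h2, hinj, hp]

/-- `verticalCollapse` identifies exactly the vertically equivalent points, so it induces a
continuous bijection from the quotient. Properness makes this bijection closed, hence a
homeomorphism. -/
theorem IsDomainOfFiniteType.exists_collapse_homeomorph (hD : IsDomainOfFiniteType π D)
    (hΦ : ∀ p, (Φ p).1 = π p) : ∃ h : Collapse π D ≃ₜ ℝ × ℝ,
      ∀ p, h (collapseMap π D p) = verticalCollapse (Φ.symm ⁻¹' D) (Φ p) := by
  set A := Φ.symm ⁻¹' D
  have hA : IsClosed A := hD.isClosed.preimage Φ.symm.continuous
  have hb := hD.exists_bound hΦ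
  have hprop := isProperMap_verticalCollapse hA
    (countable_frontier_fibre (hD.finite_topCriticalSet_preimage hΦ)) hb
  have hiff : ∀ p q, VertEquiv π D p q ↔
      verticalCollapse A (Φ p) = verticalCollapse A (Φ q) := fun p q => by
    rw [verticalCollapse_eq_iff hA, vertEquiv_iff hΦ, hΦ, hΦ]
  let k : Collapse π D → ℝ × ℝ :=
    Quotient.lift (fun p => verticalCollapse A (Φ p)) fun p q h => (hiff p q).1 h
  have hk : Continuous k := (hprop.continuous.comp Φ.continuous).quotient_lift _
  have hm : Continuous (collapseMap π D) := continuous_quotient_mk'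
  have hms : Function.Surjective (collapseMap π D) := Quotient.mk_surjective
  have hcl : IsClosedMap k := by
    intro S hS
    have : k '' S = verticalCollapse A '' (Φ '' (collapseMap π D ⁻¹' S)) := by
      rw [← image_preimage_eq S hms, preimage_image_preimage, image_image, image_image]
      rfl
    rw [this]
    exact hprop.isClosedMap _ (Φ.isClosedMap _ (hS.preimage hm))
  have hbij : Function.Bijective k := by
    refine ⟨fun u v => ?_, fun z => ?_⟩
    · induction u using Quotient.inductionOn with | _ p
      induction v using Quotient.inductionOn with | _ q
      exact fun h => Quotient.sound ((hiff p q).2 h)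
    · obtain ⟨w, rfl⟩ := verticalCollapse_surjective hA hb z
      exact ⟨collapseMap π D (Φ.symm w), by simp [k, collapseMap]⟩
  exact ⟨(isHomeomorph_iff_continuous_isClosedMap_bijective.2 ⟨hk, hcl, hbij⟩).homeomorph k,
    fun p => rfl⟩

end Chart

theorem isVerticalPlane_of_homeomorph {Q : Type*} [TopologicalSpace Q] {f : Q → ℝ}
    (h : Q ≃ₜ ℝ × ℝ) (hf : ∀ q, (h q).1 = f q) : IsVerticalPlane f where
  homeomorphic_plane := ⟨h⟩
  locally_trivial x := by
    have key : ∀ y : ℝ, f (h.symm (x, y)) = x := fun y => by rw [← hf, h.apply_symm_apply]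
    have hfc : Continuous f := by
      have : f = Prod.fst ∘ h := funext fun q => (hf q).symm
      rw [this]
      fun_prop
    let F : (f ⁻¹' {x}) ≃ₜ ℝ :=
      { toFun := fun q => (h q.1).2
        invFun := fun y => ⟨h.symm (x, y), key y⟩
        left_inv := fun q => Subtype.ext <| by
          rw [h.symm_apply_eq]
          exact Prod.ext ((hf q).trans q.2).symm rfl
        right_inv := fun y => by simp
        continuous_toFun := by fun_prop
        continuous_invFun := by fun_prop }
    let H : Q ≃ₜ ℝ × (f ⁻¹' {x}) := h.trans ((Homeomorph.refl ℝ).prodCongr F.symm)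
    refine ⟨{ H.toOpenPartialHomeomorph with
      baseSet := univ
      open_baseSet := isOpen_univ
      source_eq := rfl
      target_eq := by simp
      proj_toFun := fun q _ => hf q }, mem_univ x⟩

/-! ### The collapsed surface as a transversal graph -/

/-- `r` is a continuous closed map on the plane that collapses the components of the fibres of the
first projection on `A`, and `f` is induced by the first projection. -/
structure IsVerticalQuotient {Q : Type*} [TopologicalSpace Q] (A : Set (ℝ × ℝ)) (r : ℝ × ℝ → Q)
    (f : Q → ℝ) : Prop where
  continuous : Continuous r
  isClosedMap : IsClosedMap r
  proj : ∀ z, f (r z) = z.1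
  eq_iff : ∀ z w, r z = r w ↔ z.1 = w.1 ∧ (z.2 = w.2 ∨ Joined A z.1 z.2 w.2)

/-- A closed planar surface, proper over the first coordinate, with finitely many topological
critical points. -/
structure IsPlanarDomain (A : Set (ℝ × ℝ)) : Prop where
  isClosed : IsClosed A
  isSurface : IsSurface A
  finite_topCriticalSet : (topCriticalSet Prod.fst (frontier A)).Finite
  isCompact_inter : ∀ K : Set ℝ, IsCompact K → IsCompact (A ∩ Prod.fst ⁻¹' K)

namespace IsVerticalQuotient

variable {Q : Type*} [TopologicalSpace Q] {A : Set (ℝ × ℝ)} {r : ℝ × ℝ → Q} {f : Q → ℝ}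

theorem mk_eq (hr : IsVerticalQuotient A r f) {x y y' : ℝ} (h : Joined A x y y') :
    r (x, y) = r (x, y') := (hr.eq_iff _ _).2 ⟨rfl, Or.inr h⟩

theorem mem_vertices_iff (hr : IsVerticalQuotient A r f) {S : Set (ℝ × ℝ)} (hS : S ⊆ A) {x y : ℝ} :
    r (x, y) ∈ r '' S ↔ ∃ z, Joined A x y z ∧ (x, z) ∈ S := by
  constructor
  · rintro ⟨⟨x', z⟩, hz, h⟩
    obtain ⟨h1, h2⟩ := (hr.eq_iff _ _).1 h
    obtain rfl : x' = x := h1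
    refine ⟨z, ?_, hz⟩
    rcases h2 with h2 | h2
    · obtain rfl : z = y := h2
      exact Joined.refl (hS hz)
    · exact h2.symm
  · rintro ⟨z, hj, hz⟩
    exact ⟨_, hz, (hr.mk_eq hj).symm⟩

/-- For a closed map, a neighbourhood of a fibre contains the preimage of a neighbourhood of the
point. -/
theorem exists_nhds (hr : IsVerticalQuotient A r f) {W : Set (ℝ × ℝ)} (hW : IsOpen W) {v : Q}
    (hv : ∀ z, r z = v → z ∈ W) : ∃ U ∈ 𝓝 v, ∀ z, r z ∈ U → z ∈ W := by
  refine ⟨(r '' Wᶜ)ᶜ, (hr.isClosedMap _ hW.isClosed_compl).isOpen_compl.mem_nhds ?_, fun z hz => ?_⟩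
  · rintro ⟨z, hz, h⟩
    exact hz (hv z h)
  · by_contra h
    exact hz ⟨z, h, rfl⟩

theorem isProperMap (hr : IsVerticalQuotient A r f) (hf : Continuous f) (hA : IsPlanarDomain A) :
    IsProperMap ((r '' A).domRestrict f) := by
  refine isProperMap_iff_isCompact_preimage.2 ⟨hf.comp continuous_subtype_val, fun K hK => ?_⟩
  rw [Subtype.isCompact_iff]
  convert (hA.isCompact_inter K hK).image hr.continuous using 1
  ext v
  constructor
  · rintro ⟨⟨_, z, hz, rfl⟩, hv, rfl⟩
    exact ⟨z, ⟨hz, by simpa [hr.proj] using hv⟩, rfl⟩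
  · rintro ⟨z, ⟨hz, hzK⟩, rfl⟩
    exact ⟨⟨r z, z, hz, rfl⟩, by simpa [hr.proj] using hzK, rfl⟩

/-- Nearby points of a fibre of `A` are joined, so each has a neighbourhood in the fibre with a
single image. The fibre is compact. -/
theorem finite_fibre (hr : IsVerticalQuotient A r f) (hA : IsPlanarDomain A) (c : ℝ) :
    (r '' A ∩ f ⁻¹' {c}).Finite := by
  have h1 : (r '' (A ∩ Prod.fst ⁻¹' {c})).Finite := by
    refine (hA.isCompact_inter _ isCompact_singleton).induction_on (p := fun t => (r '' t).Finite)
      (by simp) (fun s t hst ht => ht.subset (image_mono hst))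
      (fun s t hs ht => by rw [image_union]; exact hs.union ht) ?_
    rintro ⟨x, d⟩ ⟨hz, hx⟩
    obtain rfl : x = c := hx
    obtain ⟨δ, hδ, h⟩ := exists_joined_of_mem hA.isClosed hA.isSurface hA.finite_topCriticalSet hz
    refine ⟨{z | |z.2 - d| < δ} ∩ (A ∩ Prod.fst ⁻¹' {x}), ?_, ?_⟩
    · refine Filter.inter_mem (mem_nhdsWithin_of_mem_nhds ?_) self_mem_nhdsWithin
      exact (isOpen_lt (by fun_prop : Continuous fun z : ℝ × ℝ => |z.2 - d|)
        continuous_const).mem_nhds (by simpa using hδ)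
    · refine (finite_singleton (r (x, d))).subset ?_
      rintro _ ⟨⟨x', y⟩, ⟨hy, hyA, hx'⟩, rfl⟩
      obtain rfl : x' = x := hx'
      exact (hr.mk_eq (h y hy hyA)).symm
  refine h1.subset ?_
  rintro _ ⟨⟨z, hz, rfl⟩, hc⟩
  exact ⟨z, ⟨hz, by simpa [hr.proj] using hc⟩, rfl⟩

theorem topCriticalSet_subset (hA : IsPlanarDomain A) :
    topCriticalSet Prod.fst (frontier A) ⊆ A :=
  fun _ hz => hA.isClosed.frontier_subset hz.1

/-- The section runs through the band at constant height `m`. Its interval is shortened by `η` so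
that it avoids the vertices. -/
theorem hasLocalSections [T2Space Q] (hr : IsVerticalQuotient A r f) (hA : IsPlanarDomain A) :
    HasLocalSections f (r '' A \ r '' topCriticalSet Prod.fst (frontier A)) := by
  rintro _ ⟨⟨⟨c, d⟩, hz, rfl⟩, hv⟩
  have hcpt : IsCompact {y | (c, y) ∈ A} := by
    convert (hA.isCompact_inter _ (isCompact_singleton (x := c))).image continuous_snd using 1
    ext y
    simp
  obtain ⟨m, ε, hε, W, hW, hcW, hjm, hmA, hWj⟩ := exists_band_of_noncritical hA.isClosed hA.isSurface
    hA.finite_topCriticalSet hcpt hz fun z hj hzS =>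
      hv ((hr.mem_vertices_iff (topCriticalSet_subset hA)).2 ⟨z, hj, hzS⟩)
  have hrc : Continuous fun x => r (x, m) := hr.continuous.comp (by fun_prop)
  have hcm : r (c, m) = r (c, d) := hr.mk_eq hjm.symm
  have hev : ∀ᶠ x in 𝓝 c, r (x, m) ∉ r '' topCriticalSet Prod.fst (frontier A) :=
    hrc.continuousAt ((hA.finite_topCriticalSet.image r).isClosed.isOpen_compl.mem_nhds
      (by rwa [hcm]))
  obtain ⟨η, hη, hηV⟩ := Metric.eventually_nhds_iff.1 hev
  have hpos : 0 < min ε η := lt_min hε hη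
  have hIoo : ∀ {x}, x ∈ Ioo (c - min ε η) (c + min ε η) → |x - c| < ε ∧ |x - c| < η := by
    intro x hx
    rw [← lt_min_iff, abs_lt]
    exact ⟨by linarith [hx.1], by linarith [hx.2]⟩
  refine ⟨min ε η, hpos, fun x => r (x, m), ?_, ?_, ?_⟩
  · rw [hr.proj]
    exact ⟨hrc.continuousOn, fun x hx => ⟨⟨_, hmA x (hIoo hx).1, rfl⟩, hηV (hIoo hx).2⟩,
      fun x _ => hr.proj _⟩
  · rw [hr.proj]
    exact hcm
  · rw [hr.proj]
    obtain ⟨U, hU, hUW⟩ := hr.exists_nhds (v := r (c, d))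
      (hW.inter (isOpen_Ioo.preimage continuous_fst :
        IsOpen (Prod.fst ⁻¹' Ioo (c - min ε η) (c + min ε η)))) fun ⟨x, y⟩ h => by
        obtain ⟨h1, h2⟩ := (hr.eq_iff _ _).1 h
        obtain rfl : x = c := h1
        refine ⟨hcW y ?_, by simpa using hpos⟩
        rcases h2 with h2 | h2
        · obtain rfl : y = d := h2
          exact Joined.refl hz
        · exact h2.symm
    refine ⟨U, hU, ?_⟩
    rintro _ ⟨⟨⟨⟨x, y⟩, hxA, rfl⟩, -⟩, hxU⟩
    obtain ⟨h1, h2⟩ := hUW _ hxU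
    rw [hr.proj]
    exact ⟨h2, (hr.mk_eq (hWj x y h1 hxA).2).symm⟩

theorem isTransversalGraph [T2Space Q] (hr : IsVerticalQuotient A r f) (hf : Continuous f)
    (hA : IsPlanarDomain A) :
    IsTransversalGraph f (r '' A) (r '' topCriticalSet Prod.fst (frontier A))
      {E | ∃ v ∈ r '' A \ r '' topCriticalSet Prod.fst (frontier A),
        E = connectedComponentIn (r '' A \ r '' topCriticalSet Prod.fst (frontier A)) v} :=
  isTransversalGraph_of_hasLocalSections hf (hr.isClosedMap _ hA.isClosed) (hr.isProperMap hf hA)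
    (hr.finite_fibre hA) (hA.finite_topCriticalSet.image r) (image_mono (topCriticalSet_subset hA))
    (hr.hasLocalSections hA)

end IsVerticalQuotient

/-! ### Valency of the vertices -/

namespace IsVerticalQuotient

variable {Q : Type*} [TopologicalSpace Q] {A : Set (ℝ × ℝ)} {r : ℝ × ℝ → Q} {f : Q → ℝ}
  {S : Set (ℝ × ℝ)} {c : ℝ}

theorem exists_forall_notMem (hr : IsVerticalQuotient A r f) (hS : S.Finite) (c : ℝ) :
    ∃ η > 0, ∀ x y, |x - c| < η → x ≠ c → r (x, y) ∉ r '' S := by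
  have hfin : (Prod.fst '' S \ {c}).Finite := (hS.image _).subset sdiff_subset
  have h1 : ∀ᶠ x in 𝓝 c, x ∉ Prod.fst '' S \ {c} :=
    hfin.isClosed.isOpen_compl.mem_nhds fun h => h.2 rfl
  obtain ⟨η, hη, h2⟩ := Metric.eventually_nhds_iff.1 h1
  refine ⟨η, hη, fun x y hx hxc => ?_⟩
  rintro ⟨z, hz, h⟩
  refine h2 hx ⟨⟨z, hz, ?_⟩, hxc⟩
  rw [← hr.proj z, h, hr.proj]

/-- The critical component is a single point, so an edge ending at its image has points coming from
the small box. These are joined to the curve `g`, whose image is connected and free of vertices; it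
lies in one edge. -/
theorem encard_le_one_of_inside (hr : IsVerticalQuotient A r f) (hS : S.Finite) {d s ε δ : ℝ}
    (hcd : (c, d) ∈ S) (hA : (c, d) ∈ A) (hs : s = 1 ∨ s = -1) (hε : 0 < ε) (hδ : 0 < δ) {g : ℝ → ℝ}
    (hg : ContinuousOn g (Ioo 0 ε)) (hgA : ∀ u ∈ Ioo 0 ε, (c + s * u, g u) ∈ A)
    (hbox : ∀ x y, |x - c| < ε → |y - d| < δ → (x, y) ∈ A →
      0 ≤ s * (x - c) ∧ (x = c → y = d) ∧ Joined A x y (g (s * (x - c)))) :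
    {e | e ∈ {E | ∃ v ∈ r '' A \ r '' S, E = connectedComponentIn (r '' A \ r '' S) v} ∧
      r (c, d) ∈ closure e}.encard ≤ 1 := by
  have hss : s * s = 1 := by rcases hs with rfl | rfl <;> norm_num
  have hsa : |s| = 1 := by rcases hs with rfl | rfl <;> norm_num
  obtain ⟨η, hη, hηS⟩ := hr.exists_forall_notMem hS c
  obtain ⟨κ, hκ, hκε, hκη⟩ : ∃ κ > 0, κ ≤ ε ∧ κ ≤ η :=
    ⟨min ε η, lt_min hε hη, min_le_left _ _, min_le_right _ _⟩
  -- A segment in `A` from `(c, d)` would contain a point of the box over `c` other than `(c, d)`;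
  -- the factor `t` brings such a point near enough.
  have hone : ∀ y, Joined A c d y → y = d := by
    intro y hj
    by_contra hne
    obtain ⟨t, ht0, ht1, htδ⟩ : ∃ t, 0 < t ∧ t ≤ 1 ∧ t * |y - d| < δ := by
      have hpos : 0 < |y - d| := abs_pos.2 (sub_ne_zero.2 hne)
      refine ⟨min 1 (δ / 2 / |y - d|), by positivity, min_le_left _ _, ?_⟩
      calc _ ≤ δ / 2 / |y - d| * |y - d| :=
            mul_le_mul_of_nonneg_right (min_le_right _ _) hpos.le
        _ = δ / 2 := div_mul_cancel₀ _ hpos.ne'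
        _ < δ := by linarith
    have hmem : d + t * (y - d) ∈ uIcc d y := by
      rw [mem_uIcc]
      rcases le_total d y with h | h
      · left; constructor <;> nlinarith
      · right; constructor <;> nlinarith
    have h1 := (hbox c _ (by simpa) (by rwa [add_sub_cancel_left, abs_mul, abs_of_pos ht0])
      (hj _ hmem)).2.1 rfl
    rw [add_eq_left, mul_eq_zero, sub_eq_zero] at h1
    exact h1.elim ht0.ne' hne
  obtain ⟨U, hU, hUW⟩ := hr.exists_nhds (v := r (c, d))
    (W := {z | |z.1 - c| < κ} ∩ {z | |z.2 - d| < δ})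
    ((isOpen_lt (by fun_prop) continuous_const).inter (isOpen_lt (by fun_prop) continuous_const))
    fun ⟨x, y⟩ h => by
      obtain ⟨h1, h2⟩ := (hr.eq_iff _ _).1 h
      obtain rfl : x = c := h1
      obtain rfl : y = d := by
        rcases h2 with h2 | h2
        · exact h2
        · exact hone y h2.symm
      simp [hκ, hδ]
  have hcurve : ∀ u ∈ Ioo 0 κ, r (c + s * u, g u) ∈ r '' A \ r '' S := fun u hu => by
    refine ⟨mem_image_of_mem r (hgA u ⟨hu.1, hu.2.trans_le hκε⟩), hηS _ _ ?_ ?_⟩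
    · rw [add_sub_cancel_left, abs_mul, hsa, one_mul, abs_of_pos hu.1]
      exact hu.2.trans_le hκη
    · intro h
      rw [add_eq_left] at h
      rcases hs with rfl | rfl <;> linarith [hu.1]
  have hpre : IsPreconnected ((fun u => r (c + s * u, g u)) '' Ioo 0 κ) := by
    refine isPreconnected_Ioo.image _ (hr.continuous.comp_continuousOn ?_)
    exact (by fun_prop : Continuous fun u : ℝ => c + s * u).continuousOn.prodMk
      (hg.mono (Ioo_subset_Ioo_right hκε))
  have hκ2 : κ / 2 ∈ Ioo 0 κ := ⟨by linarith, by linarith⟩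
  have key : ∀ e ∈ {e | e ∈ {E | ∃ v ∈ r '' A \ r '' S, E = connectedComponentIn (r '' A \ r '' S) v} ∧
      r (c, d) ∈ closure e}, e = connectedComponentIn (r '' A \ r '' S) (r (c + s * (κ / 2), g (κ / 2))) := by
    rintro _ ⟨⟨v, hv, rfl⟩, hcl⟩
    obtain ⟨w, hwU, hw⟩ := mem_closure_iff_nhds.1 hcl U hU
    obtain ⟨⟨⟨⟨x, y⟩, hxA, rfl⟩, hwS⟩, hwv⟩ := And.intro (connectedComponentIn_subset _ _ hw) hw
    obtain ⟨h1, h2⟩ : |x - c| < κ ∧ |y - d| < δ := hUW _ hwU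
    obtain ⟨h3, h4, h5⟩ := hbox x y (h1.trans_le hκε) h2 hxA
    have hxc : x ≠ c := by
      rintro rfl
      obtain rfl := h4 rfl
      exact hwS (mem_image_of_mem r hcd)
    have hu : s * (x - c) ∈ Ioo 0 κ := by
      refine ⟨lt_of_le_of_ne h3 fun h => ?_, ?_⟩
      · have : s ≠ 0 := by rintro rfl; simp at hss
        exact (mul_ne_zero this (sub_ne_zero.2 hxc)) h.symm
      · calc s * (x - c) ≤ |s * (x - c)| := le_abs_self _
          _ < κ := by rwa [abs_mul, hsa, one_mul]
    have hx : c + s * (s * (x - c)) = x := by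
      rw [← mul_assoc, hss]
      ring
    have h6 : r (x, y) ∈ (fun u => r (c + s * u, g u)) '' Ioo 0 κ :=
      ⟨_, hu, by simp only [hx]; exact (hr.mk_eq h5).symm⟩
    have h7 : r (x, y) ∈ connectedComponentIn (r '' A \ r '' S) _ := hpre.subset_connectedComponentIn (mem_image_of_mem _ hκ2)
      (image_subset_iff.2 hcurve) h6
    rw [connectedComponentIn_eq hw, ← connectedComponentIn_eq h7]
  exact encard_le_one_iff.2 fun e e' he he' => (key e he).trans (key e' he').symm

/-- The heights `y₁` and `y₂` give two edges on the side `s`, where they are separated, and `y₁`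
gives one on the other side. All three paths tend to the critical component over `c`, where the two
heights are joined. -/
theorem three_le_encard_of_outside [T2Space Q] (hr : IsVerticalQuotient A r f) (hf : Continuous f)
    (hA : IsPlanarDomain A) (hS : S = topCriticalSet Prod.fst (frontier A)) {d s ε y₁ y₂ : ℝ}
    (hcd : (c, d) ∈ S) (hs : s = 1 ∨ s = -1) (hε : 0 < ε) (hd₁ : y₁ < d) (hd₂ : d < y₂)
    (hj : Joined A c y₁ y₂) (hyA : ∀ x, |x - c| < ε → (x, y₁) ∈ A ∧ (x, y₂) ∈ A)
    (hn : ∀ x, |x - c| < ε → 0 < s * (x - c) → ¬ Joined A x y₁ y₂) :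
    3 ≤ {e | e ∈ {E | ∃ v ∈ r '' A \ r '' S, E = connectedComponentIn (r '' A \ r '' S) v} ∧
      r (c, d) ∈ closure e}.encard := by
  have hsa : |s| = 1 := by rcases hs with rfl | rfl <;> norm_num
  have hs0 : s ≠ 0 := by rintro rfl; simp at hsa
  have hSf : S.Finite := hS ▸ hA.finite_topCriticalSet
  have hY : HasLocalSections f (r '' A \ r '' S) := hS ▸ hr.hasLocalSections hA
  obtain ⟨η, hη, hηS⟩ := hr.exists_forall_notMem hSf c
  obtain ⟨κ, hκ, hκε, hκη⟩ : ∃ κ > 0, κ ≤ ε ∧ κ ≤ η :=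
    ⟨min ε η, lt_min hε hη, min_le_left _ _, min_le_right _ _⟩
  have hd : d ∈ uIcc y₁ y₂ := by rw [uIcc_of_le (hd₁.trans hd₂).le]; exact ⟨hd₁.le, hd₂.le⟩
  set Y := r '' A \ r '' S
  have habs : ∀ {t u : ℝ}, |t| = 1 → u ∈ Ioo 0 κ → |c + t * u - c| < κ ∧ c + t * u ≠ c := by
    intro t u ht hu
    refine ⟨?_, fun h => ?_⟩
    · rw [add_sub_cancel_left, abs_mul, ht, one_mul, abs_of_pos hu.1]
      exact hu.2
    · rw [add_eq_left, mul_eq_zero] at h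
      rcases h with rfl | h
      · simp at ht
      · exact hu.1.ne' h
  have hκ2 : κ / 2 ∈ Ioo 0 κ := ⟨by linarith, by linarith⟩
  have hmem : ∀ t y, |t| = 1 → y = y₁ ∨ y = y₂ → ∀ u ∈ Ioo 0 κ, r (c + t * u, y) ∈ Y := by
    intro t y ht hy u hu
    obtain ⟨h1, h2⟩ := habs ht hu
    refine ⟨mem_image_of_mem r ?_, hηS _ _ (h1.trans_le hκη) h2⟩
    rcases hy with rfl | rfl
    exacts [(hyA _ (h1.trans_le hκε)).1, (hyA _ (h1.trans_le hκε)).2]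
  have hedge : ∀ t y, |t| = 1 → y = y₁ ∨ y = y₂ →
      r (c, d) ∈ closure (connectedComponentIn Y (r (c + t * (κ / 2), y))) := by
    intro t y ht hy
    have hcont : Continuous fun u : ℝ => r (c + t * u, y) := hr.continuous.comp (by fun_prop)
    have hsub := (isPreconnected_Ioo.image _ hcont.continuousOn).subset_connectedComponentIn
      (mem_image_of_mem _ hκ2) (image_subset_iff.2 (hmem t y ht hy))
    have hv : r (c, d) = r (c + t * 0, y) := by
      rw [mul_zero, add_zero]
      rcases hy with rfl | rfl
      exacts [(hr.mk_eq (hj.of_mem hd)).symm, hr.mk_eq ((hj.of_mem hd).symm.trans hj)]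
    refine closure_mono hsub ?_
    rw [hv]
    exact image_closure_subset_closure_image hcont
      ⟨0, by rw [closure_Ioo hκ.ne]; exact ⟨le_rfl, hκ.le⟩, rfl⟩
  have h₁ := hmem s y₁ hsa (Or.inl rfl) _ hκ2
  have h₂ := hmem s y₂ hsa (Or.inr rfl) _ hκ2
  have h₃ := hmem (-s) y₁ (by rwa [abs_neg]) (Or.inl rfl) _ hκ2
  have hne : connectedComponentIn Y (r (c + s * (κ / 2), y₁)) ≠
      connectedComponentIn Y (r (c + s * (κ / 2), y₂)) := by
    intro h
    have h4 := injOn_connectedComponentIn hY h₁ (mem_connectedComponentIn h₁)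
      (h ▸ mem_connectedComponentIn h₂) (by rw [hr.proj, hr.proj])
    obtain ⟨-, h5⟩ := (hr.eq_iff _ _).1 h4
    rcases h5 with h5 | h5
    · exact (hd₁.trans hd₂).ne h5
    · refine hn _ ((habs hsa hκ2).1.trans_le hκε) ?_ h5
      rw [add_sub_cancel_left, ← mul_assoc]
      rcases hs with rfl | rfl <;> linarith
  -- An edge reaching both sides would have a point over `c`. Its closure also contains the vertex
  -- over `c`, and `f` is injective on that closure, so the point would be the vertex.
  have hside : ∀ y, y = y₁ ∨ y = y₂ → connectedComponentIn Y (r (c + s * (κ / 2), y)) ≠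
      connectedComponentIn Y (r (c + -s * (κ / 2), y₁)) := by
    intro y hy h
    have h4 := hmem s y hsa hy _ hκ2
    obtain ⟨-, hoc, -⟩ := exists_section_connectedComponentIn hf hY h4
    obtain ⟨u, hu, huc⟩ : c ∈ f '' connectedComponentIn Y (r (c + s * (κ / 2), y)) := by
      refine hoc.uIcc_subset (mem_image_of_mem f (mem_connectedComponentIn h4))
        (mem_image_of_mem f (h ▸ mem_connectedComponentIn h₃)) ?_
      rw [hr.proj, hr.proj, mem_uIcc]
      rcases hs with rfl | rfl
      · right; constructor <;> linarith
      · left; constructor <;> linarith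
    have hinj : InjOn f (closure (connectedComponentIn Y (r (c + s * (κ / 2), y)))) :=
      injOn_closure_connectedComponentIn hf (hr.isClosedMap _ hA.isClosed)
        (hr.isProperMap hf hA) (hr.finite_fibre hA) hY h4
    have h5 := hinj (subset_closure hu) (hedge s y hsa hy) (by rw [huc, hr.proj])
    refine (connectedComponentIn_subset _ _ hu).2 ?_
    rw [h5]
    exact mem_image_of_mem r hcd
  rw [← encard_eq_three.2 ⟨_, _, _, hne, hside y₁ (Or.inl rfl), hside y₂ (Or.inr rfl), rfl⟩]
  refine encard_mono ?_
  rintro e (rfl | rfl | rfl)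
  · exact ⟨⟨_, h₁, rfl⟩, hedge _ _ hsa (Or.inl rfl)⟩
  · exact ⟨⟨_, h₂, rfl⟩, hedge _ _ hsa (Or.inr rfl)⟩
  · exact ⟨⟨_, h₃, rfl⟩, hedge _ _ (by rwa [abs_neg]) (Or.inl rfl)⟩

theorem valency_ne_two [T2Space Q] (hr : IsVerticalQuotient A r f) (hf : Continuous f)
    (hA : IsPlanarDomain A) {v : Q} (hv : v ∈ r '' topCriticalSet Prod.fst (frontier A)) :
    valency {E | ∃ v ∈ r '' A \ r '' topCriticalSet Prod.fst (frontier A),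
        E = connectedComponentIn (r '' A \ r '' topCriticalSet Prod.fst (frontier A)) v} v ≠ 2 := by
  obtain ⟨⟨c, d⟩, hz, rfl⟩ := hv
  intro h
  unfold valency at h
  obtain ⟨s, hs, ε, hε, ⟨δ, hδ, g, hg, hgA, hbox⟩ | ⟨y₁, y₂, h₁, h₂, hj, hyA, hn⟩⟩ :=
    turn_of_mem hA.isClosed hA.isSurface hA.finite_topCriticalSet hz
  · have h1 := hr.encard_le_one_of_inside hA.finite_topCriticalSet hz (topCriticalSet_subset hA hz)
      hs hε hδ hg hgA hbox
    rw [h] at h1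
    exact absurd h1 (by decide)
  · have h1 := hr.three_le_encard_of_outside hf hA rfl hz hs hε h₁ h₂ hj hyA hn
    rw [h] at h1
    exact absurd h1 (by decide)

end IsVerticalQuotient

/-! ### Bands and edges -/

theorem image_connectedComponentIn_preimage {P Q : Type*} [TopologicalSpace P] [TopologicalSpace Q]
    {ρ : P → Q} (hc : Continuous ρ) (hcl : IsClosedMap ρ) (hconn : ∀ q, IsConnected (ρ ⁻¹' {q}))
    {Y : Set Q} {p : P} (hp : ρ p ∈ Y) :
    ρ '' connectedComponentIn (ρ ⁻¹' Y) p = connectedComponentIn Y (ρ p) := by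
  have hsurj : Function.Surjective ρ := fun q => (hconn q).nonempty
  refine Subset.antisymm ?_ ?_
  · exact (isPreconnected_connectedComponentIn.image _ hc.continuousOn).subset_connectedComponentIn
      (mem_image_of_mem _ (mem_connectedComponentIn hp))
      (image_subset_iff.2 (connectedComponentIn_subset _ _))
  · set E := connectedComponentIn Y (ρ p)
    have hpE : ρ p ∈ E := mem_connectedComponentIn hp
    have hE : ConnectedSpace E :=
      isConnected_iff_connectedSpace.1 (isConnected_connectedComponentIn_iff.2 hp)
    -- Restricted over the component `E`, the map is still a closed quotient map with connected
    -- fibres, so the whole preimage of `E` is connected and lies in one component upstairs.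
    have hq : IsQuotientMap (E.restrictPreimage ρ) :=
      (hcl.restrictPreimage E).isQuotientMap hc.restrictPreimage (hsurj.restrictPreimage E)
    have hfib : ∀ t : E, IsConnected (E.restrictPreimage ρ ⁻¹' {t}) := fun t => by
      have heq : Subtype.val '' (E.restrictPreimage ρ ⁻¹' {t}) = ρ ⁻¹' {t.1} := by
        ext w
        constructor
        · rintro ⟨w, hw, rfl⟩
          exact congrArg Subtype.val hw
        · intro hw
          have hw' : ρ w = t.1 := hw
          exact ⟨⟨w, by rw [mem_preimage, hw']; exact t.2⟩, Subtype.ext hw', rfl⟩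
      exact ⟨image_nonempty.1 (heq ▸ (hconn t.1).1),
        IsInducing.subtypeVal.isPreconnected_image.1 (heq ▸ (hconn t.1).2)⟩
    have h1 : IsConnected (ρ ⁻¹' E) := by
      have h2 := hq.isCoinducing.isConnected_preimage_of_isClosed hfib isClosed_univ isConnected_univ
      rw [preimage_univ] at h2
      have h3 := h2.image Subtype.val continuous_subtype_val.continuousOn
      rwa [image_univ, Subtype.range_coe] at h3
    have h4 := h1.isPreconnected.subset_connectedComponentIn hpE
      (preimage_mono (connectedComponentIn_subset Y (ρ p)))
    rw [← image_preimage_eq E hsurj]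
    exact image_mono h4

section Collapse

variable {P : Type*} [TopologicalSpace P] {π : P → ℝ} {D : Set P}

theorem collapseMap_eq_iff {p q : P} : collapseMap π D p = collapseMap π D q ↔ VertEquiv π D p q :=
  Quotient.eq

theorem vertEquiv_iff_of_mem {p q : P} (hp : p ∈ D) :
    VertEquiv π D p q ↔ q ∈ fiberComponent π D p := by
  constructor
  · rintro ⟨-, h | h⟩
    exacts [h, absurd hp h.2]
  · exact fun h => ⟨(connectedComponentIn_subset _ _ h).1.symm, Or.inl h⟩

theorem isConnected_collapseMap_fibre (q : Collapse π D) : IsConnected (collapseMap π D ⁻¹' {q}) := by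
  induction q using Quotient.inductionOn with | _ p
  have h : ∀ w, w ∈ collapseMap π D ⁻¹' {⟦p⟧} ↔ VertEquiv π D p w := fun w =>
    Iff.trans eq_comm collapseMap_eq_iff
  by_cases hp : p ∈ D
  · have : collapseMap π D ⁻¹' {⟦p⟧} = fiberComponent π D p := by
      ext w
      rw [h, vertEquiv_iff_of_mem hp]
    rw [this]
    exact isConnected_connectedComponentIn_iff.2 ⟨rfl, hp⟩
  · have : collapseMap π D ⁻¹' {⟦p⟧} = {p} := by
      ext w
      rw [h]
      constructor
      · rintro ⟨-, h | h⟩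
        · exact absurd (connectedComponentIn_nonempty_iff.1 ⟨w, h⟩).2 hp
        · exact h.1.symm
      · rintro rfl
        exact (vertEquiv_equivalence π D).refl _
    rw [this]
    exact isConnected_singleton

theorem collapseMap_mem_reebSet_iff {p : P} : collapseMap π D p ∈ reebSet π D ↔ p ∈ D := by
  refine ⟨?_, mem_image_of_mem _⟩
  rintro ⟨q, hq, h⟩
  exact (connectedComponentIn_subset _ _ ((vertEquiv_iff_of_mem hq).1 (collapseMap_eq_iff.1 h))).2

theorem collapseMap_mem_reebVertices_iff (hS : topCriticalSet π (boundaryCurve D) ⊆ D) {p : P} :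
    collapseMap π D p ∈ reebVertices π D ↔ p ∈ ⋃₀ criticalSegments π D := by
  constructor
  · rintro ⟨q, hq, h⟩
    have hqD := hS hq
    exact ⟨_, ⟨⟨q, hqD, rfl⟩, q, (vertEquiv_iff_of_mem hqD).1 ((vertEquiv_equivalence π D).refl q), hq⟩,
      (vertEquiv_iff_of_mem hqD).1 (collapseMap_eq_iff.1 h)⟩
  · rintro ⟨_, ⟨⟨w, hw, rfl⟩, q, hqw, hq⟩, hp⟩
    refine ⟨q, hq, ?_⟩
    rw [← collapseMap_eq_iff.2 ((vertEquiv_iff_of_mem hw).2 hqw),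
      collapseMap_eq_iff.2 ((vertEquiv_iff_of_mem hw).2 hp)]

theorem preimage_reebSet_diff (hS : topCriticalSet π (boundaryCurve D) ⊆ D) :
    collapseMap π D ⁻¹' (reebSet π D \ reebVertices π D) = D \ ⋃₀ criticalSegments π D := by
  ext p
  exact and_congr collapseMap_mem_reebSet_iff (not_congr (collapseMap_mem_reebVertices_iff hS))

/-- The complement of the critical segments is the preimage of the graph without its vertices, so
its components map onto the open edges. A closed continuous map commutes with closure, which turns
bands into closed edges. -/
theorem reebEdges_eq (hS : topCriticalSet π (boundaryCurve D) ⊆ D)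
    (hcl : IsClosedMap (collapseMap π D)) :
    reebEdges π D = closure '' {E | ∃ v ∈ reebSet π D \ reebVertices π D,
      E = connectedComponentIn (reebSet π D \ reebVertices π D) v} := by
  have hc : Continuous (collapseMap π D) := continuous_quotient_mk'
  have key : ∀ p, collapseMap π D p ∈ reebSet π D \ reebVertices π D →
      collapseMap π D '' closure (connectedComponentIn (D \ ⋃₀ criticalSegments π D) p) =
      closure (connectedComponentIn (reebSet π D \ reebVertices π D) (collapseMap π D p)) := by
    intro p hp
    rw [← image_connectedComponentIn_preimage hc hcl isConnected_collapseMap_fibre hp,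
      preimage_reebSet_diff hS, hcl.closure_image_eq_of_continuous hc]
  have hmem : ∀ p, collapseMap π D p ∈ reebSet π D \ reebVertices π D ↔
      p ∈ D \ ⋃₀ criticalSegments π D := fun p => by
    rw [← preimage_reebSet_diff hS]
    rfl
  ext e
  constructor
  · rintro ⟨_, ⟨p, hp, rfl⟩, rfl⟩
    exact ⟨_, ⟨_, (hmem p).2 hp, rfl⟩, (key p ((hmem p).2 hp)).symm⟩
  · rintro ⟨_, ⟨v, hv, rfl⟩, rfl⟩
    obtain ⟨p, rfl⟩ : ∃ p, collapseMap π D p = v := Quotient.exists_rep v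
    exact ⟨_, ⟨p, (hmem p).1 hv, rfl⟩, key p hv⟩

end Collapse

theorem IsTransversalGraph.closure_diff_vertices {Q : Type*} [TopologicalSpace Q] {f : Q → ℝ}
    {G V : Set Q} {E : Set (Set Q)} (h : IsTransversalGraph f G V E) {e : Set Q} (he : e ∈ E) :
    closure e \ V = e := by
  refine Subset.antisymm (fun w hw => ?_) fun w hw =>
    ⟨subset_closure hw, fun hV => disjoint_left.1 (h.disjoint_vertices e he) hw hV⟩
  by_contra hwe
  exact hw.2 (h.ends_subset e he ⟨hw.1, hwe⟩)

end PoincareReeb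

theorem mainTheorem8 {P : Type*} [TopologicalSpace P] (π : P → ℝ) (D : Set P)
    (hP : IsVerticalPlane π) (hD : IsDomainOfFiniteType π D) :
    IsVerticalPlane (collapseProj π D) ∧
    (∀ e ∈ reebEdges π D, IsClosedSegment e) ∧
    IsTransversalGraph (collapseProj π D) (reebSet π D) (reebVertices π D) (reebOpenEdges π D) ∧
    closure '' reebOpenEdges π D = reebEdges π D ∧
    (∀ v ∈ reebVertices π D, valency (reebOpenEdges π D) v ≠ 2) := by
  obtain ⟨Φ, hΦ⟩ := hP.exists_homeomorph
  obtain ⟨h, hh⟩ := hD.exists_collapse_homeomorph hΦ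
  set A := Φ.symm ⁻¹' D with hAdef
  have hA : IsPlanarDomain A := ⟨hD.isClosed.preimage Φ.symm.continuous, hD.isSurface_preimage Φ,
    hD.finite_topCriticalSet_preimage hΦ, fun K hK => hD.isCompact_preimage_inter hΦ hK⟩
  have hfst : ∀ q, (h q).1 = collapseProj π D q := fun q => by
    obtain ⟨p, rfl⟩ : ∃ p, collapseMap π D p = q := Quotient.exists_rep q
    rw [hh]
    exact hΦ p
  have hplane := isVerticalPlane_of_homeomorph h hfst
  have hT2 : T2Space (Collapse π D) := h.symm.t2Space
  have hprop := isProperMap_verticalCollapse hA.isClosed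
    (countable_frontier_fibre hA.finite_topCriticalSet) (hD.exists_bound hΦ)
  have hρ : collapseMap π D = h.symm ∘ verticalCollapse A ∘ Φ := funext fun p => by
    rw [Function.comp_apply, Function.comp_apply, ← hh, h.symm_apply_apply]
  have hcl : IsClosedMap (collapseMap π D) := by
    rw [hρ]
    exact h.symm.isClosedMap.comp (hprop.isClosedMap.comp Φ.isClosedMap)
  have hr : IsVerticalQuotient A (collapseMap π D ∘ Φ.symm) (collapseProj π D) :=
    { continuous := continuous_quotient_mk'.comp Φ.symm.continuous
      isClosedMap := hcl.comp Φ.symm.isClosedMap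
      proj := fun z => by
        rw [← hfst, Function.comp_apply, hh, Φ.apply_symm_apply]
        rfl
      eq_iff := fun z w => by
        rw [← verticalCollapse_eq_iff hA.isClosed, ← h.injective.eq_iff]
        simp only [Function.comp_apply, hh, Φ.apply_symm_apply] }
  have hG : (collapseMap π D ∘ Φ.symm) '' A = reebSet π D := by
    rw [image_comp, hAdef, image_preimage_eq _ Φ.symm.surjective]
    rfl
  have hV : (collapseMap π D ∘ Φ.symm) '' topCriticalSet Prod.fst (frontier A) =
      reebVertices π D := by
    rw [image_comp, hD.preimage_topCriticalSet hΦ, image_preimage_eq _ Φ.symm.surjective]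
    rfl
  have hS : topCriticalSet π (boundaryCurve D) ⊆ D := fun p hp => by
    obtain ⟨q, -, rfl⟩ := hp.1
    exact q.2
  have hf := hplane.continuous
  have hgraph := hr.isTransversalGraph hf hA
  have hval := fun v => hr.valency_ne_two hf hA (v := v)
  rw [hG, hV] at hgraph hval
  have hedges := reebEdges_eq hS hcl
  -- Open edges are defined by removing all vertices from an edge. Since an edge is the closure of a
  -- component and only gains vertices in it, this gives the component back.
  have hopen : reebOpenEdges π D = {E | ∃ v ∈ reebSet π D \ reebVertices π D,
      E = connectedComponentIn (reebSet π D \ reebVertices π D) v} := by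
    unfold reebOpenEdges
    rw [hedges, image_image]
    exact (image_congr fun e he => hgraph.closure_diff_vertices he).trans (image_id' _)
  rw [hopen]
  refine ⟨hplane, ?_, hgraph, hedges.symm, hval⟩
  rw [hedges]
  rintro _ ⟨e, he, rfl⟩
  exact hgraph.edge_segment e he
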